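/- **Setting.** Let $W=\langle f_1,f_2,f_3\rangle$ be a purely odd complex vector space of dimension $0|3$, $S(W)$ its reduced symmetric coalgebra, with basis $f_1^{i_1}f_2^{i_2}f_3^{i_3}$, $0\ne I=(i_1,i_2,i_3)\in\{0,1\}^3$, and $L_n=\mathrm{Hom}(S^n(W),W)$, $n\ge 1$, $L=L_1\oplus L_2\oplus L_3$. Let $\varphi^I_j\in L_{|I|}$ be the map sending the monomial with exponent $I$ to $f_j$ and all other monomials to $0$; its parity is $|I|-1$. A cochain $\varphi\in L$ is identified with the coderivation $\tilde\varphi$ of $S(W)$ it determines, $[\alpha,\beta]=\alpha\tilde\beta-(-1)^{\alpha\beta}\beta\tilde\alpha$, and a codifferential is an odd $d$ with $\tilde d^{\,2}=0$. For a codifferential $d\in L_2$ put $D(\varphi)=[\varphi,d]$, $H^n=\ker(D|_{L_n})/D(L_{n-1})$ with $L_0=0$, $h_n=\dim H^n$. A *base* is an augmented local graded-commutative $\mathbb Z_2$-graded $\mathbb C$-algebra $A$ with maximal ideal $\mathfrak m$; it is *formal* if $A=\varprojlim A/\mathfrak m^n$ and *infinitesimal* if $\mathfrak m^2=0$. A *deformation*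 of $d$ with base $A$ is an odd element $\tilde d\in L\otimes A$ whose coderivation of $S(W)\otimes A$ squares to zero and which the augmentation takes to $d$. Two codifferentials are *equivalent* ($\sim$) if they are conjugate under an (even) automorphism of the coalgebra; for deformations with base $A$ the automorphism of $S(W)\otimes A$ is required to reduce to the identity under the augmentation. A deformation $\tilde d$ with formal base $A$ is *versal* if for every deformation $\tilde d'$ with formal base $B$ there is a morphism of bases $f:A\to B$ with $f_*(\tilde d)\sim\tilde d'$, and *miniversal* if moreover $f$ is unique whenever $B$ is infinitesimal. Below, $t,t_i$ are even and $\theta_i$ odd parameters, $\mathbb C[[t,\theta]]$ is the graded-commutative power series algebra, and coefficients stand to the right of cochains, with the usual sign rule. For $\lambda\in\mathbb C$ let $\tilde d_\lambda=\varphi^{101}_1+\varphi^{011}_2\lambda$, and let $d_2=\varphi^{101}_1+\varphi^{101}_2+\varphi^{011}_2$. **Theorem.** 1. (Generic case.) If $\lambda\ne\pm1$, then $h_1=4$, $h_2=1$, $h_3=0$ for $\tilde d_\lambda$, and $$\tilde d_\lambda^1=\varphi^{101}_1+\varphi^{011}_2(\lambda+t)+\varphi^{100}_1\theta_1+\varphi^{010}_2\theta_2+\varphi^{001}_1\theta_3+\varphi^{001}_2\theta_4$$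 is a miniversal deformation of $\tilde d_\lambda$ with base $\mathbb C[[t,\theta_1,\dots,\theta_4]]/(\theta_1\theta_3,\ \theta_2\theta_4)$. 2. ($\lambda=-1$.) For $\tilde d_{-1}$ one has $h_1=4$, $h_2=2$, $h_3=1$, and the second order deformation $$\begin{aligned}\tilde d_{-1}^2={}&\varphi^{101}_1+\varphi^{011}_2(-1+t_1)+\varphi^{100}_1\theta_1+\varphi^{010}_2\theta_2+\varphi^{001}_1\theta_3+\varphi^{001}_2\theta_4+\varphi^{110}_3t_2+\varphi^{111}_3\theta_5\\&+\varphi^{011}_3\theta_3\theta_5+\varphi^{110}_2\theta_4\theta_5+\varphi^{010}_3t_2\theta_3+\varphi^{100}_3t_2\theta_4\end{aligned}$$ is a miniversal deformation of $\tilde d_{-1}$ with base $\mathbb C[[t_1,t_2,\theta_1,\dots,\theta_5]]$ modulo the relations $$\theta_1\theta_3=0,\quad \theta_2\theta_4=0,\quad t_2\theta_3\theta_4=0,\quad t_2\theta_1+t_2\theta_2=0,\quad \theta_5\theta_1+\theta_5\theta_2-t_1t_2=0.$$ If the odd parameters are neglected, the only relation is $t_1t_2=0$: a series $r\in\mathbb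 C[[t_1,t_2]]$ lies, in this base, in the ideal generated by $\theta_1,\dots,\theta_5$ if and only if $t_1t_2$ divides $r$. 3. ($\lambda=1$.) For $\tilde d_1$ one has $h_1=6$, $h_2=3$, $h_3=0$, and the infinitesimal deformation $$\begin{aligned}\tilde d_1^1={}&\varphi^{101}_1+\varphi^{011}_2+(\varphi^{101}_1-\varphi^{011}_2)t_1+\varphi^{101}_2t_2+\varphi^{011}_1t_3\\&+\varphi^{100}_1\theta_1+\varphi^{010}_2\theta_2+\varphi^{001}_1\theta_3+\varphi^{001}_2\theta_4+\varphi^{100}_2\theta_5+\varphi^{010}_1\theta_6\end{aligned}$$ is a miniversal deformation of $\tilde d_1$ with base $\mathbb C[[t_1,t_2,t_3,\theta_1,\dots,\theta_6]]$ modulo the relations $$\begin{gathered}t_3\theta_5-t_2\theta_6=0,\quad 2t_1\theta_5+t_2(\theta_2-\theta_1)=0,\quad 2t_1\theta_6+t_3(\theta_2-\theta_1)=0,\quad \theta_5\theta_6=0,\\ \theta_1\theta_3-\theta_4\theta_6=0,\quad \theta_2\theta_4-\theta_3\theta_5=0,\quad \theta_2\theta_5-\theta_1\theta_5=0,\quad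 \theta_1\theta_6-\theta_2\theta_6=0.\end{gathered}$$ For complex numbers $t_1,t_2,t_3$, the codifferential $\tilde d_1+(\varphi^{101}_1-\varphi^{011}_2)t_1+\varphi^{101}_2t_2+\varphi^{011}_1t_3$ is equivalent to $d_2$ if and only if $(t_1,t_2,t_3)\ne 0$ and $t_1^2+t_2t_3=0$. In particular each of the two extra directions $\varphi^{101}_2$ and $\varphi^{011}_1$ deforms $\tilde d_1$ into $d_2$ (and for $t_1=0$ these two punctured lines are all such deformations). -/

import Mathlib

universe u v

noncomputable section

namespace LInfinity

/-! ## Supercommutative augmented algebras: bases of deformations -/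

/-- A `ℤ/2`-grading by subspaces (`part 0` even, `part 1` odd) and an augmentation
on a `ℂ`-algebra `A` (which is not assumed commutative). -/
structure SuperAug (A : Type u) [Ring A] [Algebra ℂ A] where
  part : ZMod 2 → Submodule ℂ A
  aug : A →ₐ[ℂ] ℂ

namespace SuperAug

variable {A : Type u} [Ring A] [Algebra ℂ A]

/-- The augmentation ideal, as a subspace. -/
def maxIdeal (𝔸 : SuperAug A) : Submodule ℂ A := LinearMap.ker 𝔸.aug.toLinearMap

/-- An augmented local graded-commutative superalgebra.  As the ring is local, the kernel
of the augmentation is its maximal ideal. -/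
structure IsLocalBase (𝔸 : SuperAug A) : Prop where
  isCompl : IsCompl (𝔸.part 0) (𝔸.part 1)
  one_mem : (1 : A) ∈ 𝔸.part 0
  mul_mem : ∀ (i j : ZMod 2) (a b : A), a ∈ 𝔸.part i → b ∈ 𝔸.part j → a * b ∈ 𝔸.part (i + j)
  supercomm : ∀ (i j : ZMod 2) (a b : A), a ∈ 𝔸.part i → b ∈ 𝔸.part j →
    a * b = (-1 : A) ^ (i.val * j.val) * (b * a)
  isLocal : IsLocalRing A

/-- A local base with `𝔪² = 0`. -/
structure IsInfinitesimalBase (𝔸 : SuperAug A) : Prop extends IsLocalBase 𝔸 where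
  sq_eq_bot : 𝔸.maxIdeal ^ 2 = ⊥

/-- A local base for which the canonical map `A → lim A/𝔪ⁿ` is injective (`hausdorff`) and
surjective (`complete`). -/
structure IsFormalBase (𝔸 : SuperAug A) : Prop extends IsLocalBase 𝔸 where
  hausdorff : ∀ a : A, (∀ n : ℕ, a ∈ 𝔸.maxIdeal ^ (n + 1)) → a = 0
  complete : ∀ s : ℕ → A, (∀ n : ℕ, s (n + 1) - s n ∈ 𝔸.maxIdeal ^ (n + 1)) →
    ∃ a : A, ∀ n : ℕ, a - s n ∈ 𝔸.maxIdeal ^ (n + 1)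

end SuperAug

/-- Morphisms of bases: even unital algebra homomorphisms compatible with augmentations. -/
structure IsBaseHom {A : Type u} [Ring A] [Algebra ℂ A] {B : Type v} [Ring B] [Algebra ℂ B]
    (𝔸 : SuperAug A) (𝔹 : SuperAug B) (f : A →ₐ[ℂ] B) : Prop where
  map_part : ∀ (i : ZMod 2) (a : A), a ∈ 𝔸.part i → f a ∈ 𝔹.part i
  map_aug : ∀ a : A, 𝔹.aug (f a) = 𝔸.aug a

/-- The ground field as a (purely even) base. -/
def groundBase : SuperAug ℂ where
  part i := if i = 0 then ⊤ else ⊥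
  aug := AlgHom.id ℂ ℂ

/-! ## The symmetric coalgebra of a purely odd space `W = ⟨f₀, f₁, f₂⟩`

`S(W)` (without constants) has the basis `f_I`, the product of the `f_i`, `i ∈ I`, in increasing
order, for nonempty `I ⊆ {0, 1, 2}`; `f_I` has parity `|I|`. -/

/-- Index set of the monomial basis of `S(W)`. -/
abbrev Mono : Type := {I : Finset (Fin 3) // I.Nonempty}

/-- The parity of `f_I`. -/
def Mono.parity (I : Mono) : ZMod 2 := (I.1.card : ZMod 2)

/-- The coefficient of `f_I` in `f_J f_N`: a sign when `I` is the disjoint union of `J` and `N`,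
and zero otherwise.  If `J` and `N = I \ J` come from an unshuffle `σ` of `I`,
then this is `ε(σ)`. -/
def mulCoef (J N I : Finset (Fin 3)) : ℤ :=
  if Disjoint J N ∧ J ∪ N = I then
    (-1) ^ ((J ×ˢ N).filter fun x => x.2 < x.1).card
  else 0

/-- `L ⊗ A` for `L = Hom(S(W), W)`: the matrix `φ` stands for `∑ φ^I_j (φ j I)`, where `φ^I_j`
sends `f_I` to `f_j` and the other monomials to zero.  The element `φ^I_j` has
parity `|I| + 1`, and coefficients stand on the right. -/
abbrev Cochain (A : Type u) : Type u := Matrix (Fin 3) Mono A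

/-- The cochain `φ^I_j a`. -/
def phi {A : Type u} [Ring A] (I : Mono) (j : Fin 3) (a : A) : Cochain A := Matrix.single j I a

/-- The coderivation of `S(W) ⊗ A` associated to a cochain `φ` of total parity `p`, as the
matrix of a right `A`-linear map:
`f_I ↦ ∑_{I = J ⊔ N} ε φ(f_J) f_N`, the sum being over all unshuffles.
As the coefficient `a` of `φ^J_j` has parity `p + |J| + 1`, one has
`(φ^J_j a)(w) = φ^J_j(a w) = (-1)^{(p + |J| + 1)|w|} φ^J_j(w) a`. -/
def coder {A : Type u} [Ring A] (p : ℕ) (φ : Cochain A) : Matrix Mono Mono A :=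
  fun K I => ∑ J : Mono, ∑ N : Finset (Fin 3), ∑ j : Fin 3,
    (mulCoef J.1 N I.1 * mulCoef {j} N K.1 * (-1) ^ ((p + J.1.card + 1) * I.1.card)) • φ j J

/-! ## The differential and the cohomology over `ℂ` -/

/-- The bracket `[α, β] = α β̃ - (-1)^{pq} β α̃` of cochains of parities `p` and `q`. -/
def bracket (p q : ℕ) (α β : Cochain ℂ) : Cochain ℂ :=
  α * coder q β - (-1 : ℂ) ^ (p * q) • (β * coder p α)

theorem coder_add {A : Type u} [Ring A] (p : ℕ) (φ ψ : Cochain A) :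
    coder p (φ + ψ) = coder p φ + coder p ψ := by
  ext K I
  simp [coder, Finset.sum_add_distrib]

theorem coder_smul (p : ℕ) (c : ℂ) (φ : Cochain ℂ) :
    coder p (c • φ) = c • coder p φ := by
  ext K I
  simp only [coder, Matrix.smul_apply, Finset.smul_sum]
  refine Finset.sum_congr rfl fun J _ => Finset.sum_congr rfl fun N _ =>
    Finset.sum_congr rfl fun j _ => ?_
  exact smul_comm _ _ _

/-- `L_n = Hom(Sⁿ(W), W)`; it vanishes for `n = 0`. -/
def cochains (n : ℕ) : Submodule ℂ (Cochain ℂ) where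
  carrier := {φ | ∀ (j : Fin 3) (I : Mono), I.1.card ≠ n → φ j I = 0}
  add_mem' := by
    intro φ ψ hφ hψ j I hI
    simp [hφ j I hI, hψ j I hI]
  zero_mem' := by
    intro j I _
    rfl
  smul_mem' := by
    intro c φ hφ j I hI
    simp [hφ j I hI]

/-- `D(φ) = [φ, d]` for `φ ∈ L_n`, which has parity `n + 1`, and an odd `d`. -/
def differential (d : Cochain ℂ) (n : ℕ) : Cochain ℂ →ₗ[ℂ] Cochain ℂ where
  toFun φ := bracket (n + 1) 1 φ d
  map_add' φ ψ := by
    simp only [bracket, coder_add, Matrix.add_mul, Matrix.mul_add, smul_add]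
    abel
  map_smul' c φ := by
    simp only [bracket, coder_smul, Matrix.smul_mul, Matrix.mul_smul, RingHom.id_apply, smul_sub]
    rw [smul_comm]

/-- `Zⁿ = ker (D : L_n → L_{n+1})`. -/
def cocycles (d : Cochain ℂ) (n : ℕ) : Submodule ℂ (Cochain ℂ) :=
  cochains n ⊓ LinearMap.ker (differential d n)

/-- `Bⁿ = D(L_n)`, a subspace of `Z^{n+1}` if `d` is a codifferential. -/
def coboundaries (d : Cochain ℂ) (n : ℕ) : Submodule ℂ (Cochain ℂ) :=
  (cochains n).map (differential d n)

/-- `Hⁿ = Zⁿ / B^{n-1}`, for `n ≥ 1`; in particular `H¹ = Z¹`. -/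
abbrev Cohomology (d : Cochain ℂ) (n : ℕ) : Type :=
  cocycles d n ⧸ (coboundaries d (n - 1)).comap (cocycles d n).subtype

/-! ## `L∞` structures, coalgebra automorphisms and equivalence -/

section Structures

variable {A : Type u} [Ring A] [Algebra ℂ A]

/-- An `L∞` structure on `W ⊗ A`: an odd element of `L ⊗ A` whose coderivation squares to zero. -/
structure IsCodifferential (𝔸 : SuperAug A) (φ : Cochain A) : Prop where
  odd : ∀ (j : Fin 3) (I : Mono), φ j I ∈ 𝔸.part I.parity
  sq_eq_zero : coder 1 φ * coder 1 φ = 0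

/-- Automorphisms of the coalgebra `S(W) ⊗ A`: even invertible right `A`-linear maps
`g f_I = ∑ f_K g_{KI}` with `Δ g = (g ⊗ g) Δ`.  Here
`Δ f_I = ∑ mulCoef J N I • f_J ⊗ f_N` and
`g f_J ⊗ g f_N = ∑ (-1)^{(|J| + |P|)|Q|} f_P ⊗ f_Q g_{PJ} g_{QN}`. -/
structure IsCoalgAut (𝔸 : SuperAug A) (g : Matrix Mono Mono A) : Prop where
  even : ∀ K I : Mono, g K I ∈ 𝔸.part (K.parity + I.parity)
  comul : ∀ P Q I : Mono,
    ∑ K : Mono, mulCoef P.1 Q.1 K.1 • g K I =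
      ∑ J : Mono, ∑ N : Mono,
        (mulCoef J.1 N.1 I.1 * (-1) ^ ((J.1.card + P.1.card) * Q.1.card)) • (g P J * g Q N)
  isUnit : IsUnit g

/-- Equivalence of `L∞` structures: `φ̃' = g⁻¹ φ̃ g` for a coalgebra automorphism `g`. -/
def Equivalent (𝔸 : SuperAug A) (φ φ' : Cochain A) : Prop :=
  ∃ g : Matrix Mono Mono A, IsCoalgAut 𝔸 g ∧ coder 1 φ * g = g * coder 1 φ'

/-- Equivalence of deformations of one and the same structure: equivalence through a coalgebra
automorphism that the augmentation takes to the identity. -/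
def DefEquivalent (𝔸 : SuperAug A) (φ φ' : Cochain A) : Prop :=
  ∃ g : Matrix Mono Mono A, IsCoalgAut 𝔸 g ∧ g.map 𝔸.aug = 1 ∧
    coder 1 φ * g = g * coder 1 φ'

/-- A deformation of `d` with base `𝔸`. -/
structure IsDeformation (𝔸 : SuperAug A) (d : Cochain ℂ) (φ : Cochain A) : Prop
    extends IsCodifferential 𝔸 φ where
  reduces : φ.map 𝔸.aug = d

/-- Versal deformations: formal deformations from which every formal deformation arises, up to
equivalence, by a change of base.  The universe `v` of the test bases is arbitrary. -/
structure IsVersal (𝔸 : SuperAug A) (d : Cochain ℂ) (φ : Cochain A) : Prop where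
  formal : 𝔸.IsFormalBase
  isDeformation : IsDeformation 𝔸 d φ
  exists_hom : ∀ (B : Type v) [Ring B] [Algebra ℂ B] (𝔹 : SuperAug B), 𝔹.IsFormalBase →
    ∀ ψ : Cochain B, IsDeformation 𝔹 d ψ →
      ∃ f : A →ₐ[ℂ] B, IsBaseHom 𝔸 𝔹 f ∧ DefEquivalent 𝔹 (φ.map f) ψ

/-- Miniversal deformations: the change of base is unique when the test base is infinitesimal. -/
structure IsMiniversal (𝔸 : SuperAug A) (d : Cochain ℂ) (φ : Cochain A) : Prop
    extends IsVersal.{u, v} 𝔸 d φ where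
  unique_hom : ∀ (B : Type v) [Ring B] [Algebra ℂ B] (𝔹 : SuperAug B), 𝔹.IsInfinitesimalBase →
    ∀ ψ : Cochain B, IsDeformation 𝔹 d ψ →
      ∀ f f' : A →ₐ[ℂ] B, IsBaseHom 𝔸 𝔹 f → DefEquivalent 𝔹 (φ.map f) ψ →
        IsBaseHom 𝔸 𝔹 f' → DefEquivalent 𝔹 (φ.map f') ψ → f = f'

end Structures

/-! ## Quotients of super power series algebras -/

/-- `ℂ[[t₀, …, t_{p-1}, θ₀, …, θ_{q-1}]]` with even `t` and odd `θ`: the exterior algebra of a free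
module of rank `q` over the power series ring. -/
abbrev SuperSeries (p q : ℕ) : Type :=
  ExteriorAlgebra (MvPowerSeries (Fin p) ℂ) (Fin q → MvPowerSeries (Fin p) ℂ)

namespace SuperSeries

variable {p q : ℕ}

/-- The even variable `t_i`. -/
def t (i : Fin p) : SuperSeries p q := algebraMap (MvPowerSeries (Fin p) ℂ) _ (MvPowerSeries.X i)

/-- The odd variable `θ_i`. -/
def θ (i : Fin q) : SuperSeries p q :=
  ExteriorAlgebra.ι (MvPowerSeries (Fin p) ℂ) (Pi.single i 1)

/-- The even (`i = 0`) or odd (`i = 1`) part. -/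
def part (i : ZMod 2) : Submodule ℂ (SuperSeries p q) :=
  (CliffordAlgebra.evenOdd
    (0 : QuadraticForm (MvPowerSeries (Fin p) ℂ) (Fin q → MvPowerSeries (Fin p) ℂ))
    i).restrictScalars ℂ

/-- The augmentation, which sends a series to its constant term. -/
def aug : SuperSeries p q →ₐ[ℂ] ℂ :=
  AlgHom.comp
    { (MvPowerSeries.constantCoeff : MvPowerSeries (Fin p) ℂ →+* ℂ) with
      commutes' := fun c => by
        change MvPowerSeries.constantCoeff (algebraMap ℂ (MvPowerSeries (Fin p) ℂ) c) = c
        simp [MvPowerSeries.algebraMap_apply] }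
    ((ExteriorAlgebra.algebraMapInv :
      SuperSeries p q →ₐ[MvPowerSeries (Fin p) ℂ] MvPowerSeries (Fin p) ℂ).restrictScalars ℂ)

@[simp]
theorem aug_t (i : Fin p) : aug (t i : SuperSeries p q) = 0 := by
  change MvPowerSeries.constantCoeff (ExteriorAlgebra.algebraMapInv
    (algebraMap (MvPowerSeries (Fin p) ℂ) (SuperSeries p q) (MvPowerSeries.X i))) = 0
  rw [ExteriorAlgebra.algebraMap_leftInverse]
  simp

@[simp]
theorem aug_θ (i : Fin q) : aug (θ i : SuperSeries p q) = 0 := by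
  change MvPowerSeries.constantCoeff (ExteriorAlgebra.algebraMapInv
    (ExteriorAlgebra.ι (MvPowerSeries (Fin p) ℂ)
      (Pi.single i 1 : Fin q → MvPowerSeries (Fin p) ℂ))) = 0
  simp [ExteriorAlgebra.algebraMapInv]

/-- The quotient by the two-sided ideal generated by a set of relations. -/
abbrev RelQuot (R : Set (SuperSeries p q)) : Type := (TwoSidedIdeal.span R).ringCon.Quotient

/-- The projection to the quotient. -/
def proj (R : Set (SuperSeries p q)) : SuperSeries p q →ₐ[ℂ] RelQuot R :=
  (TwoSidedIdeal.span R).ringCon.mkₐ ℂ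

theorem ringCon_le_ker (R : Set (SuperSeries p q)) (hR : ∀ r ∈ R, aug r = 0) :
    (TwoSidedIdeal.span R).ringCon ≤
      RingCon.ker (aug : SuperSeries p q →ₐ[ℂ] ℂ).toRingHom := by
  have h : TwoSidedIdeal.span R ≤ TwoSidedIdeal.ker (aug : SuperSeries p q →ₐ[ℂ] ℂ) := by
    rw [TwoSidedIdeal.span_le]
    intro r hr
    exact (TwoSidedIdeal.mem_ker _).2 (hR r hr)
  intro x y hxy
  have hm := (TwoSidedIdeal.mem_ker _).1 (h ((TwoSidedIdeal.rel_iff _ x y).1 hxy))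
  rw [map_sub] at hm
  exact sub_eq_zero.1 hm

/-- The quotient with the induced grading and augmentation. -/
def base (R : Set (SuperSeries p q)) (hR : ∀ r ∈ R, aug r = 0) : SuperAug (RelQuot R) where
  part i := (part i).map (proj R).toLinearMap
  aug := (TwoSidedIdeal.span R).ringCon.liftₐ aug (ringCon_le_ker R hR)

end SuperSeries

/-! ## The codifferentials, their deformations and the bases

The indices `1, 2, 3` of basis vectors of `W` and of the parameters become `0, 1, 2`, … -/

def I100 : Mono := ⟨{0}, by simp⟩
def I010 : Mono := ⟨{1}, by simp⟩
def I001 : Mono := ⟨{2}, by simp⟩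
def I110 : Mono := ⟨{0, 1}, by simp⟩
def I101 : Mono := ⟨{0, 2}, by simp⟩
def I011 : Mono := ⟨{1, 2}, by simp⟩
def I111 : Mono := ⟨{0, 1, 2}, by simp⟩

/-- `d̃_λ = φ^{101}_1 + φ^{011}_2 λ`. -/
def dt (l : ℂ) : Cochain ℂ := phi I101 0 1 + phi I011 1 l

/-- `d_2 = φ^{101}_1 + φ^{101}_2 + φ^{011}_2`. -/
def d2 : Cochain ℂ := phi I101 0 1 + phi I101 1 1 + phi I011 1 1

/-- A cochain over `ℂ` viewed over `A`. -/
def ext (A : Type u) [Ring A] [Algebra ℂ A] (d : Cochain ℂ) : Cochain A := d.map (algebraMap ℂ A)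

open SuperSeries

/-- `θ₁θ₃, θ₂θ₄`. -/
def relGen : Set (SuperSeries 1 4) := {θ 0 * θ 2, θ 1 * θ 3}

theorem relGen_aug : ∀ r ∈ relGen, aug r = 0 := by
  simp [relGen]

/-- `φ^{101}_1 + φ^{011}_2 (λ + t) + φ^{100}_1 θ₁ + φ^{010}_2 θ₂ + φ^{001}_1 θ₃ + φ^{001}_2 θ₄`. -/
def defGen (l : ℂ) : Cochain (RelQuot relGen) :=
  ext _ (dt l) + phi I011 1 (proj _ (t 0))
    + phi I100 0 (proj _ (θ 0)) + phi I010 1 (proj _ (θ 1))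
    + phi I001 0 (proj _ (θ 2)) + phi I001 1 (proj _ (θ 3))

/-- `θ₁θ₃, θ₂θ₄, t₂θ₃θ₄, t₂θ₁ + t₂θ₂, θ₅θ₁ + θ₅θ₂ - t₁t₂`. -/
def relNeg : Set (SuperSeries 2 5) :=
  {θ 0 * θ 2, θ 1 * θ 3, t 1 * θ 2 * θ 3, t 1 * θ 0 + t 1 * θ 1,
    θ 4 * θ 0 + θ 4 * θ 1 - t 0 * t 1}

theorem relNeg_aug : ∀ r ∈ relNeg, aug r = 0 := by
  simp [relNeg]

/-- The universal infinitesimal deformation of `d̃_{-1}`,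
`φ^{101}_1 + φ^{011}_2 (-1 + t₁) + φ^{100}_1 θ₁ + φ^{010}_2 θ₂ + φ^{001}_1 θ₃ + φ^{001}_2 θ₄
+ φ^{110}_3 t₂ + φ^{111}_3 θ₅`, plus the second order terms
`φ^{011}_3 θ₃θ₅ + φ^{110}_2 θ₄θ₅ + φ^{010}_3 t₂θ₃ + φ^{100}_3 t₂θ₄`. -/
def defNeg : Cochain (RelQuot relNeg) :=
  ext _ (dt (-1)) + phi I011 1 (proj _ (t 0))
    + phi I100 0 (proj _ (θ 0)) + phi I010 1 (proj _ (θ 1))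
    + phi I001 0 (proj _ (θ 2)) + phi I001 1 (proj _ (θ 3))
    + phi I110 2 (proj _ (t 1)) + phi I111 2 (proj _ (θ 4))
    + phi I011 2 (proj _ (θ 2 * θ 4)) + phi I110 1 (proj _ (θ 3 * θ 4))
    + phi I010 2 (proj _ (t 1 * θ 2)) + phi I100 2 (proj _ (t 1 * θ 3))

/-- The relations on the base of the miniversal deformation of `d̃_1`. -/
def relOne : Set (SuperSeries 3 6) :=
  {t 2 * θ 4 - t 1 * θ 5,
    2 * t 0 * θ 4 + t 1 * (θ 1 - θ 0),
    2 * t 0 * θ 5 + t 2 * (θ 1 - θ 0),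
    θ 4 * θ 5,
    θ 0 * θ 2 - θ 3 * θ 5,
    θ 1 * θ 3 - θ 2 * θ 4,
    θ 1 * θ 4 - θ 0 * θ 4,
    θ 0 * θ 5 - θ 1 * θ 5}

theorem relOne_aug : ∀ r ∈ relOne, aug r = 0 := by
  simp [relOne]

/-- The universal infinitesimal deformation of `d̃_1`,
`φ^{101}_1 + φ^{011}_2 + (φ^{101}_1 - φ^{011}_2) t₁ + φ^{101}_2 t₂ + φ^{011}_1 t₃
+ φ^{100}_1 θ₁ + φ^{010}_2 θ₂ + φ^{001}_1 θ₃ + φ^{001}_2 θ₄ + φ^{100}_2 θ₅ + φ^{010}_1 θ₆`. -/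
def defOne : Cochain (RelQuot relOne) :=
  ext _ (dt 1) + (phi I101 0 (proj _ (t 0)) - phi I011 1 (proj _ (t 0)))
    + phi I101 1 (proj _ (t 1)) + phi I011 0 (proj _ (t 2))
    + phi I100 0 (proj _ (θ 0)) + phi I010 1 (proj _ (θ 1))
    + phi I001 0 (proj _ (θ 2)) + phi I001 1 (proj _ (θ 3))
    + phi I100 1 (proj _ (θ 4)) + phi I010 0 (proj _ (θ 5))

end LInfinity

end

set_option linter.unusedSectionVars false
set_option linter.unusedSimpArgs false

noncomputable section

namespace LInfinity

/-! ## Signs -/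

/-! Coderivations of `S(W) ⊗ A` are determined by their corestriction to `W`, and the square of an
odd coderivation is again a coderivation. Hence an odd cochain is a codifferential exactly when the
corestriction of its square vanishes: the Maurer–Cartan equation is a system of 21 quadratic
equations in the 21 coefficients (`coder_sq_eq_zero`, `isCodifferential_of_entries`).

Versality rests on gauge fixing. The action of even cochains at `d` is X ↦ [d, X] to first order
(`infin`), and `res` is a partial inverse of it, with res ∘ infin ∘ res = res. Conjugating a
deformation ψ by an automorphism that is 1 + res(ψ - d) to leading order pushes res(ψ - d) one step
down the 𝔪-adic filtration. Over a formal base the iteration converges, so every deformation is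
equivalent to one in the slice ker res (`exists_gauge`). Automorphisms are produced without
exponentials: 1 + coder(φ^J_j a) is an exact coalgebra map, and products of such maps suffice
(`isEnd_elementary`, `exists_autPair`).

Inside the slice the Maurer–Cartan equation can be solved. Components with an invertible coefficient
express the superfluous entries through the parameters, and the remaining components are the stated
relations (`normalForm_gen`, `normalForm_neg`, `normalForm_one`). A deformation in the slice is
therefore a choice of parameters in B satisfying the relations, that is, a morphism from the
quotient of the super power series algebra (`exists_baseHom`). The quotient is itself a formal base,
because it is a finite module over a power series ring (`isFormalBase_base`).

For uniqueness over a base with 𝔪² = 0, an equivalence is 1 + N with N a coderivation, so equivalent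
deformations differ by a value of `infin` (`DefEquivalent.exists_infin`). The parameters can be read
off modulo such values, and they determine the morphism.

Bracketing with f₃ makes `d̃_λ` act on ⟨f₁, f₂⟩ as diag(1, λ). The differential multiplies the
off-diagonal coefficients by ±(1 - λ) and the coefficient of φ^{110}_3 by -(1 + λ); this singles out
λ = ±1. Near λ = 1 the codifferential is a matrix 1 + N with N traceless, and it is equivalent to
`d2`, a Jordan block, exactly when N ≠ 0 and det N = 0. -/

theorem negOnePow_congr {a b : ℕ} (h : (a : ZMod 2) = b) : (-1 : ℤ) ^ a = (-1) ^ b := by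
  rw [neg_one_pow_eq_pow_mod_two, neg_one_pow_eq_pow_mod_two (n := b)]
  rw [(ZMod.natCast_eq_natCast_iff' a b 2).1 h]

namespace SuperAug

variable {A : Type u} [Ring A] [Algebra ℂ A] {𝔸 : SuperAug A}

namespace IsLocalBase

theorem swap (h : 𝔸.IsLocalBase) {m n : ℕ} {a b : A} (ha : a ∈ 𝔸.part m) (hb : b ∈ 𝔸.part n) :
    a * b = ((-1 : ℤ) ^ (m * n)) • (b * a) := by
  rw [h.supercomm _ _ a b ha hb, zsmul_eq_mul, Int.cast_pow, Int.cast_neg, Int.cast_one]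
  congr 1
  have key : (-1 : ℤ) ^ ((m : ZMod 2).val * (n : ZMod 2).val) = (-1) ^ (m * n) :=
    negOnePow_congr (by simp)
  exact_mod_cast congrArg (Int.cast : ℤ → A) key

theorem comm_of_even (h : 𝔸.IsLocalBase) {a b : A} (ha : a ∈ 𝔸.part 0) : a * b = b * a := by
  obtain ⟨x, hx, y, hy, rfl⟩ := Submodule.mem_sup.1
    (show b ∈ 𝔸.part 0 ⊔ 𝔸.part 1 by rw [h.isCompl.sup_eq_top]; trivial)
  rw [mul_add, add_mul, h.supercomm 0 0 a x ha hx, h.supercomm 0 1 a y ha hy]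
  simp

theorem anticomm (h : 𝔸.IsLocalBase) {a b : A} (ha : a ∈ 𝔸.part 1) (hb : b ∈ 𝔸.part 1) :
    a * b = -(b * a) := by
  rw [h.supercomm 1 1 a b ha hb]
  simp [ZMod.val_one]

theorem sq_odd (h : 𝔸.IsLocalBase) {a : A} (ha : a ∈ 𝔸.part 1) : a * a = 0 := by
  have h2 : (2 : ℂ) • (a * a) = 0 := by
    rw [two_smul]
    nth_rewrite 1 [h.anticomm ha ha]
    simp
  simpa using h2

end IsLocalBase

end SuperAug

/-! ## Matrices of homogeneous endomorphisms of `S(W) ⊗ A` and their tensor products -/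

section Tensor

variable {A : Type u} [Ring A] [Algebra ℂ A]

/-- A matrix of an endomorphism of parity `p`. -/
def HasParity (𝔸 : SuperAug A) (p : ℕ) (T : Matrix Mono Mono A) : Prop :=
  ∀ K I : Mono, T K I ∈ 𝔸.part ((p + K.1.card + I.1.card : ℕ) : ZMod 2)

/-- The matrix of `T ⊗ S` for `T` and `S` of parities `p` and `s`. -/
def tens (p s : ℕ) (T S : Matrix Mono Mono A) : Matrix (Mono × Mono) (Mono × Mono) A :=
  fun x y => ((-1 : ℤ) ^ (s * y.1.1.card + (p + x.1.1.card + y.1.1.card) * x.2.1.card)) •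
    (T x.1 y.1 * S x.2 y.2)

variable (A) in
/-- The matrix of the comultiplication. -/
def comulM : Matrix (Mono × Mono) Mono A := fun x I => ((mulCoef x.1.1 x.2.1 I.1 : ℤ) : A)

/-- The sign comes from moving an entry of S past an entry of T', so only these two factors have to
be homogeneous. The comparison of exponents takes place in `ZMod 2`, where every element is
idempotent. -/
theorem tens_mul {𝔸 : SuperAug A} (h : 𝔸.IsLocalBase) {p s p' s' : ℕ}
    {T S T' S' : Matrix Mono Mono A} (hS : HasParity 𝔸 s S) (hT' : HasParity 𝔸 p' T') :
    tens p s T S * tens p' s' T' S' =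
      ((-1 : ℤ) ^ (s * p')) • tens (p + p') (s + s') (T * T') (S * S') := by
  ext ⟨P, Q⟩ ⟨U, V⟩
  simp only [Matrix.mul_apply, Matrix.smul_apply, tens, Finset.sum_mul_sum, Finset.smul_sum,
    Fintype.sum_prod_type]
  refine Finset.sum_congr rfl fun J _ => Finset.sum_congr rfl fun N _ => ?_
  have e : T P J * S Q N * (T' J U * S' N V) =
      ((-1 : ℤ) ^ ((s + Q.1.card + N.1.card) * (p' + J.1.card + U.1.card))) •
        (T P J * T' J U * (S Q N * S' N V)) := by
    have e1 := h.swap (hS Q N) (hT' J U)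
    calc T P J * S Q N * (T' J U * S' N V) = T P J * (S Q N * T' J U) * S' N V := by
          simp only [mul_assoc]
      _ = _ := by
          rw [e1]
          simp only [mul_smul_comm, smul_mul_assoc, mul_assoc]
  rw [smul_mul_smul_comm, e, smul_smul, smul_smul, ← pow_add, ← pow_add, ← pow_add]
  congr 1
  refine negOnePow_congr ?_
  push_cast
  generalize (p : ZMod 2) = p
  generalize (s : ZMod 2) = s
  generalize (p' : ZMod 2) = p'
  generalize (s' : ZMod 2) = s'
  generalize (P.1.card : ZMod 2) = P
  generalize (Q.1.card : ZMod 2) = Q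
  generalize (J.1.card : ZMod 2) = J
  generalize (N.1.card : ZMod 2) = N
  generalize (U.1.card : ZMod 2) = U
  have h2 : (2 : ZMod 2) = 0 := rfl
  have hN : N * N = N := by revert N; decide
  have hJ : J * J = J := by revert J; decide
  linear_combination (s * J + J * Q + N * p' + N * J + N * U) * h2

variable {𝔸 : SuperAug A}

theorem tens_add_left (p s : ℕ) (T T' S : Matrix Mono Mono A) :
    tens p s (T + T') S = tens p s T S + tens p s T' S := by
  ext x y
  simp [tens, add_mul]

theorem tens_add_right (p s : ℕ) (T S S' : Matrix Mono Mono A) :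
    tens p s T (S + S') = tens p s T S + tens p s T S' := by
  ext x y
  simp [tens, mul_add]

theorem tens_one_one : tens 0 0 (1 : Matrix Mono Mono A) 1 = 1 := by
  ext ⟨P, Q⟩ ⟨J, N⟩
  by_cases h1 : P = J
  · subst h1
    by_cases h2 : Q = N
    · subst h2
      simp [tens, ← two_mul, mul_assoc]
    · rw [Matrix.one_apply_ne (by simp [h2])]
      simp [tens, Matrix.one_apply_ne h2]
  · rw [Matrix.one_apply_ne (by simp [h1])]
    simp [tens, Matrix.one_apply_ne h1]

theorem tens_congr {p p' s s' : ℕ} (hp : (p : ZMod 2) = p') (hs : (s : ZMod 2) = s')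
    (T S : Matrix Mono Mono A) : tens p s T S = tens p' s' T S := by
  ext x y
  simp only [tens]
  congr 1
  refine negOnePow_congr ?_
  push_cast
  rw [hp, hs]

theorem HasParity.mul (h : 𝔸.IsLocalBase) {p q : ℕ} {T S : Matrix Mono Mono A}
    (hT : HasParity 𝔸 p T) (hS : HasParity 𝔸 q S) : HasParity 𝔸 (p + q) (T * S) := by
  intro K I
  rw [Matrix.mul_apply]
  refine Submodule.sum_mem _ fun J _ => ?_
  have := h.mul_mem _ _ _ _ (hT K J) (hS J I)
  convert this using 1
  push_cast
  have h2 : (2 : ZMod 2) = 0 := rfl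
  congr 1
  linear_combination (-(J.1.card : ZMod 2)) * h2

theorem HasParity.one (h : 𝔸.IsLocalBase) : HasParity 𝔸 0 (1 : Matrix Mono Mono A) := by
  intro K I
  by_cases hK : K = I
  · subst hK
    have : ((0 + K.1.card + K.1.card : ℕ) : ZMod 2) = 0 := by
      have h2 : (2 : ZMod 2) = 0 := rfl
      push_cast
      linear_combination (K.1.card : ZMod 2) * h2
    rw [this, Matrix.one_apply_eq]
    exact h.one_mem
  · rw [Matrix.one_apply_ne hK]
    exact Submodule.zero_mem _

theorem HasParity.add {p : ℕ} {T S : Matrix Mono Mono A}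
    (hT : HasParity 𝔸 p T) (hS : HasParity 𝔸 p S) : HasParity 𝔸 p (T + S) :=
  fun K I => Submodule.add_mem _ (hT K I) (hS K I)

theorem HasParity.congr {p q : ℕ} (hpq : (p : ZMod 2) = q) {T : Matrix Mono Mono A}
    (hT : HasParity 𝔸 p T) : HasParity 𝔸 q T := by
  intro K I
  have := hT K I
  push_cast at this ⊢
  rwa [← hpq]

/-! ## Coderivations -/

/-- Coderivations of parity `p`. -/
def IsCoder (p : ℕ) (T : Matrix Mono Mono A) : Prop :=
  comulM A * T = (tens p 0 T 1 + tens 0 p 1 T) * comulM A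

/-- The monomial `f_j`. -/
def sing (j : Fin 3) : Mono := ⟨{j}, by simp⟩

theorem IsCoder.sub {p : ℕ} {T S : Matrix Mono Mono A} (hT : IsCoder p T) (hS : IsCoder p S) :
    IsCoder p (T - S) := by
  have e1 : tens p 0 (T - S) 1 = tens p 0 T 1 - tens p 0 S 1 := by
    ext x y
    simp [tens, sub_mul, smul_sub]
  have e2 : tens 0 p 1 (T - S) = tens 0 p 1 T - tens 0 p 1 S := by
    ext x y
    simp [tens, mul_sub, smul_sub]
  unfold IsCoder at *
  rw [Matrix.mul_sub, hT, hS, e1, e2, ← Matrix.sub_mul]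
  congr 1
  abel

/-- A monomial of degree at least two is detected by a single entry of the comultiplication: some
f_k ⊗ f_Q occurs in Δ f_K and in no other Δ f_{K'}. This allows induction on the degree of the
output. -/
theorem mulCoef_split : ∀ K : Mono, 2 ≤ K.1.card → ∃ (k : Fin 3) (Q : Mono),
    Q.1.card < K.1.card ∧ (mulCoef {k} Q.1 K.1 = 1) ∧
      ∀ K' : Mono, K' ≠ K → mulCoef {k} Q.1 K'.1 = 0 := by
  decide +kernel

theorem mono_card_one : ∀ K : Mono, K.1.card < 2 → ∃ k, K = sing k := by
  unfold sing
  decide +kernel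

/-- A coderivation is determined by its corestriction to `W`. -/
theorem IsCoder.eq_zero {p : ℕ} {T : Matrix Mono Mono A} (hT : IsCoder p T)
    (h0 : ∀ j I, T (sing j) I = 0) : T = 0 := by
  have key : ∀ n : ℕ, ∀ K : Mono, K.1.card = n → ∀ I, T K I = 0 := by
    intro n
    induction n using Nat.strong_induction_on with
    | _ n ih =>
      intro K hK I
      by_cases h2 : K.1.card < 2
      · obtain ⟨k, rfl⟩ := mono_card_one K h2
        exact h0 k I
      · obtain ⟨k, Q, hQ, h1, hK'⟩ := mulCoef_split K (not_lt.1 h2)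
        -- In the row (k, Q) of the coderivation identity the left side is `T K I` alone, and the
        -- right side involves only rows k and Q of T, which vanish by `h0` and by induction.
        have e := congrFun (congrFun hT (sing k, Q)) I
        rw [Matrix.mul_apply, Finset.sum_eq_single K, Matrix.mul_apply, Finset.sum_eq_zero] at e
        · simpa [comulM, sing, h1] using e
        · rintro ⟨J, N⟩ -
          simp [tens, h0 k J, ih _ (hK ▸ hQ) Q rfl N]
        · intro K' _ hne
          have := hK' K' hne
          simp [comulM, sing, this]
        · simp
  ext K I
  exact key _ K rfl I

theorem IsCoder.ext {p : ℕ} {T S : Matrix Mono Mono A} (hT : IsCoder p T) (hS : IsCoder p S)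
    (h : ∀ j I, T (sing j) I = S (sing j) I) : T = S :=
  sub_eq_zero.1 ((hT.sub hS).eq_zero fun j I => by simp [h j I])

/-- The coefficient of `φ^J_j` in the `(K, I)` entry of a coderivation, up to the sign rule. -/
def coderCoef (J : Mono) (j : Fin 3) (K I : Mono) : ℤ :=
  ∑ N : Finset (Fin 3), mulCoef J.1 N I.1 * mulCoef {j} N K.1

theorem coder_apply (p : ℕ) (φ : Cochain A) (K I : Mono) :
    coder p φ K I = ∑ J : Mono, ∑ j : Fin 3,
      (coderCoef J j K I * (-1) ^ ((p + J.1.card + 1) * I.1.card)) • φ j J := by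
  unfold coder coderCoef
  refine Finset.sum_congr rfl fun J _ => ?_
  rw [Finset.sum_comm]
  refine Finset.sum_congr rfl fun j _ => ?_
  rw [Finset.sum_mul, Finset.sum_smul]

theorem card_of_coderCoef_ne : ∀ (J : Mono) (j : Fin 3) (K I : Mono), coderCoef J j K I ≠ 0 →
    K.1.card + J.1.card = I.1.card + 1 := by
  decide +kernel

theorem card_of_mulCoef_ne {P Q I : Finset (Fin 3)} (h : mulCoef P Q I ≠ 0) :
    P.card + Q.card = I.card := by
  unfold mulCoef at h
  split_ifs at h with h1
  · rw [← h1.2, Finset.card_union_of_disjoint h1.1]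
  · exact absurd rfl h

end Tensor

end LInfinity

end

noncomputable section

namespace LInfinity

/-! ### The bijection between cochains and coderivations -/

section Coderivations

variable {A : Type u} [Ring A] [Algebra ℂ A] {𝔸 : SuperAug A}

/-- The derivation property of `coder`, on the level of structure constants. -/
theorem coderCoef_comul : ∀ (J : Mono) (j : Fin 3) (P Q I : Mono),
    ∑ K : Mono, mulCoef P.1 Q.1 K.1 * coderCoef J j K I =
      ∑ U : Mono, coderCoef J j P U * mulCoef U.1 Q.1 I.1 +
        (-1) ^ ((J.1.card + 1) * P.1.card) * ∑ V : Mono, coderCoef J j Q V * mulCoef P.1 V.1 I.1 := by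
  decide +kernel

theorem isCoder_zero (p : ℕ) : IsCoder p (0 : Matrix Mono Mono A) := by
  have e1 : tens p 0 (0 : Matrix Mono Mono A) 1 = 0 := by ext; simp [tens]
  have e2 : tens 0 p 1 (0 : Matrix Mono Mono A) = 0 := by ext; simp [tens]
  simp [IsCoder, e1, e2]

theorem IsCoder.add {p : ℕ} {T S : Matrix Mono Mono A} (hT : IsCoder p T) (hS : IsCoder p S) :
    IsCoder p (T + S) := by
  unfold IsCoder at *
  rw [Matrix.mul_add, hT, hS, tens_add_left, tens_add_right, ← Matrix.add_mul]
  congr 1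
  abel

theorem IsCoder.sum {p : ℕ} {ι : Type*} (s : Finset ι) {T : ι → Matrix Mono Mono A}
    (hT : ∀ i ∈ s, IsCoder p (T i)) : IsCoder p (∑ i ∈ s, T i) := by
  classical
  induction s using Finset.induction_on with
  | empty => simpa using isCoder_zero p
  | insert a s ha ih =>
    rw [Finset.sum_insert ha]
    exact (hT a (by simp)).add (ih fun i hi => hT i (by simp [hi]))

theorem coder_phi_apply (p : ℕ) (J : Mono) (j : Fin 3) (a : A) (K I : Mono) :
    coder p (phi J j a) K I =
      (coderCoef J j K I * (-1) ^ ((p + J.1.card + 1) * I.1.card)) • a := by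
  rw [coder_apply, Finset.sum_eq_single J, Finset.sum_eq_single j]
  · simp [phi]
  · intro j' _ hj
    simp [phi, Matrix.single_apply_of_row_ne hj.symm]
  · simp
  · intro J' _ hJ
    refine Finset.sum_eq_zero fun j' _ => ?_
    simp [phi, Matrix.single_apply_of_col_ne _ _ hJ.symm]
  · simp

/-- Both sides are integer multiples of `a`. Once the Koszul signs are brought to a common form, the
claim is the identity `coderCoef_comul` between structure constants. -/
theorem isCoder_coder_phi (p : ℕ) (J : Mono) (j : Fin 3) (a : A) :
    IsCoder p (coder p (phi J j a)) := by
  unfold IsCoder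
  ext ⟨P, Q⟩ I
  have lhs : (comulM A * coder p (phi J j a)) (P, Q) I =
      (∑ K : Mono, mulCoef P.1 Q.1 K.1 * coderCoef J j K I *
        (-1) ^ ((p + J.1.card + 1) * I.1.card)) • a := by
    rw [Matrix.mul_apply, Finset.sum_smul]
    refine Finset.sum_congr rfl fun K _ => ?_
    rw [coder_phi_apply, comulM, ← zsmul_eq_mul, smul_smul, mul_assoc]
  have r1 : (tens p 0 (coder p (phi J j a)) 1 * comulM A) (P, Q) I =
      (∑ U : Mono, coderCoef J j P U * mulCoef U.1 Q.1 I.1 *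
        (-1) ^ ((p + J.1.card + 1) * I.1.card)) • a := by
    rw [Matrix.mul_apply, Fintype.sum_prod_type, Finset.sum_smul]
    refine Finset.sum_congr rfl fun U _ => ?_
    rw [Finset.sum_eq_single Q]
    · simp only [tens, comulM, coder_phi_apply, Matrix.one_apply_eq, mul_one]
      rw [← zsmul_eq_mul', smul_smul, smul_smul]
      congr 1
      -- The degree counts |P| + |J| = |U| + 1 and |U| + |Q| = |I| that match the signs are
      -- available only where the structure constants are nonzero.
      by_cases h1 : coderCoef J j P U = 0
      · simp [h1]
      by_cases h2 : mulCoef U.1 Q.1 I.1 = 0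
      · simp [h2]
      have e1 := congrArg (Nat.cast : ℕ → ZMod 2) (card_of_coderCoef_ne J j P U h1)
      have e2 := congrArg (Nat.cast : ℕ → ZMod 2) (card_of_mulCoef_ne h2)
      push_cast at e1 e2
      have h3 : (2 : ZMod 2) = 0 := rfl
      have e3 : (-1 : ℤ) ^ ((p + J.1.card + 1) * I.1.card) =
          (-1) ^ (0 * U.1.card + (p + P.1.card + U.1.card) * Q.1.card +
            (p + J.1.card + 1) * U.1.card) := by
        refine negOnePow_congr ?_
        push_cast
        rw [← e2]
        linear_combination (-(Q.1.card : ZMod 2)) * e1 +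
          (Q.1.card * J.1.card - U.1.card * Q.1.card : ZMod 2) * h3
      rw [e3, pow_add]
      ring
    · intro V _ hV
      simp [tens, Matrix.one_apply_ne hV.symm]
    · simp
  have r2 : (tens 0 p 1 (coder p (phi J j a)) * comulM A) (P, Q) I =
      (∑ V : Mono, (-1) ^ ((J.1.card + 1) * P.1.card) * (coderCoef J j Q V * mulCoef P.1 V.1 I.1) *
        (-1) ^ ((p + J.1.card + 1) * I.1.card)) • a := by
    rw [Matrix.mul_apply, Fintype.sum_prod_type_right, Finset.sum_smul]
    refine Finset.sum_congr rfl fun V _ => ?_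
    rw [Finset.sum_eq_single P]
    · simp only [tens, comulM, coder_phi_apply, Matrix.one_apply_eq, one_mul]
      rw [← zsmul_eq_mul', smul_smul, smul_smul]
      congr 1
      by_cases h2 : mulCoef P.1 V.1 I.1 = 0
      · simp [h2]
      have e2 := congrArg (Nat.cast : ℕ → ZMod 2) (card_of_mulCoef_ne h2)
      push_cast at e2
      have h3 : (2 : ZMod 2) = 0 := rfl
      have e3 : (-1 : ℤ) ^ ((J.1.card + 1) * P.1.card) * (-1) ^ ((p + J.1.card + 1) * I.1.card) =
          (-1) ^ (p * P.1.card + (0 + P.1.card + P.1.card) * Q.1.card) *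
            (-1) ^ ((p + J.1.card + 1) * V.1.card) := by
        rw [← pow_add, ← pow_add]
        refine negOnePow_congr ?_
        push_cast
        rw [← e2]
        linear_combination (J.1.card * P.1.card + P.1.card - P.1.card * Q.1.card : ZMod 2) * h3
      linear_combination (-(coderCoef J j Q V * mulCoef P.1 V.1 I.1)) * e3
    · intro U _ hU
      simp [tens, Matrix.one_apply_ne hU.symm]
    · simp
  rw [lhs, Matrix.add_mul, Matrix.add_apply, r1, r2, ← add_smul]
  congr 1
  rw [← Finset.sum_mul, ← Finset.sum_mul, ← Finset.sum_mul, coderCoef_comul, ← Finset.mul_sum]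
  ring

theorem coder_eq_sum (p : ℕ) (φ : Cochain A) :
    coder p φ = ∑ J : Mono, ∑ j : Fin 3, coder p (phi J j (φ j J)) := by
  ext K I
  rw [coder_apply, Matrix.sum_apply]
  refine Finset.sum_congr rfl fun J _ => ?_
  rw [Matrix.sum_apply]
  refine Finset.sum_congr rfl fun j _ => ?_
  rw [coder_phi_apply]

theorem isCoder_coder (p : ℕ) (φ : Cochain A) : IsCoder p (coder p φ) := by
  rw [coder_eq_sum]
  exact IsCoder.sum _ fun J _ => IsCoder.sum _ fun j _ => isCoder_coder_phi p J j _

theorem coderCoef_sing : ∀ (J : Mono) (j k : Fin 3) (I : Mono),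
    coderCoef J j (sing k) I = if J = I ∧ j = k then 1 else 0 := by
  unfold sing
  decide +kernel

theorem coder_sing (p : ℕ) (φ : Cochain A) (k : Fin 3) (I : Mono) :
    coder p φ (sing k) I = ((-1 : ℤ) ^ ((p + I.1.card + 1) * I.1.card)) • φ k I := by
  rw [coder_apply, Finset.sum_eq_single I, Finset.sum_eq_single k]
  · simp [coderCoef_sing]
  · intro j _ hj
    simp [coderCoef_sing, hj]
  · simp
  · intro J _ hJ
    simp [coderCoef_sing, hJ]
  · simp

/-- The cochain of a coderivation of parity `p`. -/
def corestr (p : ℕ) (T : Matrix Mono Mono A) : Cochain A :=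
  fun k I => ((-1 : ℤ) ^ ((p + I.1.card + 1) * I.1.card)) • T (sing k) I

theorem sign_smul_sign_smul (n : ℕ) (a : A) : ((-1 : ℤ) ^ n) • ((-1 : ℤ) ^ n) • a = a := by
  rw [smul_smul, ← mul_pow]
  simp

/-- Two coderivations with the same corestriction agree, and the sign in `corestr` cancels the one
in `coder_sing`. -/
theorem IsCoder.eq_coder {p : ℕ} {T : Matrix Mono Mono A} (hT : IsCoder p T) :
    T = coder p (corestr p T) :=
  hT.ext (isCoder_coder p _) fun j I => by
    rw [coder_sing, corestr, sign_smul_sign_smul]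

theorem coder_injective (p : ℕ) : Function.Injective (coder p : Cochain A → _) := by
  intro φ ψ h
  ext k I
  have e := congrFun (congrFun h (sing k)) I
  rw [coder_sing, coder_sing] at e
  rw [← sign_smul_sign_smul ((p + I.1.card + 1) * I.1.card) (φ k I), e, sign_smul_sign_smul]

theorem hasParity_coder {p : ℕ} {φ : Cochain A}
    (hφ : ∀ j I, φ j I ∈ 𝔸.part ((p + I.1.card + 1 : ℕ) : ZMod 2)) :
    HasParity 𝔸 p (coder p φ) := by
  intro K I
  rw [coder_apply]
  refine Submodule.sum_mem _ fun J _ => Submodule.sum_mem _ fun j _ => ?_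
  by_cases h : coderCoef J j K I = 0
  · simp [h]
  have e1 := congrArg (Nat.cast : ℕ → ZMod 2) (card_of_coderCoef_ne J j K I h)
  push_cast at e1
  have h2 : (2 : ZMod 2) = 0 := rfl
  have e : ((p + K.1.card + I.1.card : ℕ) : ZMod 2) = ((p + J.1.card + 1 : ℕ) : ZMod 2) := by
    push_cast
    linear_combination e1 + (I.1.card - J.1.card : ZMod 2) * h2
  rw [e]
  exact zsmul_mem (hφ j J) _

theorem IsCodifferential.hasParity {φ : Cochain A} (hφ : IsCodifferential 𝔸 φ) :
    HasParity 𝔸 1 (coder 1 φ) := by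
  refine hasParity_coder fun j I => ?_
  have h2 : (2 : ZMod 2) = 0 := rfl
  have e : ((1 + I.1.card + 1 : ℕ) : ZMod 2) = I.parity := by
    rw [Mono.parity]
    push_cast
    linear_combination h2
  rw [e]
  exact hφ.odd j I

/-- The square of an odd coderivation is a coderivation. -/
theorem IsCoder.sq (h : 𝔸.IsLocalBase) {T : Matrix Mono Mono A} (hT : IsCoder 1 T)
    (hp : HasParity 𝔸 1 T) : IsCoder 0 (T * T) := by
  unfold IsCoder at *
  have hp0 := HasParity.one h
  -- In (T ⊗ 1 + 1 ⊗ T)² the two mixed products are T ⊗ T with opposite signs, T being odd, so they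
  -- cancel.
  rw [← Matrix.mul_assoc, hT, Matrix.mul_assoc, hT, ← Matrix.mul_assoc, Matrix.add_mul,
    Matrix.mul_add, Matrix.mul_add, tens_mul h hp0 hp, tens_mul h hp0 hp0, tens_mul h hp hp,
    tens_mul h hp hp0, tens_congr (p := 1 + 1) (p' := 0) rfl rfl,
    tens_congr (s := 1 + 1) (s' := 0) rfl rfl]
  simp

/-- An odd cochain is a codifferential when the corestriction of its square vanishes. -/
theorem coder_sq_eq_zero (h : 𝔸.IsLocalBase) {φ : Cochain A}
    (hφ : ∀ (j : Fin 3) (I : Mono), φ j I ∈ 𝔸.part I.parity)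
    (h0 : ∀ j I, (coder 1 φ * coder 1 φ) (sing j) I = 0) : coder 1 φ * coder 1 φ = 0 := by
  have hp : HasParity 𝔸 1 (coder 1 φ) := by
    refine hasParity_coder fun j I => ?_
    have h2 : (2 : ZMod 2) = 0 := rfl
    have e : ((1 + I.1.card + 1 : ℕ) : ZMod 2) = I.parity := by
      rw [Mono.parity]
      push_cast
      linear_combination h2
    rw [e]
    exact hφ j I
  exact ((isCoder_coder 1 φ).sq h hp).eq_zero h0

end Coderivations

end LInfinity

end

noncomputable section

namespace LInfinity

/-! ## Powers of the maximal ideal -/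

namespace SuperAug

variable {A : Type u} [Ring A] [Algebra ℂ A] {𝔸 : SuperAug A}

theorem mem_maxIdeal {a : A} : a ∈ 𝔸.maxIdeal ↔ 𝔸.aug a = 0 := LinearMap.mem_ker

theorem mul_mem_pow {m n : ℕ} {a b : A} (ha : a ∈ 𝔸.maxIdeal ^ m) (hb : b ∈ 𝔸.maxIdeal ^ n) :
    a * b ∈ 𝔸.maxIdeal ^ (m + n) := by
  rw [pow_add]
  exact Submodule.mul_mem_mul ha hb

theorem mul_mem_pow_left (n : ℕ) (b : A) {a : A} (ha : a ∈ 𝔸.maxIdeal ^ (n + 1)) :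
    b * a ∈ 𝔸.maxIdeal ^ (n + 1) := by
  rw [pow_succ'] at ha ⊢
  induction ha using Submodule.mul_induction_on' with
  | mem_mul_mem x hx y hy =>
    rw [← mul_assoc]
    refine Submodule.mul_mem_mul ?_ hy
    rw [mem_maxIdeal] at hx ⊢
    simp [hx]
  | add x _ y _ hx hy =>
    rw [mul_add]
    exact Submodule.add_mem _ hx hy

theorem mul_mem_pow_right (n : ℕ) (b : A) {a : A} (ha : a ∈ 𝔸.maxIdeal ^ (n + 1)) :
    a * b ∈ 𝔸.maxIdeal ^ (n + 1) := by
  rw [pow_succ] at ha ⊢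
  induction ha using Submodule.mul_induction_on' with
  | mem_mul_mem x hx y hy =>
    rw [mul_assoc]
    refine Submodule.mul_mem_mul hx ?_
    rw [mem_maxIdeal] at hy ⊢
    simp [hy]
  | add x _ y _ hx hy =>
    rw [add_mul]
    exact Submodule.add_mem _ hx hy

theorem pow_le_pow {m n : ℕ} (h : m ≤ n) : 𝔸.maxIdeal ^ (n + 1) ≤ 𝔸.maxIdeal ^ (m + 1) := by
  induction n, h using Nat.le_induction with
  | base => exact le_rfl
  | succ n _ ih =>
    refine le_trans ?_ ih
    rw [pow_succ' _ (n + 1)]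
    refine Submodule.mul_le.2 fun x _ y hy => mul_mem_pow_left n x hy

theorem mem_maxIdeal_of_mem_pow {n : ℕ} {a : A} (ha : a ∈ 𝔸.maxIdeal ^ (n + 1)) :
    𝔸.aug a = 0 := by
  have := pow_le_pow (Nat.zero_le n) ha
  rw [zero_add, pow_one] at this
  exact mem_maxIdeal.1 this

namespace IsLocalBase

/-- An odd element squares to zero, and ℂ has no nonzero nilpotents. -/
theorem aug_odd (h : 𝔸.IsLocalBase) {a : A} (ha : a ∈ 𝔸.part 1) : 𝔸.aug a = 0 := by
  have := congrArg 𝔸.aug (h.sq_odd ha)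
  simpa using this

theorem exists_decomp (h : 𝔸.IsLocalBase) (a : A) :
    ∃ x ∈ 𝔸.part 0, ∃ y ∈ 𝔸.part 1, a = x + y := by
  obtain ⟨x, hx, y, hy, rfl⟩ := Submodule.mem_sup.1
    (show a ∈ 𝔸.part 0 ⊔ 𝔸.part 1 by rw [h.isCompl.sup_eq_top]; trivial)
  exact ⟨x, hx, y, hy, rfl⟩

theorem eq_zero_of_mem (h : 𝔸.IsLocalBase) {a : A} (h0 : a ∈ 𝔸.part 0) (h1 : a ∈ 𝔸.part 1) :
    a = 0 := by
  have : a ∈ 𝔸.part 0 ⊓ 𝔸.part 1 := ⟨h0, h1⟩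
  rwa [h.isCompl.inf_eq_bot] at this

/-- Powers of 𝔪 are graded: odd elements lie in 𝔪 automatically, so both components of an element of
𝔪 lie in 𝔪, and products are regrouped by parity. -/
theorem exists_decomp_pow (h : 𝔸.IsLocalBase) (n : ℕ) {a : A} (ha : a ∈ 𝔸.maxIdeal ^ (n + 1)) :
    ∃ x ∈ 𝔸.part 0 ⊓ 𝔸.maxIdeal ^ (n + 1), ∃ y ∈ 𝔸.part 1 ⊓ 𝔸.maxIdeal ^ (n + 1),
      a = x + y := by
  induction n generalizing a with
  | zero =>
    rw [zero_add, pow_one] at *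
    obtain ⟨x, hx, y, hy, rfl⟩ := h.exists_decomp a
    have hy0 := h.aug_odd hy
    rw [mem_maxIdeal, map_add, hy0, add_zero] at ha
    exact ⟨x, ⟨hx, mem_maxIdeal.2 ha⟩, y, ⟨hy, mem_maxIdeal.2 hy0⟩, rfl⟩
  | succ n ih =>
    rw [pow_succ] at ha
    induction ha using Submodule.mul_induction_on' with
    | mem_mul_mem x hx y hy =>
      obtain ⟨x0, hx0, x1, hx1, rfl⟩ := ih hx
      obtain ⟨y0, hy0, y1, hy1, rfl⟩ := h.exists_decomp y
      have hy1' := h.aug_odd hy1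
      rw [mem_maxIdeal, map_add, hy1', add_zero] at hy
      have hy0m := mem_maxIdeal.2 hy
      have hy1m := mem_maxIdeal.2 hy1'
      rw [pow_succ _ (n + 1)]
      refine ⟨x0 * y0 + x1 * y1, ⟨?_, ?_⟩, x0 * y1 + x1 * y0, ⟨?_, ?_⟩, ?_⟩
      · exact Submodule.add_mem _ (h.mul_mem 0 0 _ _ hx0.1 hy0) (h.mul_mem 1 1 _ _ hx1.1 hy1)
      · exact Submodule.add_mem _ (Submodule.mul_mem_mul hx0.2 hy0m)
          (Submodule.mul_mem_mul hx1.2 hy1m)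
      · exact Submodule.add_mem _ (h.mul_mem 0 1 _ _ hx0.1 hy1) (h.mul_mem 1 0 _ _ hx1.1 hy0)
      · exact Submodule.add_mem _ (Submodule.mul_mem_mul hx0.2 hy1m)
          (Submodule.mul_mem_mul hx1.2 hy0m)
      · simp only [mul_add, add_mul]
        abel
    | add x _ y _ hx hy =>
      obtain ⟨x0, hx0, x1, hx1, rfl⟩ := hx
      obtain ⟨y0, hy0, y1, hy1, rfl⟩ := hy
      exact ⟨x0 + y0, Submodule.add_mem _ hx0 hy0, x1 + y1, Submodule.add_mem _ hx1 hy1, by abel⟩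

end IsLocalBase

namespace IsFormalBase

/-- The homogeneous parts are closed. -/
theorem mem_part_of_limit (h : 𝔸.IsFormalBase) (i : ZMod 2) {a : A}
    (ha : ∀ n : ℕ, ∃ b ∈ 𝔸.part i, a - b ∈ 𝔸.maxIdeal ^ (n + 1)) : a ∈ 𝔸.part i := by
  have hl := h.toIsLocalBase
  obtain ⟨x, hx, y, hy, rfl⟩ := hl.exists_decomp a
  -- If a homogeneous `b` approximates x + y modulo a power of 𝔪, then the component of the other
  -- parity lies in that power, since powers of 𝔪 are graded. When this happens for all n, that
  -- component vanishes.
  have key : ∀ n, ∀ b, x + y - b ∈ 𝔸.maxIdeal ^ (n + 1) →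
      (b ∈ 𝔸.part 0 → y ∈ 𝔸.maxIdeal ^ (n + 1)) ∧ (b ∈ 𝔸.part 1 → x ∈ 𝔸.maxIdeal ^ (n + 1)) := by
    intro n b hb
    obtain ⟨u, hu, w, hw, e⟩ := hl.exists_decomp_pow n hb
    refine ⟨fun h0 => ?_, fun h1 => ?_⟩
    · have e1 : x - b - u = w - y := by
        rw [sub_eq_sub_iff_add_eq_add, add_comm w u, ← e]
        abel
      have := hl.eq_zero_of_mem (Submodule.sub_mem _ (Submodule.sub_mem _ hx h0) hu.1)
        (e1 ▸ Submodule.sub_mem _ hw.1 hy)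
      rw [e1, sub_eq_zero] at this
      exact this ▸ hw.2
    · have e1 : x - u = w - y + b := by
        rw [eq_comm, ← sub_eq_iff_eq_add'.2 e]
        abel
      have := hl.eq_zero_of_mem (Submodule.sub_mem _ hx hu.1)
        (e1 ▸ Submodule.add_mem _ (Submodule.sub_mem _ hw.1 hy) h1)
      rw [sub_eq_zero] at this
      exact this ▸ hu.2
  obtain rfl | rfl : i = 0 ∨ i = 1 := (show ∀ i : ZMod 2, i = 0 ∨ i = 1 by decide) i
  · have : y = 0 := h.hausdorff y fun n => by
      obtain ⟨b, hb, hb'⟩ := ha n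
      exact (key n b hb').1 hb
    simpa [this] using hx
  · have : x = 0 := h.hausdorff x fun n => by
      obtain ⟨b, hb, hb'⟩ := ha n
      exact (key n b hb').2 hb
    simpa [this] using hy

end IsFormalBase

/-- In a local base, elements with nonzero augmentation are units. -/
theorem IsLocalBase.isUnit (h : 𝔸.IsLocalBase) {a : A} (ha : 𝔸.aug a ≠ 0) : IsUnit a := by
  by_contra hu
  have := h.isLocal
  -- A nonunit `a` plus the element aug(a) - a, which the augmentation kills, would be a nonunit in
  -- a local ring; but the sum is a nonzero scalar.
  have h1 : a + (algebraMap ℂ A (𝔸.aug a) - a) ∈ nonunits A := by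
    refine IsLocalRing.nonunits_add hu ?_
    intro h2
    have h3 := h2.map 𝔸.aug
    simp at h3
  rw [add_sub_cancel] at h1
  exact h1 ((isUnit_iff_ne_zero.2 ha).map (algebraMap ℂ A))

theorem IsLocalBase.eq_zero_of_mul (h : 𝔸.IsLocalBase) {a b : A} (ha : 𝔸.aug a ≠ 0)
    (hab : a * b = 0) : b = 0 :=
  (h.isUnit ha).mul_right_eq_zero.1 hab

/-- Congruence of matrices modulo a power of the maximal ideal. -/
def EqMod (𝔸 : SuperAug A) (n : ℕ) {ι κ : Type*} (M N : Matrix ι κ A) : Prop :=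
  ∀ i j, M i j - N i j ∈ 𝔸.maxIdeal ^ (n + 1)

namespace EqMod

variable {ι κ μ : Type*} {n : ℕ}

theorem refl (M : Matrix ι κ A) : EqMod 𝔸 n M M := fun i j => by simp

theorem symm {M N : Matrix ι κ A} (h : EqMod 𝔸 n M N) : EqMod 𝔸 n N M := fun i j => by
  rw [← neg_sub]
  exact Submodule.neg_mem _ (h i j)

theorem trans {M N P : Matrix ι κ A} (h : EqMod 𝔸 n M N) (h' : EqMod 𝔸 n N P) :
    EqMod 𝔸 n M P := fun i j => by
  rw [← sub_add_sub_cancel _ (N i j)]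
  exact Submodule.add_mem _ (h i j) (h' i j)

theorem mono {m : ℕ} (hmn : m ≤ n) {M N : Matrix ι κ A} (h : EqMod 𝔸 n M N) : EqMod 𝔸 m M N :=
  fun i j => pow_le_pow hmn (h i j)

theorem add {M N M' N' : Matrix ι κ A} (h : EqMod 𝔸 n M N) (h' : EqMod 𝔸 n M' N') :
    EqMod 𝔸 n (M + M') (N + N') := fun i j => by
  rw [Matrix.add_apply, Matrix.add_apply, add_sub_add_comm]
  exact Submodule.add_mem _ (h i j) (h' i j)

theorem sub {M N M' N' : Matrix ι κ A} (h : EqMod 𝔸 n M N) (h' : EqMod 𝔸 n M' N') :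
    EqMod 𝔸 n (M - M') (N - N') := fun i j => by
  rw [Matrix.sub_apply, Matrix.sub_apply, sub_sub_sub_comm]
  exact Submodule.sub_mem _ (h i j) (h' i j)

theorem mul [Fintype κ] {M N : Matrix ι κ A} {M' N' : Matrix κ μ A} (h : EqMod 𝔸 n M N)
    (h' : EqMod 𝔸 n M' N') : EqMod 𝔸 n (M * M') (N * N') := fun i j => by
  rw [Matrix.mul_apply, Matrix.mul_apply, ← Finset.sum_sub_distrib]
  refine Submodule.sum_mem _ fun k _ => ?_
  have : M i k * M' k j - N i k * N' k j =
      (M i k - N i k) * M' k j + N i k * (M' k j - N' k j) := by noncomm_ring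
  rw [this]
  exact Submodule.add_mem _ (mul_mem_pow_right n _ (h i k)) (mul_mem_pow_left n _ (h' k j))

/-- Products of small matrices are smaller. -/
theorem mul_zero [Fintype κ] {m : ℕ} {M : Matrix ι κ A} {N : Matrix κ μ A} (h : EqMod 𝔸 m M 0)
    (h' : EqMod 𝔸 n N 0) : EqMod 𝔸 (m + n + 1) (M * N) 0 := fun i j => by
  rw [Matrix.mul_apply, Matrix.zero_apply, sub_zero]
  refine Submodule.sum_mem _ fun k _ => ?_
  have := mul_mem_pow (h i k) (h' k j)
  simp only [Matrix.zero_apply, sub_zero] at this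
  convert this using 2
  ring

theorem sub_zero_iff {M N : Matrix ι κ A} : EqMod 𝔸 n (M - N) 0 ↔ EqMod 𝔸 n M N := by
  simp [EqMod]

theorem eq_of_forall (hf : 𝔸.IsFormalBase) {M N : Matrix ι κ A} (h : ∀ n, EqMod 𝔸 n M N) :
    M = N := by
  ext i j
  exact sub_eq_zero.1 (hf.hausdorff _ fun n => h n i j)

end EqMod

theorem EqMod.exists_limit (hf : 𝔸.IsFormalBase) {ι κ : Type*} (M : ℕ → Matrix ι κ A)
    (hM : ∀ n, EqMod 𝔸 n (M (n + 1)) (M n)) : ∃ L : Matrix ι κ A, ∀ n, EqMod 𝔸 n L (M n) := by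
  choose L hL using fun i j => hf.complete (fun n => M n i j) fun n => hM n i j
  exact ⟨L, fun n i j => hL i j n⟩

end SuperAug

/-! ## Automorphisms -/

section Automorphisms

variable {A : Type u} [Ring A] [Algebra ℂ A] {𝔸 : SuperAug A}

/-- An even endomorphism of the coalgebra `S(W) ⊗ A`. -/
structure IsEnd (𝔸 : SuperAug A) (g : Matrix Mono Mono A) : Prop where
  even : HasParity 𝔸 0 g
  comul : comulM A * g = tens 0 0 g g * comulM A

theorem isEnd_iff (g : Matrix Mono Mono A) :
    comulM A * g = tens 0 0 g g * comulM A ↔ ∀ P Q I : Mono,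
    ∑ K : Mono, mulCoef P.1 Q.1 K.1 • g K I =
      ∑ J : Mono, ∑ N : Mono,
        (mulCoef J.1 N.1 I.1 * (-1) ^ ((J.1.card + P.1.card) * Q.1.card)) •
          (g P J * g Q N) := by
  have key : ∀ P Q I : Mono, (comulM A * g) (P, Q) I = ∑ K : Mono, mulCoef P.1 Q.1 K.1 • g K I := by
    intro P Q I
    simp [Matrix.mul_apply, comulM]
  have key2 : ∀ P Q I : Mono, (tens 0 0 g g * comulM A) (P, Q) I = ∑ J : Mono, ∑ N : Mono,
        (mulCoef J.1 N.1 I.1 * (-1) ^ ((J.1.card + P.1.card) * Q.1.card)) •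
          (g P J * g Q N) := by
    intro P Q I
    rw [Matrix.mul_apply, Fintype.sum_prod_type]
    refine Finset.sum_congr rfl fun J _ => Finset.sum_congr rfl fun N _ => ?_
    simp only [comulM, tens]
    rw [← zsmul_eq_mul', smul_smul, zero_mul, zero_add, zero_add, add_comm P.1.card]
  constructor
  · intro h P Q I
    rw [← key, ← key2, h]
  · intro h
    ext ⟨P, Q⟩ I
    rw [key, key2, h]

theorem hasParity_zero_iff (g : Matrix Mono Mono A) :
    HasParity 𝔸 0 g ↔ ∀ K I : Mono, g K I ∈ 𝔸.part (K.parity + I.parity) := by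
  simp [HasParity, Mono.parity]

theorem IsEnd.isCoalgAut {g : Matrix Mono Mono A} (hg : IsEnd 𝔸 g) (hu : IsUnit g) :
    IsCoalgAut 𝔸 g :=
  ⟨(hasParity_zero_iff g).1 hg.even, (isEnd_iff g).1 hg.comul, hu⟩

theorem IsCoalgAut.isEnd {g : Matrix Mono Mono A} (hg : IsCoalgAut 𝔸 g) : IsEnd 𝔸 g :=
  ⟨(hasParity_zero_iff g).2 hg.even, (isEnd_iff g).2 hg.comul⟩

theorem IsEnd.one (h : 𝔸.IsLocalBase) : IsEnd 𝔸 1 :=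
  ⟨HasParity.one h, by rw [tens_one_one, Matrix.mul_one, Matrix.one_mul]⟩

theorem IsEnd.mul (h : 𝔸.IsLocalBase) {g k : Matrix Mono Mono A} (hg : IsEnd 𝔸 g)
    (hk : IsEnd 𝔸 k) : IsEnd 𝔸 (g * k) where
  even := hg.even.mul h hk.even
  comul := by
    have := tens_mul h (p := 0) (s' := 0) (T := g) (S' := k) hg.even hk.even
    simp only [mul_zero, pow_zero, one_smul, add_zero] at this
    rw [← this, ← Matrix.mul_assoc, hg.comul, Matrix.mul_assoc, hk.comul, Matrix.mul_assoc]

/-- A pair of mutually inverse automorphisms of `S(W) ⊗ A`. -/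
structure AutPair (𝔸 : SuperAug A) (g g' : Matrix Mono Mono A) : Prop where
  left : IsEnd 𝔸 g
  right : IsEnd 𝔸 g'
  mul_inv : g * g' = 1
  inv_mul : g' * g = 1

theorem AutPair.one (h : 𝔸.IsLocalBase) : AutPair 𝔸 1 1 :=
  ⟨IsEnd.one h, IsEnd.one h, one_mul 1, one_mul 1⟩

theorem AutPair.mul (h : 𝔸.IsLocalBase) {g g' k k' : Matrix Mono Mono A} (hg : AutPair 𝔸 g g')
    (hk : AutPair 𝔸 k k') : AutPair 𝔸 (g * k) (k' * g') where
  left := hg.left.mul h hk.left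
  right := hk.right.mul h hg.right
  mul_inv := by rw [mul_assoc, ← mul_assoc k, hk.mul_inv, one_mul, hg.mul_inv]
  inv_mul := by rw [mul_assoc, ← mul_assoc g', hg.inv_mul, one_mul, hk.inv_mul]

theorem AutPair.isCoalgAut {g g' : Matrix Mono Mono A} (hg : AutPair 𝔸 g g') : IsCoalgAut 𝔸 g :=
  hg.left.isCoalgAut ⟨⟨g, g', hg.mul_inv, hg.inv_mul⟩, rfl⟩

/-- Conjugates of odd coderivations are odd coderivations. -/
theorem AutPair.conj_isCoder (h : 𝔸.IsLocalBase) {g g' T : Matrix Mono Mono A}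
    (hg : AutPair 𝔸 g g') (hT : IsCoder 1 T) (hp : HasParity 𝔸 1 T) :
    IsCoder 1 (g * T * g') ∧ HasParity 𝔸 1 (g * T * g') := by
  have hp0 := HasParity.one h
  have hTg : HasParity 𝔸 1 (T * g') := hp.mul h hg.right.even
  refine ⟨?_, ((hg.left.even.mul h hp).mul h hg.right.even).congr rfl⟩
  unfold IsCoder at *
  -- Conjugation by g ⊗ g treats the summands T ⊗ 1 and 1 ⊗ T separately, and no signs appear
  -- because g is even.
  have e1 : tens 0 0 g g * tens 1 0 T 1 * tens 0 0 g' g' = tens 1 0 (g * T * g') 1 := by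
    rw [tens_mul h hg.left.even hp, zero_mul, pow_zero, one_smul, mul_one,
      tens_mul h (hg.left.even.congr rfl) hg.right.even, hg.mul_inv]
    simp
  have e2 : tens 0 0 g g * tens 0 1 1 T * tens 0 0 g' g' = tens 0 1 1 (g * T * g') := by
    rw [tens_mul h hg.left.even hp0, zero_mul, pow_zero, one_smul, mul_one,
      tens_mul h ((hg.left.even.mul h hp).congr rfl) hg.right.even, hg.mul_inv]
    simp
  rw [← e1, ← e2, ← Matrix.mul_assoc, ← Matrix.mul_assoc, hg.left.comul,
    Matrix.mul_assoc (tens 0 0 g g), hT, Matrix.mul_assoc, Matrix.mul_assoc, Matrix.mul_assoc,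
    hg.right.comul]
  simp only [Matrix.mul_assoc, Matrix.mul_add, Matrix.add_mul]

/-- Applying φ^J_j replaces the factor f_J by f_j. At most f_j is then left of f_J, so a second
application gives zero unless J = {j}, in which case the map is an idempotent up to its coefficient.
-/
theorem coderCoef_sq : ∀ (J : Mono) (j : Fin 3) (K I : Mono),
    ∑ M : Mono, coderCoef J j K M * (-1) ^ ((J.1.card + 1) * M.1.card) *
      (coderCoef J j M I * (-1) ^ ((J.1.card + 1) * I.1.card)) =
      if J = sing j then coderCoef J j K I else 0 := by
  unfold sing
  decide +kernel

theorem card_sing (j : Fin 3) : (sing j).1.card = 1 := by simp [sing]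

theorem coder_phi_mul (J : Mono) (j : Fin 3) (a b : A) :
    coder 0 (phi J j a) * coder 0 (phi J j b) =
      if J = sing j then coder 0 (phi J j (a * b)) else 0 := by
  ext K I
  have := coderCoef_sq J j K I
  have e : (coder 0 (phi J j a) * coder 0 (phi J j b)) K I =
      (if J = sing j then coderCoef J j K I else 0) • (a * b) := by
    rw [← this, Matrix.mul_apply, Finset.sum_smul]
    refine Finset.sum_congr rfl fun M _ => ?_
    rw [coder_phi_apply, coder_phi_apply, smul_mul_smul_comm, zero_add]
  rw [e]
  split_ifs with h
  · rw [coder_phi_apply, h, card_sing]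
    congr 1
    simp [pow_mul]
  · simp

theorem phi_apply (J : Mono) (j : Fin 3) (a : A) (k : Fin 3) (I : Mono) :
    phi J j a k I = if j = k ∧ J = I then a else 0 := Matrix.single_apply _ _ _ _ _

theorem hasParity_coder_phi {J : Mono} {j : Fin 3} {a : A}
    (ha : a ∈ 𝔸.part ((J.1.card + 1 : ℕ) : ZMod 2)) : HasParity 𝔸 0 (coder 0 (phi J j a)) := by
  refine hasParity_coder fun k I => ?_
  rw [phi_apply]
  split_ifs with h
  · rw [← h.2, zero_add]
    exact ha
  · exact Submodule.zero_mem _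

/-- Elementary coalgebra automorphisms. -/
theorem isEnd_elementary (h : 𝔸.IsLocalBase) {J : Mono} {j : Fin 3} {a : A}
    (ha : a ∈ 𝔸.part ((J.1.card + 1 : ℕ) : ZMod 2)) :
    IsEnd 𝔸 (1 + coder 0 (phi J j a)) := by
  set X := coder 0 (phi J j a) with hX
  have hp : HasParity 𝔸 0 X := hasParity_coder_phi ha
  have hp0 := HasParity.one h
  have hc : IsCoder 0 X := isCoder_coder 0 _
  -- By `coder_phi_mul` the square of X is again a coderivation. Comparing this with Δ X² = (X ⊗ 1 +
  -- 1 ⊗ X)² Δ leaves 2 (X ⊗ X) Δ = 0, which is exactly the term by which 1 + X could fail to be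
  -- multiplicative for Δ.
  have key : tens 0 0 X X * comulM A = 0 := by
    have e1 : comulM A * (X * X) =
        (tens 0 0 (X * X) 1 + (2 : ℂ) • tens 0 0 X X + tens 0 0 1 (X * X)) * comulM A := by
      rw [← Matrix.mul_assoc, hc, Matrix.mul_assoc, hc, ← Matrix.mul_assoc, Matrix.add_mul,
        Matrix.mul_add, Matrix.mul_add, tens_mul h hp0 hp, tens_mul h hp0 hp0, tens_mul h hp hp,
        tens_mul h hp hp0, two_smul]
      simp only [mul_zero, pow_zero, one_smul, add_zero, mul_one, one_mul]
      congr 1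
      abel
    have e2 : comulM A * (X * X) = (tens 0 0 (X * X) 1 + tens 0 0 1 (X * X)) * comulM A := by
      have : IsCoder 0 (X * X) := by
        rw [hX, coder_phi_mul]
        split_ifs
        · exact isCoder_coder 0 _
        · exact isCoder_zero 0
      exact this
    rw [e1, Matrix.add_mul, Matrix.add_mul, Matrix.add_mul] at e2
    have e3 : ((2 : ℂ) • tens 0 0 X X) * comulM A = 0 := by
      have := sub_eq_zero.2 e2
      rw [← this]
      abel
    rw [Matrix.smul_mul] at e3
    simpa using e3
  refine ⟨hp0.add hp, ?_⟩
  rw [Matrix.mul_add, hc, tens_add_left, tens_add_right, tens_add_right, tens_one_one]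
  simp only [Matrix.add_mul, Matrix.mul_one, Matrix.one_mul, key]
  abel

theorem coder_zero' (p : ℕ) : coder p (0 : Cochain A) = 0 := by
  ext K I
  simp [coder]

theorem phi_add (J : Mono) (j : Fin 3) (a b : A) : phi J j (a + b) = phi J j a + phi J j b :=
  Matrix.single_add _ _ _ _

theorem phi_zero (J : Mono) (j : Fin 3) : phi J j (0 : A) = 0 := Matrix.single_zero _ _

/-- Two elementary automorphisms are mutually inverse if their coefficients match. -/
theorem autPair_elementary (h : 𝔸.IsLocalBase) {J : Mono} {j : Fin 3} {a b : A}
    (ha : a ∈ 𝔸.part ((J.1.card + 1 : ℕ) : ZMod 2)) (hb : b ∈ 𝔸.part ((J.1.card + 1 : ℕ) : ZMod 2))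
    (hab : a + b + (if J = sing j then a * b else 0) = 0)
    (hba : a + b + (if J = sing j then b * a else 0) = 0) :
    AutPair 𝔸 (1 + coder 0 (phi J j a)) (1 + coder 0 (phi J j b)) := by
  have key : ∀ a b : A, a + b + (if J = sing j then a * b else 0) = 0 →
      (1 + coder 0 (phi J j a)) * (1 + coder 0 (phi J j b)) = 1 := by
    intro a b hab
    have : (if J = sing j then coder 0 (phi J j (a * b)) else 0) =
        coder 0 (phi J j (if J = sing j then a * b else 0)) := by
      split_ifs
      · rfl
      · rw [phi_zero, coder_zero']
    rw [mul_add, add_mul, add_mul, coder_phi_mul, this]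
    have e := congrArg (fun x => coder 0 (phi J j x)) hab
    simp only [phi_add, coder_add, phi_zero, coder_zero'] at e
    rw [mul_one, mul_one, one_mul, add_assoc, ← add_assoc (coder 0 (phi J j a)), e, add_zero]
  exact ⟨isEnd_elementary h ha, isEnd_elementary h hb, key a b hab,
    key b a (by rw [add_comm b a]; exact hba)⟩

end Automorphisms

end LInfinity

end

noncomputable section

namespace LInfinity

/-! ## Gauge fixing -/

section Slice

open SuperAug

variable {A : Type u} [Ring A] [Algebra ℂ A] {𝔸 : SuperAug A}

theorem SuperAug.EqMod.coder {n : ℕ} {φ ψ : Cochain A} (p : ℕ) (h : EqMod 𝔸 n φ ψ) :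
    EqMod 𝔸 n (coder p φ) (LInfinity.coder p ψ) := fun K I => by
  rw [coder_apply, coder_apply, ← Finset.sum_sub_distrib]
  refine Submodule.sum_mem _ fun J _ => ?_
  rw [← Finset.sum_sub_distrib]
  refine Submodule.sum_mem _ fun j _ => ?_
  rw [← smul_sub]
  exact zsmul_mem (h j J) _

theorem SuperAug.EqMod.corestr {n : ℕ} {T S : Matrix Mono Mono A} (p : ℕ) (h : EqMod 𝔸 n T S) :
    EqMod 𝔸 n (corestr p T) (LInfinity.corestr p S) := fun j I => by
  simp only [LInfinity.corestr]
  rw [← smul_sub]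
  exact zsmul_mem (h _ I) _

theorem SuperAug.EqMod.tens {n p s : ℕ} {T S T' S' : Matrix Mono Mono A} (h : EqMod 𝔸 n T T')
    (h' : EqMod 𝔸 n S S') : EqMod 𝔸 n (tens p s T S) (LInfinity.tens p s T' S') := fun x y => by
  simp only [LInfinity.tens]
  rw [← smul_sub]
  refine zsmul_mem ?_ _
  have : T x.1 y.1 * S x.2 y.2 - T' x.1 y.1 * S' x.2 y.2 =
      (T x.1 y.1 - T' x.1 y.1) * S x.2 y.2 + T' x.1 y.1 * (S x.2 y.2 - S' x.2 y.2) := by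
    noncomm_ring
  rw [this]
  exact Submodule.add_mem _ (mul_mem_pow_right n _ (h _ _)) (mul_mem_pow_left n _ (h' _ _))

theorem corestr_coder (p : ℕ) (φ : Cochain A) : corestr p (coder p φ) = φ :=
  coder_injective p (isCoder_coder p φ).eq_coder.symm

theorem corestr_add (p : ℕ) (T S : Matrix Mono Mono A) :
    corestr p (T + S) = corestr p T + corestr p S := by
  ext j I
  simp [corestr]

theorem corestr_sub (p : ℕ) (T S : Matrix Mono Mono A) :
    corestr p (T - S) = corestr p T - corestr p S := by
  ext j I
  simp [corestr, smul_sub]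

/-- A cochain with small coefficients integrates to an automorphism, to first order. -/
theorem exists_autPair (hf : 𝔸.IsFormalBase) (n : ℕ) (X : Cochain A)
    (hX : ∀ j I, X j I ∈ 𝔸.part ((I.1.card + 1 : ℕ) : ZMod 2))
    (hm : ∀ j I, X j I ∈ 𝔸.maxIdeal ^ (n + 1)) :
    ∃ g g' : Matrix Mono Mono A, AutPair 𝔸 g g' ∧ EqMod 𝔸 n g 1 ∧ EqMod 𝔸 n g' 1 ∧
      EqMod 𝔸 (n + 1) g (1 + coder 0 X) := by
  classical
  have hl := hf.toIsLocalBase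
  have small : ∀ (J : Mono) (j : Fin 3) (a : A), a ∈ 𝔸.maxIdeal ^ (n + 1) →
      EqMod 𝔸 n (coder 0 (phi J j a)) 0 := by
    intro J j a ha
    have : EqMod 𝔸 n (phi J j a) 0 := fun k I => by
      rw [phi_apply]
      split_ifs
      · simpa using ha
      · simp
    simpa [coder_zero'] using this.coder 0
  -- For J ≠ {j} the coderivation squares to zero and the inverse has coefficient -a. For J = {j} it
  -- has coefficient (1 + a)⁻¹ - 1, where 1 + a is a unit because `a` lies in 𝔪.
  have elem : ∀ (J : Mono) (j : Fin 3), ∃ b ∈ 𝔸.maxIdeal ^ (n + 1),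
      AutPair 𝔸 (1 + coder 0 (phi J j (X j J))) (1 + coder 0 (phi J j b)) := by
    intro J j
    by_cases hJ : J = sing j
    · have haug : 𝔸.aug (1 + X j J) ≠ 0 := by
        rw [map_add, map_one, mem_maxIdeal_of_mem_pow (hm j J)]
        simp
      obtain ⟨c, hc1, hc2⟩ : ∃ c, (1 + X j J) * c = 1 ∧ c * (1 + X j J) = 1 := by
        obtain ⟨w, hw⟩ := hl.isUnit haug
        exact ⟨↑w⁻¹, by rw [← hw]; simp, by rw [← hw]; simp⟩
      have hp0 : ((J.1.card + 1 : ℕ) : ZMod 2) = 0 := by rw [hJ, card_sing]; rfl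
      have hXe := hX j J
      rw [hp0] at hXe
      -- The inverse of an even unit is even: its odd component y makes (1 + a) y both odd and even,
      -- hence zero.
      have hce : c ∈ 𝔸.part 0 := by
        obtain ⟨x, hx, y, hy, rfl⟩ := hl.exists_decomp c
        have h1 : (1 + X j J) * y = 1 - (1 + X j J) * x := by
          rw [eq_sub_iff_add_eq, add_comm, ← mul_add, hc1]
        have hy' := hl.mul_mem 0 1 _ _ (Submodule.add_mem _ hl.one_mem hXe) hy
        have h0 := hl.eq_zero_of_mem (h1 ▸ Submodule.sub_mem _ hl.one_mem
          (hl.mul_mem 0 0 _ _ (Submodule.add_mem _ hl.one_mem hXe) hx)) hy'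
        rw [hl.eq_zero_of_mul haug h0, add_zero]
        exact hx
      have hc1' : c - 1 = -(X j J * c) := by
        rw [← hc1]
        noncomm_ring
      have hc2' : c - 1 = -(c * X j J) := by
        rw [← hc2]
        noncomm_ring
      refine ⟨c - 1, ?_, autPair_elementary hl (hX j J) ?_ ?_ ?_⟩
      · rw [hc1']
        exact Submodule.neg_mem _ (mul_mem_pow_right n _ (hm j J))
      · rw [hp0]
        exact Submodule.sub_mem _ hce hl.one_mem
      · rw [if_pos hJ, mul_sub, mul_one, hc1']
        abel
      · rw [if_pos hJ, sub_mul, one_mul, hc2']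
        abel
    · refine ⟨-X j J, Submodule.neg_mem _ (hm j J),
        autPair_elementary hl (hX j J) (Submodule.neg_mem _ (hX j J)) ?_ ?_⟩ <;> simp [hJ]
  have key : ∀ s : Finset (Mono × Fin 3), ∃ g g' : Matrix Mono Mono A, AutPair 𝔸 g g' ∧
      EqMod 𝔸 n g 1 ∧ EqMod 𝔸 n g' 1 ∧
      EqMod 𝔸 (n + 1) g (1 + ∑ x ∈ s, coder 0 (phi x.1 x.2 (X x.2 x.1))) := by
    intro s
    induction s using Finset.induction_on with
    | empty =>
      exact ⟨1, 1, AutPair.one hl, EqMod.refl _, EqMod.refl _, by simpa using EqMod.refl _⟩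
    | insert x s hx ih =>
      obtain ⟨g, g', hg, h1, h2, h3⟩ := ih
      obtain ⟨b, hb, hab⟩ := elem x.1 x.2
      set E := coder 0 (phi x.1 x.2 (X x.2 x.1)) with hE
      have sE : EqMod 𝔸 n E 0 := small _ _ _ (hm _ _)
      have sE' : EqMod 𝔸 n (coder 0 (phi x.1 x.2 b)) 0 := small _ _ _ hb
      refine ⟨_, _, hab.mul hl hg, ?_, ?_, ?_⟩
      · simpa using ((EqMod.refl 1).add sE).mul h1
      · simpa using h2.mul ((EqMod.refl 1).add sE')
      · refine ((EqMod.refl (1 + E)).mul h3).trans ?_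
        set S := ∑ x ∈ s, coder 0 (phi x.1 x.2 (X x.2 x.1)) with hS
        have sS : EqMod 𝔸 n S 0 := by
          have := (h3.mono (Nat.le_succ n)).symm.trans h1
          rw [← EqMod.sub_zero_iff] at this
          simpa using this
        rw [Finset.sum_insert hx, ← EqMod.sub_zero_iff]
        -- The first-order terms add up; the error E S has entries in 𝔪^(2n+2), which is contained
        -- in 𝔪^(n+2).
        have e : (1 + E) * (1 + S) - (1 + (E + S)) = E * S := by noncomm_ring
        rw [e]
        exact (EqMod.mul_zero sE sS).mono (by omega)
  obtain ⟨g, g', h1, h2, h3, h4⟩ := key Finset.univ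
  refine ⟨g, g', h1, h2, h3, ?_⟩
  rw [coder_eq_sum]
  simpa [Fintype.sum_prod_type] using h4

/-- The infinitesimal action of even cochains at a codifferential. -/
def infin (A : Type u) [Ring A] [Algebra ℂ A] (d : Cochain ℂ) (X : Cochain A) : Cochain A :=
  corestr 1 (coder 1 (ext A d) * coder 0 X - coder 0 X * coder 1 (ext A d))

/-- A partial inverse of the infinitesimal action; its kernel is a slice. -/
structure IsGauge (𝔸 : SuperAug A) (d : Cochain ℂ) (res : Cochain A →+ Cochain A) : Prop where
  part : ∀ x : Cochain A, (∀ j I, x j I ∈ 𝔸.part I.parity) →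
    ∀ j I, res x j I ∈ 𝔸.part ((I.1.card + 1 : ℕ) : ZMod 2)
  small : ∀ (n : ℕ) (x : Cochain A), (∀ j I, x j I ∈ 𝔸.maxIdeal ^ (n + 1)) →
    ∀ j I, res x j I ∈ 𝔸.maxIdeal ^ (n + 1)
  inv : ∀ x, res (infin A d (res x)) = res x

theorem ext_mem_part (h : 𝔸.IsLocalBase) {d : Cochain ℂ} {ψ : Cochain A}
    (hψ : IsDeformation 𝔸 d ψ) (j : Fin 3) (I : Mono) : ext A d j I ∈ 𝔸.part I.parity := by
  have e : ext A d j I = algebraMap ℂ A (𝔸.aug (ψ j I)) := by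
    rw [← hψ.reduces]
    rfl
  rw [e]
  obtain h0 | h0 := (show ∀ i : ZMod 2, i = 0 ∨ i = 1 by decide) I.parity
  · rw [h0, Algebra.algebraMap_eq_smul_one]
    exact Submodule.smul_mem _ _ h.one_mem
  · have := hψ.odd j I
    rw [h0] at this
    rw [h.aug_odd this, map_zero]
    exact Submodule.zero_mem _

theorem eqMod_ext {d : Cochain ℂ} {ψ : Cochain A} (hψ : IsDeformation 𝔸 d ψ) :
    EqMod 𝔸 0 ψ (ext A d) := fun j I => by
  rw [zero_add, pow_one, mem_maxIdeal, map_sub, sub_eq_zero, ← hψ.reduces]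
  simp [ext]

theorem reduces_of_eqMod {d : Cochain ℂ} {ψ ψ' : Cochain A} (hψ : IsDeformation 𝔸 d ψ)
    (h : EqMod 𝔸 0 ψ' ψ) : ψ'.map 𝔸.aug = d := by
  rw [← hψ.reduces]
  ext j I
  have := h j I
  rw [zero_add, pow_one, mem_maxIdeal, map_sub, sub_eq_zero] at this
  exact this

theorem IsDeformation.conj (hl : 𝔸.IsLocalBase) {d : Cochain ℂ} {ψ : Cochain A}
    (hψ : IsDeformation 𝔸 d ψ) {g g' : Matrix Mono Mono A} (hg : AutPair 𝔸 g g')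
    (h1 : EqMod 𝔸 0 g 1) (h2 : EqMod 𝔸 0 g' 1) :
    ∃ ψ' : Cochain A, IsDeformation 𝔸 d ψ' ∧ coder 1 ψ' = g * coder 1 ψ * g' := by
  obtain ⟨c1, c2⟩ := hg.conj_isCoder hl (isCoder_coder 1 ψ) hψ.hasParity
  have e : coder 1 (corestr 1 (g * coder 1 ψ * g')) = g * coder 1 ψ * g' := c1.eq_coder.symm
  refine ⟨corestr 1 (g * coder 1 ψ * g'), ⟨⟨?_, ?_⟩, ?_⟩, e⟩
  · intro j I
    refine zsmul_mem ?_ _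
    have := c2 (sing j) I
    have e2 : ((1 + (sing j).1.card + I.1.card : ℕ) : ZMod 2) = I.parity := by
      have h2 : (2 : ZMod 2) = 0 := rfl
      rw [card_sing, Mono.parity]
      push_cast
      linear_combination h2
    rwa [e2] at this
  · rw [e]
    calc g * coder 1 ψ * g' * (g * coder 1 ψ * g') =
        g * coder 1 ψ * (g' * g) * coder 1 ψ * g' := by simp only [mul_assoc]
      _ = g * (coder 1 ψ * coder 1 ψ) * g' := by rw [hg.inv_mul]; simp only [mul_assoc, one_mul]
      _ = 0 := by rw [hψ.sq_eq_zero]; simp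
  · refine reduces_of_eqMod hψ ?_
    have := (((h1.mul (EqMod.refl (coder 1 ψ))).mul h2)).corestr 1
    simpa [corestr_coder] using this

/-- One step of the gauge fixing. -/
theorem exists_gauge_step (hf : 𝔸.IsFormalBase) {d : Cochain ℂ} {res : Cochain A →+ Cochain A}
    (hr : IsGauge 𝔸 d res) (n : ℕ) {ψ : Cochain A} (hψ : IsDeformation 𝔸 d ψ)
    (hn : EqMod 𝔸 n (res (ψ - ext A d)) 0) :
    ∃ (ψ' : Cochain A) (g g' : Matrix Mono Mono A), IsDeformation 𝔸 d ψ' ∧ AutPair 𝔸 g g' ∧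
      EqMod 𝔸 n g 1 ∧ EqMod 𝔸 n g' 1 ∧ EqMod 𝔸 n ψ' ψ ∧
      coder 1 ψ' * g = g * coder 1 ψ ∧ EqMod 𝔸 (n + 1) (res (ψ' - ext A d)) 0 := by
  have hl := hf.toIsLocalBase
  set X := res (ψ - ext A d) with hXdef
  have hXp : ∀ j I, X j I ∈ 𝔸.part ((I.1.card + 1 : ℕ) : ZMod 2) :=
    hr.part _ fun j I => Submodule.sub_mem _ (hψ.odd j I) (ext_mem_part hl hψ j I)
  obtain ⟨g, g', hg, h1, h2, h3⟩ := exists_autPair hf n X hXp fun j I => by simpa using hn j I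
  obtain ⟨ψ', hψ', e⟩ := hψ.conj hl hg (h1.mono (Nat.zero_le n)) (h2.mono (Nat.zero_le n))
  have hn' : EqMod 𝔸 n (coder 1 ψ') (coder 1 ψ) := by
    rw [e]
    simpa using (h1.mul (EqMod.refl (coder 1 ψ))).mul h2
  have hψn : EqMod 𝔸 n ψ' ψ := by simpa [corestr_coder] using hn'.corestr 1
  have e' : coder 1 ψ' * g = g * coder 1 ψ := by rw [e, mul_assoc, hg.inv_mul, mul_one]
  refine ⟨ψ', g, g', hψ', hg, h1, h2, hψn, e', ?_⟩
  -- Level n of `EqMod` refers to 𝔪^(n+1). Modulo 𝔪^(n+2) the automorphism g may be replaced by 1 +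
  -- Y, and ψ, ψ' may be replaced by d wherever they multiply the small matrix Y. The result is ψ' -
  -- ψ ≡ -infin(X).
  set Y := coder 0 X with hY
  have sY : EqMod 𝔸 n Y 0 := by simpa [coder_zero'] using hn.coder 0
  have t1 : EqMod 𝔸 (n + 1) (coder 1 ψ' * (1 + Y)) ((1 + Y) * coder 1 ψ) :=
    ((EqMod.refl (coder 1 ψ')).mul h3).symm.trans (e' ▸ h3.mul (EqMod.refl (coder 1 ψ)))
  have t2 : EqMod 𝔸 (n + 1) (Y * coder 1 ψ) (Y * coder 1 (ext A d)) := by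
    rw [← EqMod.sub_zero_iff, ← mul_sub]
    have h0 : EqMod 𝔸 0 (coder 1 ψ - coder 1 (ext A d)) 0 :=
      EqMod.sub_zero_iff.2 ((eqMod_ext hψ).coder 1)
    have := EqMod.mul_zero sY h0
    rwa [add_zero] at this
  have t3 : EqMod 𝔸 (n + 1) (coder 1 ψ' * Y) (coder 1 (ext A d) * Y) := by
    rw [← EqMod.sub_zero_iff, ← sub_mul]
    have h0 : EqMod 𝔸 0 (coder 1 ψ' - coder 1 (ext A d)) 0 :=
      EqMod.sub_zero_iff.2 ((eqMod_ext hψ').coder 1)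
    have := EqMod.mul_zero h0 sY
    rwa [zero_add] at this
  have t4 : EqMod 𝔸 (n + 1)
      (coder 1 ψ' - coder 1 ψ + (coder 1 (ext A d) * Y - Y * coder 1 (ext A d))) 0 := by
    have := ((EqMod.sub_zero_iff.2 t1).add (EqMod.sub_zero_iff.2 t2)).sub (EqMod.sub_zero_iff.2 t3)
    rw [add_zero, sub_zero] at this
    convert this using 1
    noncomm_ring
  have t5 := t4.corestr 1
  rw [corestr_add, corestr_sub, corestr_coder, corestr_coder] at t5
  have t6 := hr.small (n + 1) (ψ' - ψ + infin A d X) fun j I => by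
    have := t5 j I
    rw [show corestr 1 (0 : Matrix Mono Mono A) = 0 by ext; simp [corestr]] at this
    simpa [infin] using this
  -- As X = res(ψ - d), the identity res ∘ infin ∘ res = res turns res(infin X) into res(ψ - d), so
  -- that the terms in ψ cancel.
  have t7 : res (ψ' - ψ + infin A d X) = res (ψ' - ext A d) := by
    rw [map_add, hXdef, hr.inv, ← map_add]
    congr 1
    abel
  rw [t7] at t6
  exact fun j I => by simpa using t6 j I

/-- Every formal deformation is equivalent to one in the slice. -/
theorem exists_gauge (hf : 𝔸.IsFormalBase) {d : Cochain ℂ} {res : Cochain A →+ Cochain A}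
    (hr : IsGauge 𝔸 d res) {ψ : Cochain A} (hψ : IsDeformation 𝔸 d ψ) :
    ∃ ψ' : Cochain A, IsDeformation 𝔸 d ψ' ∧ DefEquivalent 𝔸 ψ' ψ ∧ res (ψ' - ext A d) = 0 := by
  have hl := hf.toIsLocalBase
  let S := Cochain A × Matrix Mono Mono A × Matrix Mono Mono A
  -- A state records the deformation, the accumulated automorphism and its inverse. The inverses are
  -- carried along because the invertibility of the limit is deduced from their convergence.
  let P : ℕ → S → Prop := fun n s => IsDeformation 𝔸 d s.1 ∧ AutPair 𝔸 s.2.1 s.2.2 ∧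
    EqMod 𝔸 0 s.2.1 1 ∧ coder 1 s.1 * s.2.1 = s.2.1 * coder 1 ψ ∧
    EqMod 𝔸 n (res (s.1 - ext A d)) 0
  let R : ℕ → S → S → Prop := fun n s s' => EqMod 𝔸 n s'.1 s.1 ∧ EqMod 𝔸 n s'.2.1 s.2.1 ∧
    EqMod 𝔸 n s'.2.2 s.2.2
  have step : ∀ n (s : {s // P n s}), ∃ s' : {s // P (n + 1) s}, R n s.1 s'.1 := by
    rintro n ⟨⟨φ, G, G'⟩, h1, h2, h3, h4, h5⟩
    obtain ⟨φ', g, g', k1, k2, k3, k4, k5, k6, k7⟩ := exists_gauge_step hf hr n h1 h5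
    refine ⟨⟨⟨φ', g * G, G' * g'⟩, k1, k2.mul hl h2, ?_, ?_, k7⟩, k5, ?_, ?_⟩
    · simpa using (k3.mono (Nat.zero_le n)).mul h3
    · change coder 1 φ' * (g * G) = g * G * coder 1 ψ
      change coder 1 φ * G = G * coder 1 ψ at h4
      rw [← mul_assoc, k6, mul_assoc, h4, mul_assoc]
    · simpa using k3.mul (EqMod.refl G)
    · simpa using (EqMod.refl G').mul k4
  choose next hnext using step
  let s0 : {s // P 0 s} := ⟨⟨ψ, 1, 1⟩, hψ, AutPair.one hl, EqMod.refl _, by simp, fun j I => by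
    have := hr.small 0 (ψ - ext A d) (eqMod_ext hψ) j I
    simpa using this⟩
  let s : ∀ n, {s // P n s} := fun n => Nat.rec s0 (fun n t => next n t) n
  have hs : ∀ n, R n (s n).1 (s (n + 1)).1 := fun n => hnext n (s n)
  obtain ⟨φ, hφ⟩ := EqMod.exists_limit hf (fun n => (s n).1.1) fun n => (hs n).1
  obtain ⟨G, hG⟩ := EqMod.exists_limit hf (fun n => (s n).1.2.1) fun n => (hs n).2.1
  obtain ⟨G', hG'⟩ := EqMod.exists_limit hf (fun n => (s n).1.2.2) fun n => (hs n).2.2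
  have hP := fun n => (s n).2
  -- Parity and compatibility with Δ are closed conditions over a Hausdorff base with closed
  -- homogeneous parts.
  have isEnd : ∀ (L : Matrix Mono Mono A) (M : ℕ → Matrix Mono Mono A), (∀ n, EqMod 𝔸 n L (M n)) →
      (∀ n, IsEnd 𝔸 (M n)) → IsEnd 𝔸 L := by
    intro L M hL hM
    refine ⟨fun K I => hf.mem_part_of_limit _ fun n => ⟨M n K I, (hM n).even K I, hL n K I⟩,
      EqMod.eq_of_forall hf fun n => ?_⟩
    refine ((EqMod.refl _).mul (hL n)).trans ?_
    rw [(hM n).comul]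
    exact (((hL n).tens (hL n)).mul (EqMod.refl _)).symm
  have pair : AutPair 𝔸 G G' := by
    refine ⟨isEnd G _ hG fun n => (hP n).2.1.left, isEnd G' _ hG' fun n => (hP n).2.1.right,
      EqMod.eq_of_forall hf fun n => ?_, EqMod.eq_of_forall hf fun n => ?_⟩
    · rw [← (hP n).2.1.mul_inv]
      exact (hG n).mul (hG' n)
    · rw [← (hP n).2.1.inv_mul]
      exact (hG' n).mul (hG n)
  refine ⟨φ, ⟨⟨?_, ?_⟩, ?_⟩, ⟨G, pair.isCoalgAut, ?_, ?_⟩, ?_⟩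
  · exact fun j I => hf.mem_part_of_limit _ fun n => ⟨_, (hP n).1.odd j I, hφ n j I⟩
  · refine EqMod.eq_of_forall hf fun n => ?_
    rw [← (hP n).1.sq_eq_zero]
    exact ((hφ n).coder 1).mul ((hφ n).coder 1)
  · exact reduces_of_eqMod (hP 0).1 (hφ 0)
  · have := (hG 0).trans (hP 0).2.2.1
    ext K I
    have e := this K I
    rw [zero_add, pow_one, mem_maxIdeal, map_sub, sub_eq_zero] at e
    rw [Matrix.map_apply, e]
    change 𝔸.aug ((1 : Matrix Mono Mono A) K I) = _
    by_cases hKI : K = I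
    · rw [hKI, Matrix.one_apply_eq, Matrix.one_apply_eq, map_one]
    · rw [Matrix.one_apply_ne hKI, Matrix.one_apply_ne hKI, map_zero]
  · refine EqMod.eq_of_forall hf fun n => ?_
    refine (((hφ n).coder 1).mul (hG n)).trans ?_
    rw [(hP n).2.2.2.1]
    exact ((hG n).mul (EqMod.refl _)).symm
  · refine EqMod.eq_of_forall hf fun n => ?_
    have h1 : EqMod 𝔸 n (res (φ - (s n).1.1)) 0 := fun j I => by
      rw [Matrix.zero_apply, sub_zero]
      exact hr.small n (φ - (s n).1.1) (hφ n) j I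
    have := h1.add (hP n).2.2.2.2
    rw [← map_add, sub_add_sub_cancel, add_zero] at this
    exact this

end Slice

end LInfinity

end

noncomputable section

namespace LInfinity

/-! ## Coderivations in coordinates -/

theorem sum_mono {M : Type*} [AddCommMonoid M] (F : Mono → M) :
    ∑ I : Mono, F I = F I100 + F I010 + F I001 + F I110 + F I101 + F I011 + F I111 := by
  have : (Finset.univ : Finset Mono) = {I100, I010, I001, I110, I101, I011, I111} := by
    decide +kernel
  rw [this]
  repeat rw [Finset.sum_insert (by decide +kernel)]
  simp [add_assoc]

theorem mono_cases : ∀ I : Mono, I = I100 ∨ I = I010 ∨ I = I001 ∨ I = I110 ∨ I = I101 ∨ I = I011 ∨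
    I = I111 := by
  decide +kernel

@[simp]
theorem card_I100 : I100.1.card = 1 := rfl
@[simp]
theorem card_I010 : I010.1.card = 1 := rfl
@[simp]
theorem card_I001 : I001.1.card = 1 := rfl
@[simp]
theorem card_I110 : I110.1.card = 2 := rfl
@[simp]
theorem card_I101 : I101.1.card = 2 := rfl
@[simp]
theorem card_I011 : I011.1.card = 2 := rfl
@[simp]
theorem card_I111 : I111.1.card = 3 := rfl

section Entries

variable {A : Type u} [Ring A] [Algebra ℂ A] (p : ℕ) (φ : Cochain A)

theorem coder_eq_zero_of_card {K I : Mono} (h : I.1.card < K.1.card) : coder p φ K I = 0 := by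
  rw [coder_apply]
  refine Finset.sum_eq_zero fun J _ => Finset.sum_eq_zero fun j _ => ?_
  by_cases h0 : coderCoef J j K I = 0
  · simp [h0]
  · have h1 := card_of_coderCoef_ne J j K I h0
    have h2 := Finset.card_pos.2 J.2
    omega

/-- For a nonzero structure constant |K| + |J| = |I| + 1, so the sign in `coder` depends on K and I
only. Each entry is one sign times a short integer combination that can be decided. -/
theorem coder_of_table {K I : Mono} (L : List (ℤ × Mono × Fin 3))
    (hL : ∀ (J : Mono) (j : Fin 3),
      coderCoef J j K I = (L.map fun x => if J = x.2.1 ∧ j = x.2.2 then x.1 else 0).sum) :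
    coder p φ K I = ((-1 : ℤ) ^ ((p + K.1.card + I.1.card) * I.1.card)) •
      (L.map fun x => x.1 • φ x.2.2 x.2.1).sum := by
  have key : ∀ L : List (ℤ × Mono × Fin 3), ∑ J : Mono, ∑ j : Fin 3,
      (L.map fun x => if J = x.2.1 ∧ j = x.2.2 then x.1 else 0).sum • φ j J =
      (L.map fun x => x.1 • φ x.2.2 x.2.1).sum := by
    intro L
    induction L with
    | nil => simp
    | cons x L ih =>
      simp only [List.map_cons, List.sum_cons, add_smul, Finset.sum_add_distrib, ih]
      congr 1
      rw [Finset.sum_eq_single x.2.1, Finset.sum_eq_single x.2.2]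
      · simp
      · intro j _ hj
        simp [hj]
      · simp
      · intro J _ hJ
        simp [hJ]
      · simp
  rw [← key, coder_apply, Finset.smul_sum]
  refine Finset.sum_congr rfl fun J _ => ?_
  rw [Finset.smul_sum]
  refine Finset.sum_congr rfl fun j _ => ?_
  rw [← hL, smul_smul]
  by_cases h0 : coderCoef J j K I = 0
  · simp [h0]
  rw [mul_comm]
  congr 2
  refine negOnePow_congr ?_
  have e1 := congrArg (Nat.cast : ℕ → ZMod 2) (card_of_coderCoef_ne J j K I h0)
  push_cast at e1 ⊢
  have h3 : (2 : ZMod 2) = 0 := rfl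
  linear_combination (I.1.card : ZMod 2) * e1 - (K.1.card * I.1.card - I.1.card : ZMod 2) * h3

theorem sign_mul_two (n : ℕ) : (-1 : ℤ) ^ (n * 2) = 1 := by simp [pow_mul']

theorem sign_two_three (n : ℕ) : (-1 : ℤ) ^ ((n + 2 + 3) * 3) = (-1) ^ (n + 1) := by
  refine negOnePow_congr ?_
  push_cast
  have h3 : (2 : ZMod 2) = 0 := rfl
  linear_combination (n + 7 : ZMod 2) * h3

theorem sign_three_three (n : ℕ) : (-1 : ℤ) ^ ((n + 3 + 3) * 3) = (-1) ^ n := by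
  refine negOnePow_congr ?_
  push_cast
  have h3 : (2 : ZMod 2) = 0 := rfl
  linear_combination (n + 9 : ZMod 2) * h3

@[simp]
theorem coder_110_110 : coder p φ I110 I110 =
    φ 0 I100 + φ 1 I010 := by
  rw [coder_of_table p φ (K := I110) (I := I110) [(1, I100, 0), (1, I010, 1)]
    (by decide +kernel)]
  simp only [card_I110, card_I110, sign_mul_two]
  simp [sub_eq_add_neg, add_assoc]

@[simp]
theorem coder_110_101 : coder p φ I110 I101 =
    φ 1 I001 := by
  rw [coder_of_table p φ (K := I110) (I := I101) [(1, I001, 1)]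
    (by decide +kernel)]
  simp only [card_I110, card_I101, sign_mul_two]
  simp [sub_eq_add_neg, add_assoc]

@[simp]
theorem coder_110_011 : coder p φ I110 I011 =
    -φ 0 I001 := by
  rw [coder_of_table p φ (K := I110) (I := I011) [(-1, I001, 0)]
    (by decide +kernel)]
  simp only [card_I110, card_I011, sign_mul_two]
  simp [sub_eq_add_neg, add_assoc]

@[simp]
theorem coder_110_111 : coder p φ I110 I111 =
    ((-1 : ℤ) ^ (p + 1)) • (-φ 0 I101 - φ 1 I011) := by
  rw [coder_of_table p φ (K := I110) (I := I111) [(-1, I101, 0), (-1, I011, 1)]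
    (by decide +kernel)]
  simp only [card_I110, card_I111, sign_two_three]
  simp [sub_eq_add_neg, add_assoc]

@[simp]
theorem coder_101_110 : coder p φ I101 I110 =
    φ 2 I010 := by
  rw [coder_of_table p φ (K := I101) (I := I110) [(1, I010, 2)]
    (by decide +kernel)]
  simp only [card_I101, card_I110, sign_mul_two]
  simp [sub_eq_add_neg, add_assoc]

@[simp]
theorem coder_101_101 : coder p φ I101 I101 =
    φ 0 I100 + φ 2 I001 := by
  rw [coder_of_table p φ (K := I101) (I := I101) [(1, I100, 0), (1, I001, 2)]
    (by decide +kernel)]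
  simp only [card_I101, card_I101, sign_mul_two]
  simp [sub_eq_add_neg, add_assoc]

@[simp]
theorem coder_101_011 : coder p φ I101 I011 =
    φ 0 I010 := by
  rw [coder_of_table p φ (K := I101) (I := I011) [(1, I010, 0)]
    (by decide +kernel)]
  simp only [card_I101, card_I011, sign_mul_two]
  simp [sub_eq_add_neg, add_assoc]

@[simp]
theorem coder_101_111 : coder p φ I101 I111 =
    ((-1 : ℤ) ^ (p + 1)) • (φ 0 I110 - φ 2 I011) := by
  rw [coder_of_table p φ (K := I101) (I := I111) [(1, I110, 0), (-1, I011, 2)]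
    (by decide +kernel)]
  simp only [card_I101, card_I111, sign_two_three]
  simp [sub_eq_add_neg, add_assoc]

@[simp]
theorem coder_011_110 : coder p φ I011 I110 =
    -φ 2 I100 := by
  rw [coder_of_table p φ (K := I011) (I := I110) [(-1, I100, 2)]
    (by decide +kernel)]
  simp only [card_I011, card_I110, sign_mul_two]
  simp [sub_eq_add_neg, add_assoc]

@[simp]
theorem coder_011_101 : coder p φ I011 I101 =
    φ 1 I100 := by
  rw [coder_of_table p φ (K := I011) (I := I101) [(1, I100, 1)]
    (by decide +kernel)]
  simp only [card_I011, card_I101, sign_mul_two]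
  simp [sub_eq_add_neg, add_assoc]

@[simp]
theorem coder_011_011 : coder p φ I011 I011 =
    φ 1 I010 + φ 2 I001 := by
  rw [coder_of_table p φ (K := I011) (I := I011) [(1, I010, 1), (1, I001, 2)]
    (by decide +kernel)]
  simp only [card_I011, card_I011, sign_mul_two]
  simp [sub_eq_add_neg, add_assoc]

@[simp]
theorem coder_011_111 : coder p φ I011 I111 =
    ((-1 : ℤ) ^ (p + 1)) • (φ 1 I110 + φ 2 I101) := by
  rw [coder_of_table p φ (K := I011) (I := I111) [(1, I110, 1), (1, I101, 2)]
    (by decide +kernel)]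
  simp only [card_I011, card_I111, sign_two_three]
  simp [sub_eq_add_neg, add_assoc]

@[simp]
theorem coder_111_111 : coder p φ I111 I111 =
    ((-1 : ℤ) ^ p) • (φ 0 I100 + φ 1 I010 + φ 2 I001) := by
  rw [coder_of_table p φ (K := I111) (I := I111) [(1, I100, 0), (1, I010, 1), (1, I001, 2)]
    (by decide +kernel)]
  simp only [card_I111, card_I111, sign_three_three]
  simp [sub_eq_add_neg, add_assoc]

@[simp]
theorem coder_I100 (I : Mono) :
    coder p φ I100 I = ((-1 : ℤ) ^ ((p + I.1.card + 1) * I.1.card)) • φ 0 I := coder_sing p φ 0 I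

@[simp]
theorem coder_I010 (I : Mono) :
    coder p φ I010 I = ((-1 : ℤ) ^ ((p + I.1.card + 1) * I.1.card)) • φ 1 I := coder_sing p φ 1 I

@[simp]
theorem coder_I001 (I : Mono) :
    coder p φ I001 I = ((-1 : ℤ) ^ ((p + I.1.card + 1) * I.1.card)) • φ 2 I := coder_sing p φ 2 I

@[simp]
theorem coder_110_100 : coder p φ I110 I100 = 0 :=
  coder_eq_zero_of_card p φ (by decide)

@[simp]
theorem coder_110_010 : coder p φ I110 I010 = 0 :=
  coder_eq_zero_of_card p φ (by decide)

@[simp]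
theorem coder_110_001 : coder p φ I110 I001 = 0 :=
  coder_eq_zero_of_card p φ (by decide)

@[simp]
theorem coder_101_100 : coder p φ I101 I100 = 0 :=
  coder_eq_zero_of_card p φ (by decide)

@[simp]
theorem coder_101_010 : coder p φ I101 I010 = 0 :=
  coder_eq_zero_of_card p φ (by decide)

@[simp]
theorem coder_101_001 : coder p φ I101 I001 = 0 :=
  coder_eq_zero_of_card p φ (by decide)

@[simp]
theorem coder_011_100 : coder p φ I011 I100 = 0 :=
  coder_eq_zero_of_card p φ (by decide)

@[simp]
theorem coder_011_010 : coder p φ I011 I010 = 0 :=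
  coder_eq_zero_of_card p φ (by decide)

@[simp]
theorem coder_011_001 : coder p φ I011 I001 = 0 :=
  coder_eq_zero_of_card p φ (by decide)

@[simp]
theorem coder_111_100 : coder p φ I111 I100 = 0 :=
  coder_eq_zero_of_card p φ (by decide)

@[simp]
theorem coder_111_010 : coder p φ I111 I010 = 0 :=
  coder_eq_zero_of_card p φ (by decide)

@[simp]
theorem coder_111_001 : coder p φ I111 I001 = 0 :=
  coder_eq_zero_of_card p φ (by decide)

@[simp]
theorem coder_111_110 : coder p φ I111 I110 = 0 :=
  coder_eq_zero_of_card p φ (by decide)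

@[simp]
theorem coder_111_101 : coder p φ I111 I101 = 0 :=
  coder_eq_zero_of_card p φ (by decide)

@[simp]
theorem coder_111_011 : coder p φ I111 I011 = 0 :=
  coder_eq_zero_of_card p φ (by decide)

end Entries

/-! ### The 21 components of the Maurer–Cartan equation -/

section Square

variable {A : Type u} [Ring A] [Algebra ℂ A] (φ : Cochain A)

theorem sq_100_0 : (coder 1 φ * coder 1 φ) I100 I100 =
    φ 0 I100 * φ 0 I100 + φ 0 I010 * φ 1 I100 + φ 0 I001 * φ 2 I100 := by
  simp [Matrix.mul_apply, sum_mono]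
  try noncomm_ring

theorem sq_100_1 : (coder 1 φ * coder 1 φ) I010 I100 =
    φ 1 I100 * φ 0 I100 + φ 1 I010 * φ 1 I100 + φ 1 I001 * φ 2 I100 := by
  simp [Matrix.mul_apply, sum_mono]
  try noncomm_ring

theorem sq_100_2 : (coder 1 φ * coder 1 φ) I001 I100 =
    φ 2 I100 * φ 0 I100 + φ 2 I010 * φ 1 I100 + φ 2 I001 * φ 2 I100 := by
  simp [Matrix.mul_apply, sum_mono]
  try noncomm_ring

theorem sq_010_0 : (coder 1 φ * coder 1 φ) I100 I010 =
    φ 0 I100 * φ 0 I010 + φ 0 I010 * φ 1 I010 + φ 0 I001 * φ 2 I010 := by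
  simp [Matrix.mul_apply, sum_mono]
  try noncomm_ring

theorem sq_010_1 : (coder 1 φ * coder 1 φ) I010 I010 =
    φ 1 I100 * φ 0 I010 + φ 1 I010 * φ 1 I010 + φ 1 I001 * φ 2 I010 := by
  simp [Matrix.mul_apply, sum_mono]
  try noncomm_ring

theorem sq_010_2 : (coder 1 φ * coder 1 φ) I001 I010 =
    φ 2 I100 * φ 0 I010 + φ 2 I010 * φ 1 I010 + φ 2 I001 * φ 2 I010 := by
  simp [Matrix.mul_apply, sum_mono]
  try noncomm_ring

theorem sq_001_0 : (coder 1 φ * coder 1 φ) I100 I001 =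
    φ 0 I100 * φ 0 I001 + φ 0 I010 * φ 1 I001 + φ 0 I001 * φ 2 I001 := by
  simp [Matrix.mul_apply, sum_mono]
  try noncomm_ring

theorem sq_001_1 : (coder 1 φ * coder 1 φ) I010 I001 =
    φ 1 I100 * φ 0 I001 + φ 1 I010 * φ 1 I001 + φ 1 I001 * φ 2 I001 := by
  simp [Matrix.mul_apply, sum_mono]
  try noncomm_ring

theorem sq_001_2 : (coder 1 φ * coder 1 φ) I001 I001 =
    φ 2 I100 * φ 0 I001 + φ 2 I010 * φ 1 I001 + φ 2 I001 * φ 2 I001 := by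
  simp [Matrix.mul_apply, sum_mono]
  try noncomm_ring

theorem sq_110_0 : (coder 1 φ * coder 1 φ) I100 I110 =
    -φ 0 I100 * φ 0 I110 - φ 0 I010 * φ 1 I110 - φ 0 I001 * φ 2 I110 + φ 0 I110 * φ 0 I100 +
      φ 0 I110 * φ 1 I010 + φ 0 I101 * φ 2 I010 - φ 0 I011 * φ 2 I100 := by
  simp [Matrix.mul_apply, sum_mono]
  try noncomm_ring

theorem sq_110_1 : (coder 1 φ * coder 1 φ) I010 I110 =
    -φ 1 I100 * φ 0 I110 - φ 1 I010 * φ 1 I110 - φ 1 I001 * φ 2 I110 + φ 1 I110 * φ 0 I100 +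
      φ 1 I110 * φ 1 I010 + φ 1 I101 * φ 2 I010 - φ 1 I011 * φ 2 I100 := by
  simp [Matrix.mul_apply, sum_mono]
  try noncomm_ring

theorem sq_110_2 : (coder 1 φ * coder 1 φ) I001 I110 =
    -φ 2 I100 * φ 0 I110 - φ 2 I010 * φ 1 I110 - φ 2 I001 * φ 2 I110 + φ 2 I110 * φ 0 I100 +
      φ 2 I110 * φ 1 I010 + φ 2 I101 * φ 2 I010 - φ 2 I011 * φ 2 I100 := by
  simp [Matrix.mul_apply, sum_mono]
  try noncomm_ring

theorem sq_101_0 : (coder 1 φ * coder 1 φ) I100 I101 =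
    -φ 0 I100 * φ 0 I101 - φ 0 I010 * φ 1 I101 - φ 0 I001 * φ 2 I101 + φ 0 I110 * φ 1 I001 +
      φ 0 I101 * φ 0 I100 + φ 0 I101 * φ 2 I001 + φ 0 I011 * φ 1 I100 := by
  simp [Matrix.mul_apply, sum_mono]
  try noncomm_ring

theorem sq_101_1 : (coder 1 φ * coder 1 φ) I010 I101 =
    -φ 1 I100 * φ 0 I101 - φ 1 I010 * φ 1 I101 - φ 1 I001 * φ 2 I101 + φ 1 I110 * φ 1 I001 +
      φ 1 I101 * φ 0 I100 + φ 1 I101 * φ 2 I001 + φ 1 I011 * φ 1 I100 := by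
  simp [Matrix.mul_apply, sum_mono]
  try noncomm_ring

theorem sq_101_2 : (coder 1 φ * coder 1 φ) I001 I101 =
    -φ 2 I100 * φ 0 I101 - φ 2 I010 * φ 1 I101 - φ 2 I001 * φ 2 I101 + φ 2 I110 * φ 1 I001 +
      φ 2 I101 * φ 0 I100 + φ 2 I101 * φ 2 I001 + φ 2 I011 * φ 1 I100 := by
  simp [Matrix.mul_apply, sum_mono]
  try noncomm_ring

theorem sq_011_0 : (coder 1 φ * coder 1 φ) I100 I011 =
    -φ 0 I100 * φ 0 I011 - φ 0 I010 * φ 1 I011 - φ 0 I001 * φ 2 I011 - φ 0 I110 * φ 0 I001 +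
      φ 0 I101 * φ 0 I010 + φ 0 I011 * φ 1 I010 + φ 0 I011 * φ 2 I001 := by
  simp [Matrix.mul_apply, sum_mono]
  try noncomm_ring

theorem sq_011_1 : (coder 1 φ * coder 1 φ) I010 I011 =
    -φ 1 I100 * φ 0 I011 - φ 1 I010 * φ 1 I011 - φ 1 I001 * φ 2 I011 - φ 1 I110 * φ 0 I001 +
      φ 1 I101 * φ 0 I010 + φ 1 I011 * φ 1 I010 + φ 1 I011 * φ 2 I001 := by
  simp [Matrix.mul_apply, sum_mono]
  try noncomm_ring

theorem sq_011_2 : (coder 1 φ * coder 1 φ) I001 I011 =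
    -φ 2 I100 * φ 0 I011 - φ 2 I010 * φ 1 I011 - φ 2 I001 * φ 2 I011 - φ 2 I110 * φ 0 I001 +
      φ 2 I101 * φ 0 I010 + φ 2 I011 * φ 1 I010 + φ 2 I011 * φ 2 I001 := by
  simp [Matrix.mul_apply, sum_mono]
  try noncomm_ring

theorem sq_111_0 : (coder 1 φ * coder 1 φ) I100 I111 =
    φ 0 I100 * φ 0 I111 + φ 0 I010 * φ 1 I111 + φ 0 I001 * φ 2 I111 - φ 0 I110 * φ 0 I101 -
      φ 0 I110 * φ 1 I011 + φ 0 I101 * φ 0 I110 - φ 0 I101 * φ 2 I011 + φ 0 I011 * φ 1 I110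
      + φ 0 I011 * φ 2 I101 + φ 0 I111 * φ 0 I100 + φ 0 I111 * φ 1 I010 + φ 0 I111 * φ 2
      I001 := by
  simp [Matrix.mul_apply, sum_mono]
  try noncomm_ring

theorem sq_111_1 : (coder 1 φ * coder 1 φ) I010 I111 =
    φ 1 I100 * φ 0 I111 + φ 1 I010 * φ 1 I111 + φ 1 I001 * φ 2 I111 - φ 1 I110 * φ 0 I101 -
      φ 1 I110 * φ 1 I011 + φ 1 I101 * φ 0 I110 - φ 1 I101 * φ 2 I011 + φ 1 I011 * φ 1 I110
      + φ 1 I011 * φ 2 I101 + φ 1 I111 * φ 0 I100 + φ 1 I111 * φ 1 I010 + φ 1 I111 * φ 2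
      I001 := by
  simp [Matrix.mul_apply, sum_mono]
  try noncomm_ring

theorem sq_111_2 : (coder 1 φ * coder 1 φ) I001 I111 =
    φ 2 I100 * φ 0 I111 + φ 2 I010 * φ 1 I111 + φ 2 I001 * φ 2 I111 - φ 2 I110 * φ 0 I101 -
      φ 2 I110 * φ 1 I011 + φ 2 I101 * φ 0 I110 - φ 2 I101 * φ 2 I011 + φ 2 I011 * φ 1 I110
      + φ 2 I011 * φ 2 I101 + φ 2 I111 * φ 0 I100 + φ 2 I111 * φ 1 I010 + φ 2 I111 * φ 2
      I001 := by
  simp [Matrix.mul_apply, sum_mono]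
  try noncomm_ring

end Square

end LInfinity

end

noncomputable section

namespace LInfinity

/-! ## The gauge slice of `d̃_λ` -/

theorem sing_zero : sing 0 = I100 := rfl
theorem sing_one : sing 1 = I010 := rfl
theorem sing_two : sing 2 = I001 := rfl

theorem dt_apply (l : ℂ) (j : Fin 3) (I : Mono) :
    dt l j I = (if 0 = j ∧ I101 = I then 1 else 0) + (if 1 = j ∧ I011 = I then l else 0) := by
  rw [dt, Matrix.add_apply, phi_apply, phi_apply]

section Gauge

variable {A : Type u} [Ring A] [Algebra ℂ A] {𝔸 : SuperAug A}

theorem ext_dt_apply (l : ℂ) (j : Fin 3) (I : Mono) :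
    ext A (dt l) j I =
      (if 0 = j ∧ I101 = I then 1 else 0) + (if 1 = j ∧ I011 = I then algebraMap ℂ A l else 0) := by
  change algebraMap ℂ A (dt l j I) = _
  rw [dt_apply, map_add]
  split_ifs <;> simp

theorem infin_apply (d : Cochain ℂ) (X : Cochain A) (j : Fin 3) (I : Mono) :
    infin A d X j I = ((-1 : ℤ) ^ ((1 + I.1.card + 1) * I.1.card)) •
      ∑ M : Mono, (coder 1 (ext A d) (sing j) M * coder 0 X M I -
        coder 0 X (sing j) M * coder 1 (ext A d) M I) := by
  rw [infin, corestr, Matrix.sub_apply, Matrix.mul_apply, Matrix.mul_apply, Finset.sum_sub_distrib]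

variable (l : ℂ) (X : Cochain A)

/-- The bracket with a quadratic codifferential raises degree by one, so nothing reaches the linear
columns: the coefficients of linear cochains are infinitesimal invariants. -/
theorem infin_dt_linear (j : Fin 3) {I : Mono} (hI : I.1.card = 1) :
    infin A (dt l) X j I = 0 := by
  obtain ⟨k, rfl⟩ := mono_card_one I (by omega)
  rw [infin_apply, sum_mono]
  fin_cases j <;> fin_cases k <;>
    simp +decide [sing_zero, sing_one, sing_two, ext_dt_apply]

/-- This and the following formulas are the differential of `d̃_λ` with coefficients in A, up to the
sign convention. The factors 1 - λ and 1 + λ decide which directions stop being removable at λ = 1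
and at λ = -1. -/
theorem infin_dt_110_0 : infin A (dt l) X 0 I110 = X 2 I010 := by
  rw [infin_apply, sum_mono]
  simp +decide [sing_zero, ext_dt_apply]

theorem infin_dt_110_2 : infin A (dt l) X 2 I110 = 0 := by
  rw [infin_apply, sum_mono]
  simp +decide [sing_two, ext_dt_apply]

theorem infin_dt_101_0 : infin A (dt l) X 0 I101 = X 2 I001 := by
  rw [infin_apply, sum_mono]
  simp +decide [sing_zero, ext_dt_apply]

theorem infin_dt_101_1 : infin A (dt l) X 1 I101 = (l - 1) • X 1 I100 := by
  rw [infin_apply, sum_mono]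
  simp +decide [sing_one, ext_dt_apply, Algebra.smul_def, sub_mul]
  noncomm_ring

theorem infin_dt_101_2 : infin A (dt l) X 2 I101 = -X 2 I100 := by
  rw [infin_apply, sum_mono]
  simp +decide [sing_two, ext_dt_apply]

theorem infin_dt_011_0 : infin A (dt l) X 0 I011 = (1 - l) • X 0 I010 := by
  rw [infin_apply, sum_mono]
  simp +decide [sing_zero, ext_dt_apply, Algebra.smul_def, sub_mul, Algebra.commutes l]
  noncomm_ring

theorem infin_dt_011_1 : infin A (dt l) X 1 I011 = l • X 2 I001 := by
  rw [infin_apply, sum_mono]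
  simp +decide [sing_one, ext_dt_apply, Algebra.smul_def, Algebra.commutes l, mul_add]
  noncomm_ring

theorem infin_dt_111_0 : infin A (dt l) X 0 I111 = -X 2 I011 - l • X 0 I110 := by
  rw [infin_apply, sum_mono]
  simp +decide [sing_zero, ext_dt_apply, Algebra.smul_def, Algebra.commutes l]
  noncomm_ring

theorem infin_dt_111_1 : infin A (dt l) X 1 I111 = -X 1 I110 + l • X 2 I101 := by
  rw [infin_apply, sum_mono]
  simp +decide [sing_one, ext_dt_apply, Algebra.smul_def, Algebra.commutes l]
  noncomm_ring

theorem infin_dt_111_2 : infin A (dt l) X 2 I111 = -((1 + l) • X 2 I110) := by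
  rw [infin_apply, sum_mono]
  simp +decide [sing_two, ext_dt_apply, Algebra.smul_def, Algebra.commutes l, add_mul]
  noncomm_ring

variable (A) in
/-- A family of partial inverses of the infinitesimal action at `d̃_λ`. -/
def gaugeRes (a b c e : ℂ) : Cochain A →+ Cochain A where
  toFun x := phi I001 2 (a • x 0 I101 + b • x 1 I011) + phi I010 0 (c • x 0 I011) +
    phi I100 1 (-(c • x 1 I101)) + phi I010 2 (x 0 I110) + phi I100 2 (-x 2 I101) +
    phi I011 2 (-x 0 I111) + phi I110 1 (-x 1 I111) + phi I110 2 (-(e • x 2 I111))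
  map_zero' := by simp [phi_zero]
  map_add' x y := by
    simp only [Matrix.add_apply, smul_add, neg_add, phi_add]
    abel

theorem gaugeRes_apply (a b c e : ℂ) (x : Cochain A) : gaugeRes A a b c e x =
    phi I001 2 (a • x 0 I101 + b • x 1 I011) + phi I010 0 (c • x 0 I011) +
    phi I100 1 (-(c • x 1 I101)) + phi I010 2 (x 0 I110) + phi I100 2 (-x 2 I101) +
    phi I011 2 (-x 0 I111) + phi I110 1 (-x 1 I111) + phi I110 2 (-(e • x 2 I111)) := rfl

/-- The scalars c and e are generalised inverses of 1 - λ and 1 + λ, with zero allowed when these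
vanish. The entry `X 2 I001` moves the coefficients of φ^{101}_1 and φ^{011}_2 in the ratio 1 : λ,
and (a, b) is a functional with value 1 on that direction; its choice fixes the complementary
parameter. -/
theorem isGauge_gaugeRes {a b c e : ℂ} (h1 : a + b * l = 1) (h2 : c * (1 - l) * c = c)
    (h3 : e * (1 + l) * e = e) : IsGauge 𝔸 (dt l) (gaugeRes A a b c e) where
  part x hx j I := by
    have even : ∀ j (I J : Mono), (I.parity = ((J.1.card + 1 : ℕ) : ZMod 2)) →
        x j I ∈ 𝔸.part ((J.1.card + 1 : ℕ) : ZMod 2) := fun j I J h => h ▸ hx j I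
    have mem : ∀ (J : Mono) (k : Fin 3) (y : A), y ∈ 𝔸.part ((J.1.card + 1 : ℕ) : ZMod 2) →
        phi J k y j I ∈ 𝔸.part ((I.1.card + 1 : ℕ) : ZMod 2) := by
      intro J k y hy
      rw [phi_apply]
      split_ifs with h
      · exact h.2 ▸ hy
      · exact Submodule.zero_mem _
    rw [gaugeRes_apply]
    simp only [Matrix.add_apply]
    refine Submodule.add_mem _ (Submodule.add_mem _ (Submodule.add_mem _ (Submodule.add_mem _
      (Submodule.add_mem _ (Submodule.add_mem _ (Submodule.add_mem _ (mem _ _ _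
        (Submodule.add_mem _ (Submodule.smul_mem _ _ (even _ _ _ rfl))
        (Submodule.smul_mem _ _ (even _ _ _ rfl))))
      (mem _ _ _ (Submodule.smul_mem _ _ (even _ _ _ rfl))))
      (mem _ _ _ (Submodule.neg_mem _ (Submodule.smul_mem _ _ (even _ _ _ rfl)))))
      (mem _ _ _ (even _ _ _ rfl))) (mem _ _ _ (Submodule.neg_mem _ (even _ _ _ rfl))))
      (mem _ _ _ (Submodule.neg_mem _ (even _ _ _ rfl))))
      (mem _ _ _ (Submodule.neg_mem _ (even _ _ _ rfl))))
      (mem _ _ _ (Submodule.neg_mem _ (Submodule.smul_mem _ _ (even _ _ _ rfl))))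
  small n x hx j I := by
    have mem : ∀ (J : Mono) (k : Fin 3) (y : A), y ∈ 𝔸.maxIdeal ^ (n + 1) →
        phi J k y j I ∈ 𝔸.maxIdeal ^ (n + 1) := by
      intro J k y hy
      rw [phi_apply]
      split_ifs with h
      · exact hy
      · exact Submodule.zero_mem _
    rw [gaugeRes_apply]
    simp only [Matrix.add_apply]
    refine Submodule.add_mem _ (Submodule.add_mem _ (Submodule.add_mem _ (Submodule.add_mem _
      (Submodule.add_mem _ (Submodule.add_mem _ (Submodule.add_mem _ (mem _ _ _
        (Submodule.add_mem _ (Submodule.smul_mem _ _ (hx _ _))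
        (Submodule.smul_mem _ _ (hx _ _))))
      (mem _ _ _ (Submodule.smul_mem _ _ (hx _ _))))
      (mem _ _ _ (Submodule.neg_mem _ (Submodule.smul_mem _ _ (hx _ _)))))
      (mem _ _ _ (hx _ _))) (mem _ _ _ (Submodule.neg_mem _ (hx _ _))))
      (mem _ _ _ (Submodule.neg_mem _ (hx _ _))))
      (mem _ _ _ (Submodule.neg_mem _ (hx _ _))))
      (mem _ _ _ (Submodule.neg_mem _ (Submodule.smul_mem _ _ (hx _ _))))
  inv x := by
    have k1 : ∀ y : A, a • y + b • l • y = y := fun y => by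
      rw [smul_smul, ← add_smul, h1, one_smul]
    have k2 : ∀ y : A, c • (1 - l) • c • y = c • y := fun y => by
      rw [smul_smul, smul_smul, h2]
    have k2' : ∀ y : A, c • (l - 1) • c • y = -(c • y) := fun y => by
      rw [← neg_sub 1 l, neg_smul, smul_neg, k2]
    have k3 : ∀ y : A, e • (1 + l) • e • y = e • y := fun y => by
      rw [smul_smul, smul_smul, h3]
    set y := infin A (dt l) (gaugeRes A a b c e x) with hy
    have e1 : y 0 I101 = a • x 0 I101 + b • x 1 I011 := by
      rw [hy, infin_dt_101_0, gaugeRes_apply]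
      simp +decide [phi_apply]
    have e2 : y 1 I011 = l • (a • x 0 I101 + b • x 1 I011) := by
      rw [hy, infin_dt_011_1, gaugeRes_apply]
      simp +decide [phi_apply]
    have e3 : y 0 I011 = (1 - l) • c • x 0 I011 := by
      rw [hy, infin_dt_011_0, gaugeRes_apply]
      simp +decide [phi_apply]
    have e4 : y 1 I101 = (l - 1) • -(c • x 1 I101) := by
      rw [hy, infin_dt_101_1, gaugeRes_apply]
      simp +decide [phi_apply]
    have e5 : y 0 I110 = x 0 I110 := by
      rw [hy, infin_dt_110_0, gaugeRes_apply]
      simp +decide [phi_apply]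
    have e6 : y 2 I101 = x 2 I101 := by
      rw [hy, infin_dt_101_2, gaugeRes_apply]
      simp +decide [phi_apply]
    have e7 : y 0 I111 = x 0 I111 := by
      rw [hy, infin_dt_111_0, gaugeRes_apply]
      simp +decide [phi_apply]
    have e8 : y 1 I111 = x 1 I111 := by
      rw [hy, infin_dt_111_1, gaugeRes_apply]
      simp +decide [phi_apply]
    have e9 : y 2 I111 = (1 + l) • e • x 2 I111 := by
      rw [hy, infin_dt_111_2, gaugeRes_apply]
      simp +decide [phi_apply]
    rw [gaugeRes_apply, e1, e2, e3, e4, e5, e6, e7, e8, e9, k1, k2, smul_neg, smul_neg, k2', k3,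
      neg_neg, gaugeRes_apply]

/-- Formal deformations of `d̃_λ` can be brought into the slice. -/
theorem exists_slice (hf : 𝔸.IsFormalBase) {a b c e : ℂ} (h1 : a + b * l = 1)
    (h2 : c * (1 - l) * c = c) (h3 : e * (1 + l) * e = e) {ψ : Cochain A}
    (hψ : IsDeformation 𝔸 (dt l) ψ) :
    ∃ ψ' : Cochain A, IsDeformation 𝔸 (dt l) ψ' ∧ DefEquivalent 𝔸 ψ' ψ ∧
      a • (ψ' 0 I101 - 1) + b • (ψ' 1 I011 - algebraMap ℂ A l) = 0 ∧
      c • ψ' 0 I011 = 0 ∧ c • ψ' 1 I101 = 0 ∧ ψ' 0 I110 = 0 ∧ ψ' 2 I101 = 0 ∧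
      ψ' 0 I111 = 0 ∧ ψ' 1 I111 = 0 ∧ e • ψ' 2 I111 = 0 := by
  obtain ⟨ψ', k1, k2, k3⟩ := exists_gauge hf (isGauge_gaugeRes l h1 h2 h3) hψ
  rw [gaugeRes_apply] at k3
  refine ⟨ψ', k1, k2, ?_, ?_, ?_, ?_, ?_, ?_, ?_, ?_⟩
  · have := congrFun (congrFun k3 2) I001
    simpa +decide [phi_apply, ext_dt_apply] using this
  · have := congrFun (congrFun k3 0) I010
    simpa +decide [phi_apply, ext_dt_apply] using this
  · have := congrFun (congrFun k3 1) I100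
    simpa +decide [phi_apply, ext_dt_apply] using this
  · have := congrFun (congrFun k3 2) I010
    simpa +decide [phi_apply, ext_dt_apply] using this
  · have := congrFun (congrFun k3 2) I100
    simpa +decide [phi_apply, ext_dt_apply] using this
  · have := congrFun (congrFun k3 2) I011
    simpa +decide [phi_apply, ext_dt_apply] using this
  · have := congrFun (congrFun k3 1) I110
    simpa +decide [phi_apply, ext_dt_apply] using this
  · have := congrFun (congrFun k3 2) I110
    simpa +decide [phi_apply, ext_dt_apply] using this

end Gauge

end LInfinity

end

noncomputable section

namespace LInfinity

/-! ## Evaluation of super power series -/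

section Evaluation

open SuperAug

variable {B : Type v} [Ring B] [Algebra ℂ B] {𝔹 : SuperAug B} {p q : ℕ}

/-- Evaluation of polynomials at central elements. -/
def polyEval (τ : Fin p → B) (hτ : ∀ i, τ i ∈ Subalgebra.center ℂ B) :
    MvPolynomial (Fin p) ℂ →ₐ[ℂ] B :=
  (Subalgebra.center ℂ B).val.comp (MvPolynomial.aeval fun i => ⟨τ i, hτ i⟩)

theorem polyEval_X (τ : Fin p → B) (hτ : ∀ i, τ i ∈ Subalgebra.center ℂ B) (i : Fin p) :
    polyEval τ hτ (MvPolynomial.X i) = τ i := by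
  simp [polyEval]

theorem polyEval_mem_part (h : 𝔹.IsLocalBase) {τ : Fin p → B}
    (hτ : ∀ i, τ i ∈ Subalgebra.center ℂ B) (h0 : ∀ i, τ i ∈ 𝔹.part 0)
    (f : MvPolynomial (Fin p) ℂ) : polyEval τ hτ f ∈ 𝔹.part 0 := by
  induction f using MvPolynomial.induction_on with
  | C c =>
    rw [← MvPolynomial.algebraMap_eq, AlgHom.commutes, Algebra.algebraMap_eq_smul_one]
    exact Submodule.smul_mem _ _ h.one_mem
  | add f g hf hg =>
    rw [map_add]
    exact Submodule.add_mem _ hf hg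
  | mul_X f i hf =>
    rw [map_mul, polyEval_X]
    exact h.mul_mem 0 0 _ _ hf (h0 i)

theorem aug_polyEval {τ : Fin p → B} (hτ : ∀ i, τ i ∈ Subalgebra.center ℂ B)
    (h1 : ∀ i, 𝔹.aug (τ i) = 0) (f : MvPolynomial (Fin p) ℂ) :
    𝔹.aug (polyEval τ hτ f) = MvPolynomial.constantCoeff f := by
  induction f using MvPolynomial.induction_on with
  | C c =>
    rw [← MvPolynomial.algebraMap_eq, AlgHom.commutes, AlgHom.commutes,
      MvPolynomial.algebraMap_eq, MvPolynomial.constantCoeff_C]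
    rfl
  | add f g hf hg => rw [map_add, map_add, map_add, hf, hg]
  | mul_X f i hf => rw [map_mul, polyEval_X, map_mul, h1 i]; simp

theorem polyEval_mem_pow {τ : Fin p → B} (hτ : ∀ i, τ i ∈ Subalgebra.center ℂ B)
    (h1 : ∀ i, 𝔹.aug (τ i) = 0) (n : ℕ) {f : MvPolynomial (Fin p) ℂ}
    (hf : f ∈ MvPolynomial.idealOfVars (Fin p) ℂ ^ (n + 1)) :
    polyEval τ hτ f ∈ 𝔹.maxIdeal ^ (n + 1) := by
  have base : ∀ f ∈ MvPolynomial.idealOfVars (Fin p) ℂ, polyEval τ hτ f ∈ 𝔹.maxIdeal := by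
    intro f hf
    have hle : MvPolynomial.idealOfVars (Fin p) ℂ ≤
        RingHom.ker (MvPolynomial.constantCoeff (R := ℂ) (σ := Fin p)) := by
      rw [MvPolynomial.idealOfVars, Ideal.span_le]
      rintro _ ⟨i, rfl⟩
      simp
    rw [mem_maxIdeal, aug_polyEval hτ h1]
    exact hle hf
  induction n generalizing f with
  | zero =>
    rw [zero_add, pow_one] at *
    exact base f hf
  | succ n ih =>
    rw [pow_succ] at hf ⊢
    refine Submodule.mul_induction_on hf (fun x hx y hy => ?_) fun x y hx hy => ?_
    · rw [map_mul]
      exact Submodule.mul_mem_mul (ih hx) (base y hy)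
    · rw [map_add]
      exact Submodule.add_mem _ hx hy

theorem eq_of_limit (hf : 𝔹.IsFormalBase) {s : ℕ → B} {a b : B}
    (ha : ∀ n, a - s n ∈ 𝔹.maxIdeal ^ (n + 1)) (hb : ∀ n, b - s n ∈ 𝔹.maxIdeal ^ (n + 1)) :
    a = b := by
  refine sub_eq_zero.1 (hf.hausdorff _ fun n => ?_)
  rw [← sub_sub_sub_cancel_right a b (s n)]
  exact Submodule.sub_mem _ (ha n) (hb n)

-- Even elements are central, so polynomials can be evaluated at them. Successive truncations of a
-- series differ by high powers of the variables, hence their values form a Cauchy sequence;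
-- completeness gives the value, and the Hausdorff property gives its uniqueness and with it
-- additivity and multiplicativity.
open MvPowerSeries in
theorem exists_seriesEval (hf : 𝔹.IsFormalBase) {τ : Fin p → B} (h0 : ∀ i, τ i ∈ 𝔹.part 0)
    (h1 : ∀ i, 𝔹.aug (τ i) = 0) :
    ∃ ev : MvPowerSeries (Fin p) ℂ →ₐ[ℂ] B, (∀ i, ev (X i) = τ i) ∧
      (∀ r, ev r ∈ 𝔹.part 0) ∧ ∀ r, 𝔹.aug (ev r) = constantCoeff r := by
  have hl := hf.toIsLocalBase
  have hτ : ∀ i, τ i ∈ Subalgebra.center ℂ B := fun i =>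
    Subalgebra.mem_center_iff.2 fun b => (hl.comm_of_even (h0 i)).symm
  set P := polyEval τ hτ with hP
  have lim : ∀ r : MvPowerSeries (Fin p) ℂ, ∃ a : B, ∀ n : ℕ,
      a - P (truncTotal (n + 1) r) ∈ 𝔹.maxIdeal ^ (n + 1) := by
    intro r
    refine hf.complete _ fun n => ?_
    rw [← map_sub]
    exact polyEval_mem_pow hτ h1 n
      (truncTotal_sub_truncTotal_mem_pow_idealOfVars (by omega) (by omega) r)
  choose ev hev using lim
  have hpoly : ∀ f : MvPolynomial (Fin p) ℂ, ev (f : MvPowerSeries (Fin p) ℂ) = P f := by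
    intro f
    refine eq_of_limit hf (hev f) fun n => ?_
    rw [← map_sub]
    refine polyEval_mem_pow hτ h1 n ?_
    rw [MvPolynomial.mem_pow_idealOfVars_iff']
    intro x hx
    rw [MvPolynomial.coeff_sub, sub_eq_zero, coeff_truncTotal _ hx, MvPolynomial.coeff_coe]
  have hone : ev 1 = 1 := by simpa using hpoly 1
  have hadd : ∀ r s, ev (r + s) = ev r + ev s := by
    intro r s
    refine eq_of_limit hf (hev (r + s)) fun n => ?_
    rw [map_add, map_add, add_sub_add_comm]
    exact Submodule.add_mem _ (hev r n) (hev s n)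
  have hmul : ∀ r s, ev (r * s) = ev r * ev s := by
    intro r s
    refine eq_of_limit hf (hev (r * s)) fun n => ?_
    -- The truncation of a product and the product of the truncations differ by a polynomial of high
    -- order, so all three terms lie in 𝔪^(n+1).
    have e : ev r * ev s - P (truncTotal (n + 1) (r * s)) =
        (ev r - P (truncTotal (n + 1) r)) * ev s +
          P (truncTotal (n + 1) r) * (ev s - P (truncTotal (n + 1) s)) -
          P (truncTotal (n + 1) (r * s) - truncTotal (n + 1) r * truncTotal (n + 1) s) := by
      rw [map_sub P, map_mul P]
      noncomm_ring
    rw [e]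
    exact Submodule.sub_mem _ (Submodule.add_mem _ (mul_mem_pow_right n _ (hev r n))
      (mul_mem_pow_left n _ (hev s n)))
      (polyEval_mem_pow hτ h1 n (truncTotal_mul_sub_mul_truncTotal_mem_pow_idealOfVars r s))
  have hC : ∀ c : ℂ, ev (algebraMap ℂ _ c) = algebraMap ℂ B c := by
    intro c
    have := hpoly (MvPolynomial.C c)
    rw [MvPolynomial.coe_C, ← MvPolynomial.algebraMap_eq, AlgHom.commutes] at this
    rw [← this, MvPowerSeries.algebraMap_apply]
    rfl
  have hzero : ev 0 = 0 := by simpa using hpoly 0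
  let E : MvPowerSeries (Fin p) ℂ →ₐ[ℂ] B :=
    { toFun := ev
      map_one' := hone
      map_mul' := hmul
      map_zero' := hzero
      map_add' := hadd
      commutes' := hC }
  refine ⟨E, ?_, ?_, ?_⟩
  · intro i
    have := hpoly (MvPolynomial.X i)
    rw [MvPolynomial.coe_X, hP, polyEval_X] at this
    exact this
  · exact fun r => hf.mem_part_of_limit 0 fun n => ⟨_, polyEval_mem_part hl hτ h0 _, hev r n⟩
  · intro r
    have := hev r 0
    rw [zero_add, pow_one, mem_maxIdeal, map_sub, hP, aug_polyEval hτ h1,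
      constantCoeff_truncTotal_eq_ite, if_pos (Nat.lt_succ_self 0), sub_eq_zero] at this
    exact this

theorem SuperSeries.ι_eq (m : Fin q → MvPowerSeries (Fin p) ℂ) :
    ExteriorAlgebra.ι (MvPowerSeries (Fin p) ℂ) m =
      ∑ i, algebraMap _ (SuperSeries p q) (m i) * SuperSeries.θ i := by
  conv_lhs => rw [pi_eq_sum_univ' m]
  rw [map_sum]
  refine Finset.sum_congr rfl fun i _ => ?_
  rw [map_smul, Algebra.smul_def, SuperSeries.θ]

/-- Evaluation at the even values makes B an algebra over the power series ring. Odd elements of B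
square to zero, so the universal property of the exterior algebra extends the map to the θ's. -/
theorem exists_superEval (hf : 𝔹.IsFormalBase) {τ : Fin p → B} {η : Fin q → B}
    (h0 : ∀ i, τ i ∈ 𝔹.part 0) (h1 : ∀ i, 𝔹.aug (τ i) = 0) (h2 : ∀ i, η i ∈ 𝔹.part 1) :
    ∃ F : SuperSeries p q →ₐ[ℂ] B, (∀ i, F (SuperSeries.t i) = τ i) ∧
      (∀ i, F (SuperSeries.θ i) = η i) ∧
      (∀ i, ∀ x ∈ SuperSeries.part i, F x ∈ 𝔹.part i) ∧
      ∀ x, 𝔹.aug (F x) = SuperSeries.aug x := by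
  have hl := hf.toIsLocalBase
  obtain ⟨ev, e1, e2, e3⟩ := exists_seriesEval hf h0 h1
  let _ : Algebra (MvPowerSeries (Fin p) ℂ) B :=
    ev.toRingHom.toAlgebra' fun r x => hl.comm_of_even (e2 r)
  have smul_eq : ∀ (r : MvPowerSeries (Fin p) ℂ) (x : B), r • x = ev r * x := fun r x => rfl
  have : IsScalarTower ℂ (MvPowerSeries (Fin p) ℂ) B :=
    IsScalarTower.of_algebraMap_eq fun c => (ev.commutes c).symm
  let f : (Fin q → MvPowerSeries (Fin p) ℂ) →ₗ[MvPowerSeries (Fin p) ℂ] B :=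
    Fintype.linearCombination _ η
  have f_apply : ∀ m, f m = ∑ i, ev (m i) * η i := fun m => by
    simp only [f, Fintype.linearCombination_apply, smul_eq]
  have f_odd : ∀ m, f m ∈ 𝔹.part 1 := fun m => by
    rw [f_apply]
    exact Submodule.sum_mem _ fun i _ => hl.mul_mem 0 1 _ _ (e2 _) (h2 i)
  let F : SuperSeries p q →ₐ[ℂ] B := (ExteriorAlgebra.lift (MvPowerSeries (Fin p) ℂ)
    ⟨f, fun m => hl.sq_odd (f_odd m)⟩).restrictScalars ℂ
  have Fι : ∀ m, F (ExteriorAlgebra.ι (MvPowerSeries (Fin p) ℂ) m) = f m := fun m =>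
    ExteriorAlgebra.lift_ι_apply _ f _ m
  have FC : ∀ r, F (algebraMap (MvPowerSeries (Fin p) ℂ) (SuperSeries p q) r) = ev r := fun r =>
    AlgHom.commutes (ExteriorAlgebra.lift (MvPowerSeries (Fin p) ℂ)
      ⟨f, fun m => hl.sq_odd (f_odd m)⟩) r
  refine ⟨F, fun i => ?_, fun i => ?_, fun i x hx => ?_, fun x => ?_⟩
  · rw [SuperSeries.t, FC, e1]
  · rw [SuperSeries.θ, Fι]
    simp [f, Fintype.linearCombination_apply_single]
  · change x ∈ CliffordAlgebra.evenOdd _ i at hx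
    induction x, hx using CliffordAlgebra.evenOdd_induction with
    | range_ι_pow v hv =>
      obtain rfl | rfl := (show ∀ i : ZMod 2, i = 0 ∨ i = 1 by decide) i
      · rw [ZMod.val_zero, pow_zero, Submodule.mem_one] at hv
        obtain ⟨r, rfl⟩ := hv
        exact (FC r).symm ▸ e2 r
      · rw [ZMod.val_one, pow_one] at hv
        obtain ⟨m, rfl⟩ := hv
        exact (Fι m).symm ▸ f_odd m
    | add x y _ _ hx hy =>
      rw [map_add]
      exact Submodule.add_mem _ hx hy
    | ι_mul_ι_mul m₁ m₂ x _ hx =>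
      rw [map_mul, map_mul]
      have := hl.mul_mem _ _ _ _ (hl.mul_mem 1 1 _ _ (f_odd m₁) (f_odd m₂)) hx
      rw [show (1 + 1 : ZMod 2) + i = i by
        rw [show (1 + 1 : ZMod 2) = 0 from rfl, zero_add]] at this
      have k1 := Fι m₁
      have k2 := Fι m₂
      rw [← k1, ← k2] at this
      exact this
  · induction x using ExteriorAlgebra.induction with
    | algebraMap r =>
      rw [FC, e3]
      change _ = MvPowerSeries.constantCoeff (ExteriorAlgebra.algebraMapInv
        (algebraMap (MvPowerSeries (Fin p) ℂ) (SuperSeries p q) r))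
      rw [ExteriorAlgebra.algebraMap_leftInverse]
    | ι m =>
      rw [Fι, hl.aug_odd (f_odd m), SuperSeries.ι_eq, map_sum]
      simp
    | mul a b ha hb => rw [map_mul, map_mul, map_mul, ha, hb]
    | add a b ha hb => rw [map_add, map_add, map_add, ha, hb]

theorem SuperSeries.proj_surjective (R : Set (SuperSeries p q)) :
    Function.Surjective (SuperSeries.proj R) := RingCon.mk'_surjective _

theorem SuperSeries.proj_eq_zero_iff (R : Set (SuperSeries p q)) (x : SuperSeries p q) :
    SuperSeries.proj R x = 0 ↔ x ∈ TwoSidedIdeal.span R := by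
  rw [TwoSidedIdeal.mem_iff]
  exact RingCon.eq _

theorem SuperSeries.proj_eq_zero {R : Set (SuperSeries p q)} {x : SuperSeries p q} (hx : x ∈ R) :
    SuperSeries.proj R x = 0 :=
  (SuperSeries.proj_eq_zero_iff R x).2 (TwoSidedIdeal.subset_span hx)

theorem SuperSeries.aug_proj (R : Set (SuperSeries p q)) (hR : ∀ r ∈ R, SuperSeries.aug r = 0)
    (x : SuperSeries p q) :
    (SuperSeries.base R hR).aug (SuperSeries.proj R x) = SuperSeries.aug x := rfl

/-- Bases of super power series with relations map to formal bases by prescribing the images of the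
variables. -/
theorem exists_baseHom (hf : 𝔹.IsFormalBase) (R : Set (SuperSeries p q))
    (hR : ∀ r ∈ R, SuperSeries.aug r = 0) (τ : Fin p → B) (η : Fin q → B)
    (h0 : ∀ i, τ i ∈ 𝔹.part 0) (h1 : ∀ i, 𝔹.aug (τ i) = 0) (h2 : ∀ i, η i ∈ 𝔹.part 1)
    (hrel : ∀ F : SuperSeries p q →ₐ[ℂ] B, (∀ i, F (SuperSeries.t i) = τ i) →
      (∀ i, F (SuperSeries.θ i) = η i) → ∀ r ∈ R, F r = 0) :
    ∃ f : SuperSeries.RelQuot R →ₐ[ℂ] B, IsBaseHom (SuperSeries.base R hR) 𝔹 f ∧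
      (∀ i, f (SuperSeries.proj R (SuperSeries.t i)) = τ i) ∧
      ∀ i, f (SuperSeries.proj R (SuperSeries.θ i)) = η i := by
  obtain ⟨F, k1, k2, k3, k4⟩ := exists_superEval (q := q) hf h0 h1 h2
  have hle : (TwoSidedIdeal.span R).ringCon ≤ RingCon.ker F.toRingHom := by
    have h : TwoSidedIdeal.span R ≤ TwoSidedIdeal.ker F := by
      rw [TwoSidedIdeal.span_le]
      exact fun r hr => (TwoSidedIdeal.mem_ker _).2 (hrel F k1 k2 r hr)
    intro x y hxy
    have hm := (TwoSidedIdeal.mem_ker _).1 (h ((TwoSidedIdeal.rel_iff _ x y).1 hxy))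
    rw [map_sub] at hm
    exact sub_eq_zero.1 hm
  have hproj : ∀ x, (TwoSidedIdeal.span R).ringCon.liftₐ F hle (SuperSeries.proj R x) = F x :=
    fun x => rfl
  refine ⟨(TwoSidedIdeal.span R).ringCon.liftₐ F hle, ⟨?_, ?_⟩, fun i => ?_, fun i => ?_⟩
  · rintro i _ ⟨x, hx, rfl⟩
    exact k3 i x hx
  · intro a
    obtain ⟨x, rfl⟩ := SuperSeries.proj_surjective R a
    rw [hproj, k4, SuperSeries.aug_proj]
  · rw [hproj, k1]
  · rw [hproj, k2]

end Evaluation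

end LInfinity

end

noncomputable section

namespace LInfinity

/-! ## Quotients of super power series algebras are formal bases -/

section Formal

open SuperAug

variable {p q : ℕ}

-- For one variable after another, the monomials divisible by it are split off. What is left in the
-- end is the constant term, which is zero.
open MvPowerSeries in
theorem mem_span_X_of_constantCoeff {r : MvPowerSeries (Fin p) ℂ} (hr : constantCoeff r = 0) :
    r ∈ Ideal.span (Set.range (X : Fin p → MvPowerSeries (Fin p) ℂ)) := by
  have key : ∀ s : Finset (Fin p), ∃ r' : MvPowerSeries (Fin p) ℂ,
      r - r' ∈ Ideal.span (Set.range (X : Fin p → MvPowerSeries (Fin p) ℂ)) ∧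
      ∀ m : Fin p →₀ ℕ, (∃ i ∈ s, m i ≠ 0) → coeff m r' = 0 := by
    intro s
    induction s using Finset.induction_on with
    | empty => exact ⟨r, by simp, by simp⟩
    | insert i s _ ih =>
      obtain ⟨r', h1, h2⟩ := ih
      let r'' : MvPowerSeries (Fin p) ℂ := fun m => if m i = 0 then coeff m r' else 0
      have hr'' : ∀ m, coeff m r'' = if m i = 0 then coeff m r' else 0 := fun m => rfl
      refine ⟨r'', ?_, fun m hm => ?_⟩
      · rw [← sub_add_sub_cancel r r' r'']
        refine Ideal.add_mem _ h1 ?_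
        obtain ⟨c, hc⟩ : (X i : MvPowerSeries (Fin p) ℂ) ∣ r' - r'' := by
          rw [X_dvd_iff]
          intro m hm
          rw [map_sub, hr'', if_pos hm, sub_self]
        rw [hc]
        exact Ideal.mul_mem_right _ _ (Ideal.subset_span ⟨i, rfl⟩)
      · rw [hr'']
        split_ifs with hmi
        · obtain ⟨j, hj, hmj⟩ := hm
          refine h2 m ⟨j, ?_, hmj⟩
          rcases Finset.mem_insert.1 hj with rfl | hj
          · exact absurd hmi hmj
          · exact hj
        · rfl
  obtain ⟨r', h1, h2⟩ := key Finset.univ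
  have hle : Ideal.span (Set.range (X : Fin p → MvPowerSeries (Fin p) ℂ)) ≤
      RingHom.ker (constantCoeff (σ := Fin p) (R := ℂ)) := by
    rw [Ideal.span_le]
    rintro _ ⟨i, rfl⟩
    simp
  have h3 : r' = 0 := by
    ext m
    by_cases hm : m = 0
    · have := hle h1
      rw [RingHom.mem_ker, map_sub, hr, zero_sub, neg_eq_zero] at this
      rw [hm]
      simpa using this
    · obtain ⟨i, hi⟩ := Finsupp.ne_iff.1 hm
      simpa using h2 m ⟨i, Finset.mem_univ i, hi⟩
  simpa [h3] using h1

/-- The ideal generated by the variables. -/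
def varIdeal (p : ℕ) : Ideal (MvPowerSeries (Fin p) ℂ) := Ideal.span (Set.range MvPowerSeries.X)

/-- Finite modules over power series rings are complete. -/
theorem exists_limit_of_finite {M : Type*} [AddCommGroup M] [Module (MvPowerSeries (Fin p) ℂ) M]
    [Module.Finite (MvPowerSeries (Fin p) ℂ) M] (s : ℕ → M)
    (hs : ∀ n, s (n + 1) - s n ∈ (varIdeal p ^ n • ⊤ : Submodule (MvPowerSeries (Fin p) ℂ) M)) :
    ∃ a : M, ∀ n, a - s n ∈ (varIdeal p ^ n • ⊤ : Submodule (MvPowerSeries (Fin p) ℂ) M) := by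
  obtain ⟨k, g, hg⟩ := Module.Finite.exists_fin (R := MvPowerSeries (Fin p) ℂ) (M := M)
  -- The n-th increment is a combination of the generators with coefficients in the n-th power of
  -- the ideal. Convergence is thereby moved to the coefficients, in the complete power series ring.
  have h1 : ∀ n, ∃ c : Fin k → MvPowerSeries (Fin p) ℂ, (∀ i, c i ∈ varIdeal p ^ n) ∧
      ∑ i, c i • g i = s (n + 1) - s n := by
    intro n
    have := hs n
    rw [← hg, Submodule.mem_ideal_smul_span_iff_exists_sum] at this
    obtain ⟨a, ha, e⟩ := this
    refine ⟨a, ha, ?_⟩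
    rw [← e, Finsupp.sum_fintype _ _ (by simp)]
  choose c hc1 hc2 using h1
  have hcomplete : IsAdicComplete (varIdeal p) (MvPowerSeries (Fin p) ℂ) := by
    unfold varIdeal
    infer_instance
  have h2 : ∀ i, ∃ L : MvPowerSeries (Fin p) ℂ, ∀ n,
      (∑ m ∈ Finset.range n, c m i) - L ∈ varIdeal p ^ n := by
    intro i
    have hmono : ∀ {m n : ℕ}, m ≤ n → (∑ j ∈ Finset.range m, c j i) ≡ (∑ j ∈ Finset.range n, c j i)
        [SMOD (varIdeal p ^ m • ⊤ : Submodule (MvPowerSeries (Fin p) ℂ) _)] := by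
      intro m n hmn
      refine SModEq.symm ?_
      rw [SModEq.sub_mem, smul_eq_mul, Ideal.mul_top, ← Finset.sum_Ico_eq_sub _ hmn]
      exact Ideal.sum_mem _ fun j hj => Ideal.pow_le_pow_right (Finset.mem_Ico.1 hj).1 (hc1 j i)
    obtain ⟨L, hL⟩ := IsPrecomplete.prec hcomplete.toIsPrecomplete hmono
    refine ⟨L, fun n => ?_⟩
    have := hL n
    rwa [SModEq.sub_mem, smul_eq_mul, Ideal.mul_top] at this
  choose L hL using h2
  refine ⟨s 0 + ∑ i, L i • g i, fun n => ?_⟩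
  have h3 : s n = s 0 + ∑ i, (∑ m ∈ Finset.range n, c m i) • g i := by
    simp only [Finset.sum_smul]
    rw [Finset.sum_comm]
    simp only [hc2]
    rw [Finset.sum_range_sub, add_sub_cancel]
  rw [h3, add_sub_add_left_eq_sub, ← Finset.sum_sub_distrib]
  refine Submodule.sum_mem _ fun i _ => ?_
  rw [← sub_smul, ← neg_sub, neg_smul]
  exact Submodule.neg_mem _ (Submodule.smul_mem_smul (hL i n) trivial)

instance : Module.Finite (MvPowerSeries (Fin p) ℂ) (SuperSeries p q) :=
  Module.Finite.of_basis (Pi.basisFun (MvPowerSeries (Fin p) ℂ) (Fin q)).ExteriorAlgebra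

theorem SuperSeries.supercomm (i j : ZMod 2) {a b : SuperSeries p q} (ha : a ∈ SuperSeries.part i)
    (hb : b ∈ SuperSeries.part j) : a * b = (-1) ^ (i.val * j.val) * (b * a) := by
  have h := CliffordAlgebra.map_mul_map_of_isOrtho_of_mem_evenOdd
    (QuadraticMap.Isometry.id (0 : QuadraticForm (MvPowerSeries (Fin p) ℂ) _))
    (QuadraticMap.Isometry.id (0 : QuadraticForm (MvPowerSeries (Fin p) ℂ) _))
    (fun x y => by simp [QuadraticMap.isOrtho_def]) a b ha hb
  simp only [CliffordAlgebra.map_id, AlgHom.id_apply] at h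
  rw [h]
  obtain rfl | rfl := (show ∀ i : ZMod 2, i = 0 ∨ i = 1 by decide) i <;>
  obtain rfl | rfl := (show ∀ i : ZMod 2, i = 0 ∨ i = 1 by decide) j <;>
  simp [ZMod.val_one]

variable (p q) in
/-- The span of the odd variables. -/
def oddSpan : Submodule (MvPowerSeries (Fin p) ℂ) (SuperSeries p q) :=
  LinearMap.range (ExteriorAlgebra.ι (MvPowerSeries (Fin p) ℂ))

/-- This is the exterior power of degree q + 1 of a free module of rank q. -/
theorem oddSpan_pow : oddSpan p q ^ (q + 1) = ⊥ := by
  have h := exteriorPower.finrank_eq (MvPowerSeries (Fin p) ℂ) (q + 1)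
    (M := Fin q → MvPowerSeries (Fin p) ℂ)
  rw [Module.finrank_fin_fun, Nat.choose_succ_self, Module.finrank_eq_zero_iff_of_free] at h
  exact (Submodule.subsingleton_iff_eq_bot).1 h

theorem top_mul_oddSpan : (⊤ : Submodule (MvPowerSeries (Fin p) ℂ) (SuperSeries p q)) * oddSpan p q ≤
    oddSpan p q * ⊤ := by
  have key : ∀ x : SuperSeries p q, ∀ y ∈ oddSpan p q * ⊤, x * y ∈ oddSpan p q * ⊤ := by
    intro x
    induction x using ExteriorAlgebra.induction with
    | algebraMap r =>
      intro y hy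
      rw [← Algebra.smul_def]
      exact Submodule.smul_mem _ _ hy
    | ι m => exact fun y _ => Submodule.mul_mem_mul ⟨m, rfl⟩ trivial
    | mul a b ha hb =>
      intro y hy
      rw [mul_assoc]
      exact ha _ (hb _ hy)
    | add a b ha hb =>
      intro y hy
      rw [add_mul]
      exact Submodule.add_mem _ (ha y hy) (hb y hy)
  refine Submodule.mul_le.2 fun x _ y hy => key x y ?_
  have := Submodule.mul_mem_mul hy (show (1 : SuperSeries p q) ∈ ⊤ from trivial)
  rwa [mul_one] at this

theorem exists_sub_mem_oddSpan (x : SuperSeries p q) :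
    ∃ r : MvPowerSeries (Fin p) ℂ, x - algebraMap _ _ r ∈ oddSpan p q * ⊤ := by
  induction x using ExteriorAlgebra.induction with
  | algebraMap r => exact ⟨r, by simp⟩
  | ι m =>
    refine ⟨0, ?_⟩
    have := Submodule.mul_mem_mul (show _ ∈ oddSpan p q from ⟨m, rfl⟩)
      (show (1 : SuperSeries p q) ∈ ⊤ from trivial)
    simpa using this
  | mul a b ha hb =>
    obtain ⟨r, hr⟩ := ha
    obtain ⟨s, hs⟩ := hb
    refine ⟨r * s, ?_⟩
    have e : a * b - algebraMap _ (SuperSeries p q) (r * s) =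
        (a - algebraMap _ _ r) * b + algebraMap _ _ r * (b - algebraMap _ _ s) := by
      rw [map_mul]
      noncomm_ring
    rw [e]
    refine Submodule.add_mem _ ?_ ?_
    · have := Submodule.mul_mem_mul hr (show b ∈ ⊤ from trivial)
      rw [mul_assoc] at this
      exact (show oddSpan p q * (⊤ * ⊤) ≤ oddSpan p q * ⊤ from mul_le_mul' le_rfl le_top) this
    · rw [← Algebra.smul_def]
      exact Submodule.smul_mem _ _ hs
  | add a b ha hb =>
    obtain ⟨r, hr⟩ := ha
    obtain ⟨s, hs⟩ := hb
    refine ⟨r + s, ?_⟩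
    rw [map_add, add_sub_add_comm]
    exact Submodule.add_mem _ hr hs

theorem aug_algebraMap (r : MvPowerSeries (Fin p) ℂ) :
    SuperSeries.aug (algebraMap _ (SuperSeries p q) r) = MvPowerSeries.constantCoeff r := by
  change MvPowerSeries.constantCoeff (ExteriorAlgebra.algebraMapInv
    (algebraMap (MvPowerSeries (Fin p) ℂ) (SuperSeries p q) r)) = _
  rw [ExteriorAlgebra.algebraMap_leftInverse]

theorem aug_oddSpan {x : SuperSeries p q} (hx : x ∈ oddSpan p q * ⊤) : SuperSeries.aug x = 0 := by
  induction hx using Submodule.mul_induction_on' with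
  | mem_mul_mem a ha b _ =>
    obtain ⟨m, rfl⟩ := ha
    rw [map_mul, SuperSeries.ι_eq, map_sum]
    simp
  | add a _ b _ ha hb => rw [map_add, ha, hb, add_zero]

theorem mem_of_aug_eq_zero {x : SuperSeries p q} (hx : SuperSeries.aug x = 0) :
    x ∈ (varIdeal p • ⊤ ⊔ oddSpan p q * ⊤ :
      Submodule (MvPowerSeries (Fin p) ℂ) (SuperSeries p q)) := by
  obtain ⟨r, hr⟩ := exists_sub_mem_oddSpan x
  have h1 := aug_oddSpan hr
  rw [map_sub, hx, zero_sub, neg_eq_zero, aug_algebraMap] at h1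
  rw [← sub_add_cancel x (algebraMap _ _ r)]
  refine Submodule.add_mem _ (Submodule.mem_sup_right hr) (Submodule.mem_sup_left ?_)
  rw [Algebra.algebraMap_eq_smul_one]
  exact Submodule.smul_mem_smul (mem_span_X_of_constantCoeff h1) trivial

/-- Products of many elements of the augmentation ideal are divisible by even variables. -/
theorem mem_of_mem_pow (k : ℕ) {x : SuperSeries p q}
    (hx : x ∈ (LinearMap.ker (SuperSeries.aug : SuperSeries p q →ₐ[ℂ] ℂ).toLinearMap) ^ (k + 1)) :
    x ∈ (varIdeal p • ⊤ ⊔ oddSpan p q ^ (k + 1) * ⊤ :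
      Submodule (MvPowerSeries (Fin p) ℂ) (SuperSeries p q)) := by
  have vmul : ∀ a ∈ (varIdeal p • ⊤ : Submodule (MvPowerSeries (Fin p) ℂ) (SuperSeries p q)),
      ∀ b, a * b ∈ (varIdeal p • ⊤ : Submodule (MvPowerSeries (Fin p) ℂ) (SuperSeries p q)) := by
    intro a ha b
    refine Submodule.smul_induction_on ha (fun r hr m _ => ?_) fun x y hx hy => ?_
    · rw [smul_mul_assoc]
      exact Submodule.smul_mem_smul hr trivial
    · rw [add_mul]
      exact Submodule.add_mem _ hx hy
  have mulv : ∀ a ∈ (varIdeal p • ⊤ : Submodule (MvPowerSeries (Fin p) ℂ) (SuperSeries p q)),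
      ∀ b, b * a ∈ (varIdeal p • ⊤ : Submodule (MvPowerSeries (Fin p) ℂ) (SuperSeries p q)) := by
    intro a ha b
    refine Submodule.smul_induction_on ha (fun r hr m _ => ?_) fun x y hx hy => ?_
    · rw [mul_smul_comm]
      exact Submodule.smul_mem_smul hr trivial
    · rw [mul_add]
      exact Submodule.add_mem _ hx hy
  induction k generalizing x with
  | zero =>
    rw [zero_add, pow_one] at *
    exact mem_of_aug_eq_zero hx
  | succ k ih =>
    rw [pow_succ] at hx
    induction hx using Submodule.mul_induction_on' with
    | mem_mul_mem a ha b hb =>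
      obtain ⟨a0, ha0, a1, ha1, rfl⟩ := Submodule.mem_sup.1 (ih ha)
      obtain ⟨b0, hb0, b1, hb1, rfl⟩ := Submodule.mem_sup.1 (mem_of_aug_eq_zero hb)
      -- Modulo the even variables only the product of the odd parts counts; its odd generators are
      -- collected on the left by `top_mul_oddSpan`.
      have e : (a0 + a1) * (b0 + b1) = (a0 * (b0 + b1) + a1 * b0) + a1 * b1 := by noncomm_ring
      rw [e]
      refine Submodule.add_mem _ (Submodule.mem_sup_left (Submodule.add_mem _ (vmul _ ha0 _)
        (mulv _ hb0 _))) (Submodule.mem_sup_right ?_)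
      have h1 := Submodule.mul_mem_mul ha1 hb1
      have h2 : oddSpan p q ^ (k + 1) * ⊤ * (oddSpan p q * ⊤) ≤ oddSpan p q ^ (k + 1 + 1) * ⊤ := by
        calc oddSpan p q ^ (k + 1) * ⊤ * (oddSpan p q * ⊤) =
            oddSpan p q ^ (k + 1) * (⊤ * oddSpan p q) * ⊤ := by simp only [mul_assoc]
          _ ≤ oddSpan p q ^ (k + 1) * (oddSpan p q * ⊤) * ⊤ :=
            mul_le_mul' (mul_le_mul' le_rfl top_mul_oddSpan) le_rfl
          _ = oddSpan p q ^ (k + 1 + 1) * (⊤ * ⊤) := by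
            rw [pow_succ _ (k + 1)]
            simp only [mul_assoc]
          _ ≤ _ := mul_le_mul' le_rfl le_top
      exact h2 h1
    | add a _ b _ ha hb => exact Submodule.add_mem _ ha hb

end Formal

end LInfinity

end

noncomputable section

namespace LInfinity

/-! ### Completeness and locality of the quotients -/

section FormalBase

open SuperAug SuperSeries

/-- After scaling to augmentation 1, the element is 1 - y with y in 𝔪 and is inverted by the
geometric series. -/
theorem SuperAug.isUnit_of_complete {A : Type u} [Ring A] [Algebra ℂ A] {𝔸 : SuperAug A}
    (hh : ∀ a : A, (∀ n : ℕ, a ∈ 𝔸.maxIdeal ^ (n + 1)) → a = 0)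
    (hc : ∀ s : ℕ → A, (∀ n : ℕ, s (n + 1) - s n ∈ 𝔸.maxIdeal ^ (n + 1)) →
      ∃ a : A, ∀ n : ℕ, a - s n ∈ 𝔸.maxIdeal ^ (n + 1)) {a : A} (ha : 𝔸.aug a ≠ 0) :
    IsUnit a := by
  obtain ⟨y, hy⟩ : ∃ y, y = 1 - (𝔸.aug a)⁻¹ • a := ⟨_, rfl⟩
  have hym : y ∈ 𝔸.maxIdeal := by
    rw [mem_maxIdeal, hy, map_sub, map_one, map_smul, smul_eq_mul, inv_mul_cancel₀ ha, sub_self]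
  have hpow : ∀ n, y ^ (n + 1) ∈ 𝔸.maxIdeal ^ (n + 1) := fun n => Submodule.pow_mem_pow _ hym _
  obtain ⟨b, hb⟩ := hc (fun n => ∑ i ∈ Finset.range (n + 1), y ^ i) fun n => by
    rw [Finset.sum_range_succ, add_sub_cancel_left]
    exact hpow n
  have h1 : (1 - y) * b = 1 := by
    rw [← sub_eq_zero]
    refine hh _ fun n => ?_
    have e : (1 - y) * b - 1 = (1 - y) * (b - ∑ i ∈ Finset.range (n + 1), y ^ i) - y ^ (n + 1) := by
      rw [mul_sub, mul_neg_geom_sum]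
      abel
    rw [e]
    exact Submodule.sub_mem _ (mul_mem_pow_left n _ (hb n)) (hpow n)
  have h2 : b * (1 - y) = 1 := by
    rw [← sub_eq_zero]
    refine hh _ fun n => ?_
    have e : b * (1 - y) - 1 = (b - ∑ i ∈ Finset.range (n + 1), y ^ i) * (1 - y) - y ^ (n + 1) := by
      rw [sub_mul, geom_sum_mul_neg]
      abel
    rw [e]
    exact Submodule.sub_mem _ (mul_mem_pow_right n _ (hb n)) (hpow n)
  have h3 : 1 - y = (𝔸.aug a)⁻¹ • a := by rw [hy, sub_sub_cancel]
  rw [h3] at h1 h2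
  exact ⟨⟨a, (𝔸.aug a)⁻¹ • b, by rw [mul_smul_comm, ← smul_mul_assoc, h1],
    by rw [smul_mul_assoc, ← mul_smul_comm, h2]⟩, rfl⟩

theorem SuperAug.isLocalRing_of_isUnit {A : Type u} [Ring A] [Algebra ℂ A] {𝔸 : SuperAug A}
    (h : ∀ a : A, 𝔸.aug a ≠ 0 → IsUnit a) : IsLocalRing A := by
  have : Nontrivial A := ⟨1, 0, fun e => by simpa using congrArg 𝔸.aug e⟩
  have key : ∀ a : A, a ∈ nonunits A → 𝔸.aug a = 0 := fun a ha => by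
    by_contra h0
    exact ha (h a h0)
  refine IsLocalRing.of_nonunits_add fun a b ha hb hab => ?_
  have := hab.map 𝔸.aug
  rw [map_add, key a ha, key b hb, add_zero] at this
  exact not_isUnit_zero this

variable {p q : ℕ} (R : Set (SuperSeries p q)) (hR : ∀ r ∈ R, aug r = 0)

theorem SuperSeries.base_maxIdeal : (base R hR).maxIdeal =
    (LinearMap.ker (aug : SuperSeries p q →ₐ[ℂ] ℂ).toLinearMap).map (proj R).toLinearMap := by
  ext x
  obtain ⟨x, rfl⟩ := proj_surjective R x
  rw [mem_maxIdeal, aug_proj, Submodule.mem_map]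
  constructor
  · intro h
    exact ⟨x, h, rfl⟩
  · rintro ⟨y, hy, e⟩
    have := congrArg (base R hR).aug e
    change (base R hR).aug (proj R y) = (base R hR).aug (proj R x) at this
    rw [aug_proj, aug_proj] at this
    rw [← this]
    exact hy

theorem SuperSeries.proj_smul (r : MvPowerSeries (Fin p) ℂ) (x : SuperSeries p q) :
    proj R (r • x) = r • proj R x := rfl

instance : Module.Finite (MvPowerSeries (Fin p) ℂ) (RelQuot R) :=
  Module.Finite.of_surjective
    ({ toFun := proj R, map_add' := map_add _, map_smul' := proj_smul R } :
      SuperSeries p q →ₗ[MvPowerSeries (Fin p) ℂ] RelQuot R) (proj_surjective R)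

/-- A product of q + 1 elements of 𝔪 has no purely odd part left, so 𝔪^(q+1) lies in the ideal of
the even variables. Together with `mem_maxIdeal_pow_of_mem_smul` this shows that the 𝔪-adic topology
is that of a finite module over the power series ring. -/
theorem SuperSeries.mem_smul_of_mem_maxIdeal_pow (n : ℕ) {x : RelQuot R}
    (hx : x ∈ (base R hR).maxIdeal ^ ((q + 1) * n)) :
    x ∈ (varIdeal p ^ n • ⊤ : Submodule (MvPowerSeries (Fin p) ℂ) (RelQuot R)) := by
  induction n generalizing x with
  | zero => simp
  | succ n ih =>
    rw [Nat.mul_succ, pow_add] at hx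
    induction hx using Submodule.mul_induction_on' with
    | mem_mul_mem a ha b hb =>
      rw [base_maxIdeal, ← Submodule.map_pow] at hb
      obtain ⟨b, hb, rfl⟩ := hb
      have hb' := mem_of_mem_pow q hb
      rw [oddSpan_pow, Submodule.bot_mul, sup_bot_eq] at hb'
      change a * proj R b ∈ _
      have hpb : proj R b ∈ (varIdeal p • ⊤ : Submodule (MvPowerSeries (Fin p) ℂ) (RelQuot R)) := by
        refine Submodule.smul_induction_on hb' (fun r hr m _ => ?_) fun x y hx hy => ?_
        · rw [proj_smul]
          exact Submodule.smul_mem_smul hr trivial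
        · rw [map_add]
          exact Submodule.add_mem _ hx hy
      refine Submodule.smul_induction_on hpb (fun r hr m _ => ?_) fun x y hx hy => ?_
      · refine Submodule.smul_induction_on (ih ha) (fun r' hr' m' _ => ?_) fun x y hx hy => ?_
        · rw [smul_mul_smul_comm, pow_succ]
          exact Submodule.smul_mem_smul (Ideal.mul_mem_mul hr' hr) trivial
        · rw [add_mul]
          exact Submodule.add_mem _ hx hy
      · rw [mul_add]
        exact Submodule.add_mem _ hx hy
    | add a _ b _ ha hb => exact Submodule.add_mem _ ha hb

theorem constantCoeff_of_mem_varIdeal {r : MvPowerSeries (Fin p) ℂ} (hr : r ∈ varIdeal p) :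
    MvPowerSeries.constantCoeff r = 0 := by
  have hle : varIdeal p ≤ RingHom.ker (MvPowerSeries.constantCoeff (σ := Fin p) (R := ℂ)) := by
    unfold varIdeal
    rw [Ideal.span_le]
    rintro _ ⟨i, rfl⟩
    simp
  exact hle hr

theorem SuperSeries.mem_maxIdeal_pow_of_mem_smul (n : ℕ) {x : RelQuot R}
    (hx : x ∈ (varIdeal p ^ (n + 1) • ⊤ :
      Submodule (MvPowerSeries (Fin p) ℂ) (RelQuot R))) :
    x ∈ (base R hR).maxIdeal ^ (n + 1) := by
  have key : ∀ r ∈ varIdeal p ^ (n + 1),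
      proj R (algebraMap _ _ r) ∈ (base R hR).maxIdeal ^ (n + 1) := by
    clear hx
    induction n with
    | zero =>
      intro r hr
      rw [zero_add, pow_one] at *
      rw [mem_maxIdeal, aug_proj, aug_algebraMap, constantCoeff_of_mem_varIdeal hr]
    | succ n ih =>
      intro r hr
      rw [pow_succ] at hr
      refine Submodule.mul_induction_on hr (fun a ha b hb => ?_) fun a b ha hb => ?_
      · rw [map_mul, map_mul, pow_succ]
        refine Submodule.mul_mem_mul (ih a ha) ?_
        rw [mem_maxIdeal, aug_proj, aug_algebraMap, constantCoeff_of_mem_varIdeal hb]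
      · rw [map_add, map_add]
        exact Submodule.add_mem _ ha hb
  refine Submodule.smul_induction_on hx (fun r hr m _ => ?_) fun x y hx hy => ?_
  · rw [Algebra.smul_def]
    exact mul_mem_pow_right n m (key r hr)
  · exact Submodule.add_mem _ hx hy

theorem SuperSeries.base_hausdorff (a : RelQuot R) (h : ∀ n : ℕ, a ∈ (base R hR).maxIdeal ^ (n + 1)) :
    a = 0 := by
  have hne : varIdeal p ≠ ⊤ := fun e => by
    have := constantCoeff_of_mem_varIdeal (p := p) (r := 1) (e ▸ trivial)
    simp at this
  -- Krull's intersection theorem for a finite module over the Noetherian local power series ring.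
  have := Ideal.iInf_pow_smul_eq_bot_of_isLocalRing (M := RelQuot R) (varIdeal p) hne
  rw [← Submodule.mem_bot (MvPowerSeries (Fin p) ℂ), ← this, Submodule.mem_iInf]
  rintro (_ | n)
  · simp
  · exact mem_smul_of_mem_maxIdeal_pow R hR (n + 1) (h _)

theorem SuperSeries.base_complete (s : ℕ → RelQuot R)
    (hs : ∀ n : ℕ, s (n + 1) - s n ∈ (base R hR).maxIdeal ^ (n + 1)) :
    ∃ a, ∀ n : ℕ, a - s n ∈ (base R hR).maxIdeal ^ (n + 1) := by
  have hs' : ∀ n m, n ≤ m → s m - s n ∈ (base R hR).maxIdeal ^ (n + 1) := by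
    intro n m hnm
    induction m, hnm using Nat.le_induction with
    | base => simp
    | succ m hm ih =>
      rw [← sub_add_sub_cancel _ (s m)]
      exact Submodule.add_mem _ (pow_le_pow hm (hs m)) ih
  -- Along the indices (q + 1) n the sequence is Cauchy for the powers of the ideal of even
  -- variables; for n = 0 there is no condition.
  obtain ⟨a, ha⟩ := exists_limit_of_finite (fun n => s ((q + 1) * n)) fun n => by
    rcases n with _ | n
    · simp
    · refine mem_smul_of_mem_maxIdeal_pow R hR (n + 1) ?_
      have h1 := hs' ((q + 1) * (n + 1)) ((q + 1) * (n + 1 + 1)) (Nat.mul_le_mul le_rfl (by omega))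
      have e : (q + 1) * (n + 1) = ((q + 1) * (n + 1) - 1) + 1 :=
        (Nat.sub_add_cancel (Nat.mul_pos (by omega) (by omega))).symm
      have h2 := pow_le_pow (𝔸 := base R hR) (m := (q + 1) * (n + 1) - 1) (n := (q + 1) * (n + 1)) (by omega) h1
      rwa [← e] at h2
  refine ⟨a, fun n => ?_⟩
  rw [← sub_add_sub_cancel a (s ((q + 1) * (n + 1)))]
  refine Submodule.add_mem _ (mem_maxIdeal_pow_of_mem_smul R hR n (ha (n + 1))) (hs' _ _ ?_)
  nlinarith

/-- The parity involution fixes homogeneous generators up to sign. Stability of the ideal under it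
makes the ideal graded, so that the quotient is still the direct sum of its even and odd parts. -/
theorem SuperSeries.involute_mem {R : Set (SuperSeries p q)}
    (hhom : ∀ r ∈ R, r ∈ part 0 ∨ r ∈ part 1) {x : SuperSeries p q}
    (hx : x ∈ TwoSidedIdeal.span R) : CliffordAlgebra.involute x ∈ TwoSidedIdeal.span R := by
  have hle : TwoSidedIdeal.span R ≤ (TwoSidedIdeal.span R).comap
      (CliffordAlgebra.involute (Q := (0 : QuadraticForm (MvPowerSeries (Fin p) ℂ)
        (Fin q → MvPowerSeries (Fin p) ℂ)))) := by
    rw [TwoSidedIdeal.span_le]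
    intro r hr
    change r ∈ TwoSidedIdeal.comap _ _
    rw [TwoSidedIdeal.mem_comap]
    rcases hhom r hr with h | h
    · rw [CliffordAlgebra.involute_eq_of_mem_even h]
      exact TwoSidedIdeal.subset_span hr
    · rw [CliffordAlgebra.involute_eq_of_mem_odd h]
      exact neg_mem (TwoSidedIdeal.subset_span hr)
  exact (TwoSidedIdeal.mem_comap _).1 (hle hx)

theorem SuperSeries.base_isCompl (hhom : ∀ r ∈ R, r ∈ part 0 ∨ r ∈ part 1) :
    IsCompl ((base R hR).part 0) ((base R hR).part 1) := by
  have hc := CliffordAlgebra.evenOdd_isCompl (Q := (0 : QuadraticForm (MvPowerSeries (Fin p) ℂ)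
        (Fin q → MvPowerSeries (Fin p) ℂ)))
  constructor
  · rw [Submodule.disjoint_def]
    rintro _ ⟨x, hx, rfl⟩ ⟨y, hy, e⟩
    change proj R y = proj R x at e
    change proj R x = 0
    have h1 : x - y ∈ TwoSidedIdeal.span R := by
      rw [← proj_eq_zero_iff, map_sub, e, sub_self]
    have h2 := involute_mem hhom h1
    rw [map_sub, CliffordAlgebra.involute_eq_of_mem_even hx,
      CliffordAlgebra.involute_eq_of_mem_odd hy, sub_neg_eq_add, ← proj_eq_zero_iff, map_add, e,
      ← two_smul ℂ] at h2
    exact (smul_eq_zero_iff_right two_ne_zero).1 h2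
  · rw [codisjoint_iff, eq_top_iff]
    rintro x -
    obtain ⟨x, rfl⟩ := proj_surjective R x
    obtain ⟨a, ha, b, hb, rfl⟩ := Submodule.mem_sup.1
      (show x ∈ _ ⊔ _ by rw [hc.sup_eq_top]; trivial)
    rw [map_add]
    exact Submodule.add_mem_sup ⟨a, ha, rfl⟩ ⟨b, hb, rfl⟩

/-- A quotient of a super power series algebra by homogeneous relations is a formal base. -/
theorem SuperSeries.isFormalBase_base (hhom : ∀ r ∈ R, r ∈ part 0 ∨ r ∈ part 1) :
    (base R hR).IsFormalBase where
  isCompl := base_isCompl R hR hhom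
  one_mem := ⟨1, SetLike.GradedOne.one_mem (A := CliffordAlgebra.evenOdd _), map_one (proj R)⟩
  mul_mem := by
    rintro i j _ _ ⟨a, ha, rfl⟩ ⟨b, hb, rfl⟩
    exact ⟨a * b, CliffordAlgebra.evenOdd_mul_le _ i j (Submodule.mul_mem_mul ha hb),
      map_mul (proj R) a b⟩
  supercomm := by
    rintro i j _ _ ⟨a, ha, rfl⟩ ⟨b, hb, rfl⟩
    have := congrArg (proj R) (supercomm i j ha hb)
    simpa using this
  isLocal := isLocalRing_of_isUnit fun a ha =>
    isUnit_of_complete (base_hausdorff R hR) (base_complete R hR) ha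
  hausdorff := base_hausdorff R hR
  complete := base_complete R hR

end FormalBase

end LInfinity

end

noncomputable section

namespace LInfinity

/-! ### The three families, and relations making them codifferentials -/

open SuperSeries

/-- The entries of a cochain, by columns. -/
theorem cochain_ext {A : Type u} {φ ψ : Cochain A} (h100 : ∀ j, φ j I100 = ψ j I100)
    (h010 : ∀ j, φ j I010 = ψ j I010) (h001 : ∀ j, φ j I001 = ψ j I001)
    (h110 : ∀ j, φ j I110 = ψ j I110) (h101 : ∀ j, φ j I101 = ψ j I101)
    (h011 : ∀ j, φ j I011 = ψ j I011) (h111 : ∀ j, φ j I111 = ψ j I111) : φ = ψ := by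
  ext j I
  rcases mono_cases I with rfl | rfl | rfl | rfl | rfl | rfl | rfl
  exacts [h100 j, h010 j, h001 j, h110 j, h101 j, h011 j, h111 j]

/-- The cochain with given columns. -/
def ofColumns {A : Type u} (c100 c010 c001 c110 c101 c011 c111 : Fin 3 → A) : Cochain A :=
  fun j I =>
    if I = I100 then c100 j else if I = I010 then c010 j else if I = I001 then c001 j
    else if I = I110 then c110 j else if I = I101 then c101 j else if I = I011 then c011 j
    else c111 j

section

variable {A : Type u} (c100 c010 c001 c110 c101 c011 c111 : Fin 3 → A) (j : Fin 3)

@[simp] theorem ofColumns_100 : ofColumns c100 c010 c001 c110 c101 c011 c111 j I100 = c100 j := rfl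
@[simp] theorem ofColumns_010 : ofColumns c100 c010 c001 c110 c101 c011 c111 j I010 = c010 j := rfl
@[simp] theorem ofColumns_001 : ofColumns c100 c010 c001 c110 c101 c011 c111 j I001 = c001 j := rfl
@[simp] theorem ofColumns_110 : ofColumns c100 c010 c001 c110 c101 c011 c111 j I110 = c110 j := rfl
@[simp] theorem ofColumns_101 : ofColumns c100 c010 c001 c110 c101 c011 c111 j I101 = c101 j := rfl
@[simp] theorem ofColumns_011 : ofColumns c100 c010 c001 c110 c101 c011 c111 j I011 = c011 j := rfl
@[simp] theorem ofColumns_111 : ofColumns c100 c010 c001 c110 c101 c011 c111 j I111 = c111 j := rfl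

end

variable {A : Type u} [Ring A] [Algebra ℂ A]

/-- The three families are written over an arbitrary algebra: they commute with change of base, and
the same expression serves for the universal deformation and for the normal form of a given one. -/
def formGen (l : ℂ) (t : A) (θ : Fin 4 → A) : Cochain A :=
  ofColumns ![θ 0, 0, 0] ![0, θ 1, 0] ![θ 2, θ 3, 0] 0 ![1, 0, 0]
    ![0, algebraMap ℂ A l + t, 0] 0

def formNeg (t : Fin 2 → A) (θ : Fin 5 → A) : Cochain A :=
  ofColumns ![θ 0, 0, t 1 * θ 3] ![0, θ 1, t 1 * θ 2] ![θ 2, θ 3, 0] ![0, θ 3 * θ 4, t 1] ![1, 0, 0]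
    ![0, -1 + t 0, θ 2 * θ 4] ![0, 0, θ 4]

def formOne (t : Fin 3 → A) (θ : Fin 6 → A) : Cochain A :=
  ofColumns ![θ 0, θ 4, 0] ![θ 5, θ 1, 0] ![θ 2, θ 3, 0] 0 ![1 + t 0, t 1, 0]
    ![t 2, 1 - t 0, 0] 0

theorem defGen_eq (l : ℂ) :
    defGen l = formGen l (proj relGen (t 0)) (fun i => proj relGen (θ i)) := by
  apply cochain_ext <;> intro j <;> fin_cases j <;>
    simp +decide [defGen, formGen, phi_apply, ext_dt_apply]

theorem defNeg_eq :
    defNeg = formNeg (fun i => proj relNeg (t i)) (fun i => proj relNeg (θ i)) := by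
  apply cochain_ext <;> intro j <;> fin_cases j <;>
    simp +decide [defNeg, formNeg, phi_apply, ext_dt_apply]

theorem defOne_eq :
    defOne = formOne (fun i => proj relOne (t i)) (fun i => proj relOne (θ i)) := by
  apply cochain_ext <;> intro j <;> fin_cases j <;>
    simp +decide [defOne, formOne, phi_apply, ext_dt_apply, sub_eq_add_neg]

variable {𝔸 : SuperAug A}

/-- The entries of an odd cochain, by columns. -/
theorem mem_part_of_columns {φ : Cochain A} (h100 : ∀ j, φ j I100 ∈ 𝔸.part 1)
    (h010 : ∀ j, φ j I010 ∈ 𝔸.part 1) (h001 : ∀ j, φ j I001 ∈ 𝔸.part 1)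
    (h110 : ∀ j, φ j I110 ∈ 𝔸.part 0) (h101 : ∀ j, φ j I101 ∈ 𝔸.part 0)
    (h011 : ∀ j, φ j I011 ∈ 𝔸.part 0) (h111 : ∀ j, φ j I111 ∈ 𝔸.part 1)
    (j : Fin 3) (I : Mono) : φ j I ∈ 𝔸.part I.parity := by
  rcases mono_cases I with rfl | rfl | rfl | rfl | rfl | rfl | rfl
  exacts [h100 j, h010 j, h001 j, h110 j, h101 j, h011 j, h111 j]

/-- The Maurer-Cartan equation in coordinates. -/
theorem isCodifferential_of_entries (h : 𝔸.IsLocalBase) {φ : Cochain A}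
    (hφ : ∀ (j : Fin 3) (I : Mono), φ j I ∈ 𝔸.part I.parity)
    (h100_0 : φ 0 I100 * φ 0 I100 + φ 0 I010 * φ 1 I100 + φ 0 I001 * φ 2 I100 = 0)
    (h100_1 : φ 1 I100 * φ 0 I100 + φ 1 I010 * φ 1 I100 + φ 1 I001 * φ 2 I100 = 0)
    (h100_2 : φ 2 I100 * φ 0 I100 + φ 2 I010 * φ 1 I100 + φ 2 I001 * φ 2 I100 = 0)
    (h010_0 : φ 0 I100 * φ 0 I010 + φ 0 I010 * φ 1 I010 + φ 0 I001 * φ 2 I010 = 0)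
    (h010_1 : φ 1 I100 * φ 0 I010 + φ 1 I010 * φ 1 I010 + φ 1 I001 * φ 2 I010 = 0)
    (h010_2 : φ 2 I100 * φ 0 I010 + φ 2 I010 * φ 1 I010 + φ 2 I001 * φ 2 I010 = 0)
    (h001_0 : φ 0 I100 * φ 0 I001 + φ 0 I010 * φ 1 I001 + φ 0 I001 * φ 2 I001 = 0)
    (h001_1 : φ 1 I100 * φ 0 I001 + φ 1 I010 * φ 1 I001 + φ 1 I001 * φ 2 I001 = 0)
    (h001_2 : φ 2 I100 * φ 0 I001 + φ 2 I010 * φ 1 I001 + φ 2 I001 * φ 2 I001 = 0)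
    (h110_0 : -φ 0 I100 * φ 0 I110 - φ 0 I010 * φ 1 I110 - φ 0 I001 * φ 2 I110 + φ 0 I110 * φ 0
      I100 + φ 0 I110 * φ 1 I010 + φ 0 I101 * φ 2 I010 - φ 0 I011 * φ 2 I100 = 0)
    (h110_1 : -φ 1 I100 * φ 0 I110 - φ 1 I010 * φ 1 I110 - φ 1 I001 * φ 2 I110 + φ 1 I110 * φ 0
      I100 + φ 1 I110 * φ 1 I010 + φ 1 I101 * φ 2 I010 - φ 1 I011 * φ 2 I100 = 0)
    (h110_2 : -φ 2 I100 * φ 0 I110 - φ 2 I010 * φ 1 I110 - φ 2 I001 * φ 2 I110 + φ 2 I110 * φ 0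
      I100 + φ 2 I110 * φ 1 I010 + φ 2 I101 * φ 2 I010 - φ 2 I011 * φ 2 I100 = 0)
    (h101_0 : -φ 0 I100 * φ 0 I101 - φ 0 I010 * φ 1 I101 - φ 0 I001 * φ 2 I101 + φ 0 I110 * φ 1
      I001 + φ 0 I101 * φ 0 I100 + φ 0 I101 * φ 2 I001 + φ 0 I011 * φ 1 I100 = 0)
    (h101_1 : -φ 1 I100 * φ 0 I101 - φ 1 I010 * φ 1 I101 - φ 1 I001 * φ 2 I101 + φ 1 I110 * φ 1
      I001 + φ 1 I101 * φ 0 I100 + φ 1 I101 * φ 2 I001 + φ 1 I011 * φ 1 I100 = 0)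
    (h101_2 : -φ 2 I100 * φ 0 I101 - φ 2 I010 * φ 1 I101 - φ 2 I001 * φ 2 I101 + φ 2 I110 * φ 1
      I001 + φ 2 I101 * φ 0 I100 + φ 2 I101 * φ 2 I001 + φ 2 I011 * φ 1 I100 = 0)
    (h011_0 : -φ 0 I100 * φ 0 I011 - φ 0 I010 * φ 1 I011 - φ 0 I001 * φ 2 I011 - φ 0 I110 * φ 0
      I001 + φ 0 I101 * φ 0 I010 + φ 0 I011 * φ 1 I010 + φ 0 I011 * φ 2 I001 = 0)
    (h011_1 : -φ 1 I100 * φ 0 I011 - φ 1 I010 * φ 1 I011 - φ 1 I001 * φ 2 I011 - φ 1 I110 * φ 0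
      I001 + φ 1 I101 * φ 0 I010 + φ 1 I011 * φ 1 I010 + φ 1 I011 * φ 2 I001 = 0)
    (h011_2 : -φ 2 I100 * φ 0 I011 - φ 2 I010 * φ 1 I011 - φ 2 I001 * φ 2 I011 - φ 2 I110 * φ 0
      I001 + φ 2 I101 * φ 0 I010 + φ 2 I011 * φ 1 I010 + φ 2 I011 * φ 2 I001 = 0)
    (h111_0 : φ 0 I100 * φ 0 I111 + φ 0 I010 * φ 1 I111 + φ 0 I001 * φ 2 I111 - φ 0 I110 * φ 0
      I101 - φ 0 I110 * φ 1 I011 + φ 0 I101 * φ 0 I110 - φ 0 I101 * φ 2 I011 + φ 0 I011 * φ 1 I110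
      + φ 0 I011 * φ 2 I101 + φ 0 I111 * φ 0 I100 + φ 0 I111 * φ 1 I010 + φ 0 I111 * φ 2 I001 = 0)
    (h111_1 : φ 1 I100 * φ 0 I111 + φ 1 I010 * φ 1 I111 + φ 1 I001 * φ 2 I111 - φ 1 I110 * φ 0
      I101 - φ 1 I110 * φ 1 I011 + φ 1 I101 * φ 0 I110 - φ 1 I101 * φ 2 I011 + φ 1 I011 * φ 1 I110
      + φ 1 I011 * φ 2 I101 + φ 1 I111 * φ 0 I100 + φ 1 I111 * φ 1 I010 + φ 1 I111 * φ 2 I001 = 0)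
    (h111_2 : φ 2 I100 * φ 0 I111 + φ 2 I010 * φ 1 I111 + φ 2 I001 * φ 2 I111 - φ 2 I110 * φ 0
      I101 - φ 2 I110 * φ 1 I011 + φ 2 I101 * φ 0 I110 - φ 2 I101 * φ 2 I011 + φ 2 I011 * φ 1 I110
      + φ 2 I011 * φ 2 I101 + φ 2 I111 * φ 0 I100 + φ 2 I111 * φ 1 I010 + φ 2 I111 * φ 2 I001 = 0) :
    IsCodifferential 𝔸 φ := by
  refine ⟨hφ, coder_sq_eq_zero h hφ fun j I => ?_⟩
  rcases mono_cases I with rfl | rfl | rfl | rfl | rfl | rfl | rfl <;> fin_cases j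
  · exact (sq_100_0 φ).trans h100_0
  · exact (sq_100_1 φ).trans h100_1
  · exact (sq_100_2 φ).trans h100_2
  · exact (sq_010_0 φ).trans h010_0
  · exact (sq_010_1 φ).trans h010_1
  · exact (sq_010_2 φ).trans h010_2
  · exact (sq_001_0 φ).trans h001_0
  · exact (sq_001_1 φ).trans h001_1
  · exact (sq_001_2 φ).trans h001_2
  · exact (sq_110_0 φ).trans h110_0
  · exact (sq_110_1 φ).trans h110_1
  · exact (sq_110_2 φ).trans h110_2
  · exact (sq_101_0 φ).trans h101_0
  · exact (sq_101_1 φ).trans h101_1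
  · exact (sq_101_2 φ).trans h101_2
  · exact (sq_011_0 φ).trans h011_0
  · exact (sq_011_1 φ).trans h011_1
  · exact (sq_011_2 φ).trans h011_2
  · exact (sq_111_0 φ).trans h111_0
  · exact (sq_111_1 φ).trans h111_1
  · exact (sq_111_2 φ).trans h111_2

theorem SuperAug.IsLocalBase.algebraMap_mem (h : 𝔸.IsLocalBase) (c : ℂ) :
    algebraMap ℂ A c ∈ 𝔸.part 0 := by
  rw [Algebra.algebraMap_eq_smul_one]
  exact Submodule.smul_mem _ _ h.one_mem

theorem formGen_odd (h : 𝔸.IsLocalBase) (l : ℂ) {t : A} {θ : Fin 4 → A} (ht : t ∈ 𝔸.part 0)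
    (hθ : ∀ i, θ i ∈ 𝔸.part 1) (j : Fin 3) (I : Mono) : formGen l t θ j I ∈ 𝔸.part I.parity := by
  apply mem_part_of_columns <;> intro j <;> fin_cases j <;>
    simp [formGen, hθ, h.one_mem, Submodule.add_mem _ (h.algebraMap_mem l) ht]

theorem formNeg_odd (h : 𝔸.IsLocalBase) {t : Fin 2 → A} {θ : Fin 5 → A} (ht : ∀ i, t i ∈ 𝔸.part 0)
    (hθ : ∀ i, θ i ∈ 𝔸.part 1) (j : Fin 3) (I : Mono) : formNeg t θ j I ∈ 𝔸.part I.parity := by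
  have h01 : ∀ i j, t i * θ j ∈ 𝔸.part 1 := fun i j => h.mul_mem 0 1 _ _ (ht i) (hθ j)
  have h11 : ∀ i j, θ i * θ j ∈ 𝔸.part 0 := fun i j => h.mul_mem 1 1 _ _ (hθ i) (hθ j)
  apply mem_part_of_columns <;> intro j <;> fin_cases j <;>
    simp [formNeg, hθ, ht, h01, h11, h.one_mem,
      Submodule.add_mem _ (Submodule.neg_mem _ h.one_mem) (ht 0)]

theorem formOne_odd (h : 𝔸.IsLocalBase) {t : Fin 3 → A} {θ : Fin 6 → A} (ht : ∀ i, t i ∈ 𝔸.part 0)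
    (hθ : ∀ i, θ i ∈ 𝔸.part 1) (j : Fin 3) (I : Mono) : formOne t θ j I ∈ 𝔸.part I.parity := by
  apply mem_part_of_columns <;> intro j <;> fin_cases j <;>
    simp [formOne, hθ, ht, h.one_mem, Submodule.add_mem _ h.one_mem (ht 0),
      Submodule.sub_mem _ h.one_mem (ht 0)]

theorem isCodifferential_formGen (h : 𝔸.IsLocalBase) (l : ℂ) {t : A} {θ : Fin 4 → A}
    (ht : t ∈ 𝔸.part 0) (hθ : ∀ i, θ i ∈ 𝔸.part 1) (h02 : θ 0 * θ 2 = 0) (h13 : θ 1 * θ 3 = 0) :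
    IsCodifferential 𝔸 (formGen l t θ) := by
  have hs : ∀ i, θ i * θ i = 0 := fun i => h.sq_odd (hθ i)
  have hc : ∀ i, θ i * t = t * θ i := fun i => (h.comm_of_even ht).symm
  apply isCodifferential_of_entries h (formGen_odd h l ht hθ) <;>
    simp [formGen, hs, h02, h13, mul_add, add_mul, hc, Algebra.commutes l]

/-- Let Θ be the odd matrix with rows (θ 0, θ 5), (θ 4, θ 1), let v be the odd vector (θ 2, θ 3),
and let M be the even matrix with rows (1 + t 0, t 2), (t 1, 1 - t 0). The Maurer–Cartan equation
says Θ² = 0 (`r4`, `r7`, `r8`), Θ v = 0 (`r5`, `r6`) and [M, Θ] = 0 (`r1`, `r2`, `r3`). -/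
theorem isCodifferential_formOne (h : 𝔸.IsLocalBase) {t : Fin 3 → A} {θ : Fin 6 → A}
    (ht : ∀ i, t i ∈ 𝔸.part 0) (hθ : ∀ i, θ i ∈ 𝔸.part 1)
    (r1 : t 2 * θ 4 - t 1 * θ 5 = 0) (r2 : 2 * t 0 * θ 4 + t 1 * (θ 1 - θ 0) = 0)
    (r3 : 2 * t 0 * θ 5 + t 2 * (θ 1 - θ 0) = 0) (r4 : θ 4 * θ 5 = 0)
    (r5 : θ 0 * θ 2 - θ 3 * θ 5 = 0) (r6 : θ 1 * θ 3 - θ 2 * θ 4 = 0)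
    (r7 : θ 1 * θ 4 - θ 0 * θ 4 = 0) (r8 : θ 0 * θ 5 - θ 1 * θ 5 = 0) :
    IsCodifferential 𝔸 (formOne t θ) := by
  have hs : ∀ i, θ i * θ i = 0 := fun i => h.sq_odd (hθ i)
  have hc : ∀ i j, θ i * t j = t j * θ i := fun i j => (h.comm_of_even (ht j)).symm
  have ha : ∀ i j, θ i * θ j = - (θ j * θ i) := fun i j => h.anticomm (hθ i) (hθ j)
  apply isCodifferential_of_entries h (formOne_odd h ht hθ) <;>
    simp [formOne, hs, mul_add, add_mul, mul_sub, sub_mul, hc, r4]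
  · rw [ha, r4, neg_zero]
  · linear_combination (norm := noncomm_ring) ha 4 0 + r7
  · linear_combination (norm := noncomm_ring) ha 5 1 + r8
  · linear_combination (norm := noncomm_ring) ha 5 3 + r5
  · linear_combination (norm := noncomm_ring) ha 4 2 + r6
  · linear_combination (norm := noncomm_ring) r1
  · linear_combination (norm := noncomm_ring) -r2
  · linear_combination (norm := noncomm_ring) r3
  · linear_combination (norm := noncomm_ring) -r1

/-- The relations are components of the equation: `r1`, `r2` in the column 001, `r3` in 100 and 010,
`r4` in 110, `r5` in 111. The second order entries make the other components follow from these and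
from the signs of odd elements. -/
theorem isCodifferential_formNeg (h : 𝔸.IsLocalBase) {t : Fin 2 → A} {θ : Fin 5 → A}
    (ht : ∀ i, t i ∈ 𝔸.part 0) (hθ : ∀ i, θ i ∈ 𝔸.part 1)
    (r1 : θ 0 * θ 2 = 0) (r2 : θ 1 * θ 3 = 0) (r3 : t 1 * θ 2 * θ 3 = 0)
    (r4 : t 1 * θ 0 + t 1 * θ 1 = 0) (r5 : θ 4 * θ 0 + θ 4 * θ 1 - t 0 * t 1 = 0) :
    IsCodifferential 𝔸 (formNeg t θ) := by
  have ht1 : t 0 * t 1 = t 1 * t 0 := h.comm_of_even (ht 0)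
  have hs : ∀ i, θ i * θ i = 0 := fun i => h.sq_odd (hθ i)
  have hc : ∀ i j, θ i * t j = t j * θ i := fun i j => (h.comm_of_even (ht j)).symm
  have ha : ∀ i j, θ i * θ j = - (θ j * θ i) := fun i j => h.anticomm (hθ i) (hθ j)
  apply isCodifferential_of_entries h (formNeg_odd h ht hθ) <;>
    simp [formNeg, hs, mul_add, add_mul, mul_sub, sub_mul, hc, r1, r2, r3]
  · rw [← mul_assoc, hc, r3]
  · rw [← mul_assoc, hc, mul_assoc, hs, mul_zero]
  · linear_combination (norm := noncomm_ring) t 1 * ha 3 0 - r4 * θ 3 + t 1 * r2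
  · rw [← mul_assoc, hc, mul_assoc, hs, mul_zero]
  · linear_combination (norm := noncomm_ring) hc 3 1 * θ 2 + t 1 * ha 3 2 - r3
  · linear_combination (norm := noncomm_ring) t 1 * ha 2 1 - r4 * θ 2 + t 1 * r1
  · linear_combination (norm := noncomm_ring) t 1 * ha 3 2 - r3
  · linear_combination (norm := noncomm_ring) -r2 * θ 4 + θ 3 * r5 + hc 3 0 * t 1 + t 0 * hc 3 1
  · linear_combination (norm := noncomm_ring) r4 - r3 * θ 4 - θ 2 * hc 4 1 * θ 3 - hc 2 1 * θ 4 * θ 3 - t 1 * θ 2 * ha 4 3 + r3 * θ 4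
  · linear_combination (norm := noncomm_ring) ha 3 4 * θ 3 - θ 4 * hs 3
  · linear_combination (norm := noncomm_ring) hs 2 * θ 4
  · linear_combination (norm := noncomm_ring) -θ 3 * ha 2 4
  · linear_combination (norm := noncomm_ring) θ 2 * r5 - ha 2 4 * θ 0 + θ 4 * ha 2 0 - θ 4 * r1 + hc 2 0 * t 1 - t 1 * hc 2 0 + ht1 * θ 2 + t 0 * hc 2 1
  · linear_combination (norm := noncomm_ring) -θ 3 * hc 4 0 - hc 3 0 * θ 4
  · linear_combination (norm := noncomm_ring) r5 + ht1 + ha 2 4 * θ 3 * θ 4 - θ 4 * θ 2 * ha 3 4 + θ 4 * ha 2 4 * θ 3 - hs 4 * θ 2 * θ 3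

theorem formGen_map {B : Type*} [Ring B] [Algebra ℂ B] (f : A →ₐ[ℂ] B) (l : ℂ) (t : A)
    (θ : Fin 4 → A) : (formGen l t θ).map f = formGen l (f t) (f ∘ θ) := by
  apply cochain_ext <;> intro j <;> fin_cases j <;> simp [formGen]

theorem formNeg_map {B : Type*} [Ring B] [Algebra ℂ B] (f : A →ₐ[ℂ] B) (t : Fin 2 → A)
    (θ : Fin 5 → A) : (formNeg t θ).map f = formNeg (f ∘ t) (f ∘ θ) := by
  apply cochain_ext <;> intro j <;> fin_cases j <;> simp [formNeg]

theorem formOne_map {B : Type*} [Ring B] [Algebra ℂ B] (f : A →ₐ[ℂ] B) (t : Fin 3 → A)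
    (θ : Fin 6 → A) : (formOne t θ).map f = formOne (f ∘ t) (f ∘ θ) := by
  apply cochain_ext <;> intro j <;> fin_cases j <;> simp [formOne]

theorem formGen_zero (l : ℂ) : formGen l 0 0 = dt l := by
  apply cochain_ext <;> intro j <;> fin_cases j <;> simp +decide [formGen, dt_apply]

theorem formNeg_zero : formNeg 0 0 = dt (-1) := by
  apply cochain_ext <;> intro j <;> fin_cases j <;> simp +decide [formNeg, dt_apply]

theorem formOne_zero : formOne 0 0 = dt 1 := by
  apply cochain_ext <;> intro j <;> fin_cases j <;> simp +decide [formOne, dt_apply]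

theorem SuperSeries.t_mem {p q : ℕ} (i : Fin p) : (t i : SuperSeries p q) ∈ part 0 := by
  change _ ∈ CliffordAlgebra.evenOdd _ _
  exact SetLike.algebraMap_mem_graded (CliffordAlgebra.evenOdd
    (0 : QuadraticForm (MvPowerSeries (Fin p) ℂ) (Fin q → MvPowerSeries (Fin p) ℂ))) _

theorem SuperSeries.θ_mem {p q : ℕ} (i : Fin q) : (θ i : SuperSeries p q) ∈ part 1 :=
  CliffordAlgebra.ι_mem_evenOdd_one _ _

theorem SuperSeries.mul_mem {p q : ℕ} {i j : ZMod 2} {a b : SuperSeries p q} (ha : a ∈ part i)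
    (hb : b ∈ part j) : a * b ∈ part (i + j) :=
  CliffordAlgebra.evenOdd_mul_le _ i j (Submodule.mul_mem_mul ha hb)

theorem SuperSeries.t_mul_t_mem {p q : ℕ} (i j : Fin p) : (t i * t j : SuperSeries p q) ∈ part 0 := by
  have := mul_mem (q := q) (t_mem i) (t_mem j)
  rwa [add_zero] at this

theorem SuperSeries.t_mul_θ_mem {p q : ℕ} (i : Fin p) (j : Fin q) :
    (t i * θ j : SuperSeries p q) ∈ part 1 := by
  have := mul_mem (q := q) (t_mem i) (θ_mem j)
  rwa [zero_add] at this

theorem SuperSeries.θ_mul_θ_mem {p q : ℕ} (i j : Fin q) : (θ i * θ j : SuperSeries p q) ∈ part 0 := by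
  have := mul_mem (p := p) (θ_mem i) (θ_mem j)
  rwa [show (1 + 1 : ZMod 2) = 0 from rfl] at this

theorem relGen_hom : ∀ r ∈ relGen, r ∈ part 0 ∨ r ∈ part 1 := by
  simp only [relGen, Set.forall_mem_insert, Set.mem_singleton_iff, forall_eq]
  exact ⟨Or.inl (θ_mul_θ_mem _ _), Or.inl (θ_mul_θ_mem _ _)⟩

theorem relNeg_hom : ∀ r ∈ relNeg, r ∈ part 0 ∨ r ∈ part 1 := by
  have h := mul_mem (t_mul_θ_mem (p := 2) (q := 5) 1 2) (θ_mem 3)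
  rw [show (1 + 1 : ZMod 2) = 0 from rfl] at h
  simp only [relNeg, Set.forall_mem_insert, Set.mem_singleton_iff, forall_eq]
  exact ⟨Or.inl (θ_mul_θ_mem _ _), Or.inl (θ_mul_θ_mem _ _), Or.inl h,
    Or.inr (Submodule.add_mem _ (t_mul_θ_mem _ _) (t_mul_θ_mem _ _)),
    Or.inl (Submodule.sub_mem _ (Submodule.add_mem _ (θ_mul_θ_mem _ _) (θ_mul_θ_mem _ _))
      (t_mul_t_mem _ _))⟩

theorem relOne_hom : ∀ r ∈ relOne, r ∈ part 0 ∨ r ∈ part 1 := by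
  have h : ∀ (i j : Fin 3) (a b c : Fin 6),
      (2 * t i * θ a + t j * (θ b - θ c) : SuperSeries 3 6) ∈ part 1 := fun i j a b c => by
    rw [mul_assoc, two_mul, mul_sub]
    exact Submodule.add_mem _ (Submodule.add_mem _ (t_mul_θ_mem _ _) (t_mul_θ_mem _ _))
      (Submodule.sub_mem _ (t_mul_θ_mem _ _) (t_mul_θ_mem _ _))
  have h2 : ∀ a b c d : Fin 6, (θ a * θ b - θ c * θ d : SuperSeries 3 6) ∈ part 0 :=
    fun a b c d => Submodule.sub_mem _ (θ_mul_θ_mem _ _) (θ_mul_θ_mem _ _)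
  simp only [relOne, Set.forall_mem_insert, Set.mem_singleton_iff, forall_eq]
  exact ⟨Or.inr (Submodule.sub_mem _ (t_mul_θ_mem _ _) (t_mul_θ_mem _ _)), Or.inr (h _ _ _ _ _),
    Or.inr (h _ _ _ _ _), Or.inl (θ_mul_θ_mem _ _), Or.inl (h2 _ _ _ _), Or.inl (h2 _ _ _ _),
    Or.inl (h2 _ _ _ _), Or.inl (h2 _ _ _ _)⟩

theorem isFormalBase_relGen : (base relGen relGen_aug).IsFormalBase :=
  isFormalBase_base _ _ relGen_hom

theorem isFormalBase_relNeg : (base relNeg relNeg_aug).IsFormalBase :=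
  isFormalBase_base _ _ relNeg_hom

theorem isFormalBase_relOne : (base relOne relOne_aug).IsFormalBase :=
  isFormalBase_base _ _ relOne_hom

theorem isDeformation_defGen (l : ℂ) :
    IsDeformation (base relGen relGen_aug) (dt l) (defGen l) := by
  rw [defGen_eq]
  refine ⟨isCodifferential_formGen isFormalBase_relGen.toIsLocalBase l ⟨_, t_mem 0, rfl⟩
    (fun i => ⟨_, θ_mem i, rfl⟩) ?_ ?_, ?_⟩
  · rw [← map_mul]
    exact proj_eq_zero (by simp [relGen])
  · rw [← map_mul]
    exact proj_eq_zero (by simp [relGen])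
  · rw [formGen_map, ← formGen_zero]
    exact congrArg₂ (formGen l) (aug_t 0) (funext aug_θ)

theorem isDeformation_defNeg : IsDeformation (base relNeg relNeg_aug) (dt (-1)) defNeg := by
  rw [defNeg_eq]
  refine ⟨isCodifferential_formNeg isFormalBase_relNeg.toIsLocalBase (fun i => ⟨_, t_mem i, rfl⟩)
    (fun i => ⟨_, θ_mem i, rfl⟩) ?_ ?_ ?_ ?_ ?_, ?_⟩
  iterate 5
    · simp only [← map_mul, ← map_add, ← map_sub]
      exact proj_eq_zero (by simp [relNeg])
  · rw [formNeg_map, ← formNeg_zero]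
    exact congrArg₂ formNeg (funext aug_t) (funext aug_θ)

theorem isDeformation_defOne : IsDeformation (base relOne relOne_aug) (dt 1) defOne := by
  rw [defOne_eq]
  have h2 : (2 : RelQuot relOne) = proj relOne 2 := (map_ofNat (proj relOne) 2).symm
  refine ⟨isCodifferential_formOne isFormalBase_relOne.toIsLocalBase (fun i => ⟨_, t_mem i, rfl⟩)
    (fun i => ⟨_, θ_mem i, rfl⟩) ?_ ?_ ?_ ?_ ?_ ?_ ?_ ?_, ?_⟩
  iterate 8
    · simp only [h2, ← map_mul, ← map_add, ← map_sub]
      exact proj_eq_zero (by simp [relOne])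
  · rw [formOne_map, ← formOne_zero]
    exact congrArg₂ formOne (funext aug_t) (funext aug_θ)

end LInfinity

end

noncomputable section

namespace LInfinity

open SuperSeries

/-! ### Solving the Maurer–Cartan equation in the slice -/

section NormalForm

variable {A : Type u} [Ring A] [Algebra ℂ A] {𝔸 : SuperAug A} {ψ : Cochain A}

theorem IsDeformation.aug_apply {d : Cochain ℂ} (h : IsDeformation 𝔸 d ψ) (j : Fin 3) (I : Mono) :
    𝔸.aug (ψ j I) = d j I := congrFun₂ h.reduces j I

theorem eq_of_sq_eq_zero (h : coder 1 ψ * coder 1 ψ = 0) {K I : Mono} {a : A}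
    (ha : (coder 1 ψ * coder 1 ψ) K I = a) : a = 0 := by
  rw [← ha, h]
  rfl

/-- The components are used by decreasing degree. The cubic ones kill the remaining quadratic
entries with third output or on f₁f₂, one of them because 1 + `ψ 1 I011` has augmentation 1 + λ ≠ 0.
The quadratic ones then kill the linear entries that are not parameters, the off-diagonal ones
because λ ≠ 1. The column 001 remains as the relations. -/
theorem normalForm_gen (hl : 𝔸.IsLocalBase) {l : ℂ} (h1 : l ≠ 1) (h2 : l ≠ -1)
    (hψ : IsDeformation 𝔸 (dt l) ψ) (z101_0 : ψ 0 I101 = 1) (z011_0 : ψ 0 I011 = 0)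
    (z101_1 : ψ 1 I101 = 0) (z110_0 : ψ 0 I110 = 0) (z101_2 : ψ 2 I101 = 0)
    (z111_0 : ψ 0 I111 = 0) (z111_1 : ψ 1 I111 = 0) (z111_2 : ψ 2 I111 = 0) :
    ψ = formGen l (ψ 1 I011 - algebraMap ℂ A l) ![ψ 0 I100, ψ 1 I010, ψ 0 I001, ψ 1 I001] ∧
      ψ 0 I100 * ψ 0 I001 = 0 ∧ ψ 1 I010 * ψ 1 I001 = 0 := by
  have hs := hψ.sq_eq_zero
  have hc : ∀ a, ψ 1 I011 * a = a * ψ 1 I011 := fun a => hl.comm_of_even (hψ.odd 1 I011)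
  have ha : 𝔸.aug (ψ 1 I011) = l := by rw [hψ.aug_apply, dt_apply]; simp +decide
  have z011_2 : ψ 2 I011 = 0 := by
    simpa [z101_0, z011_0, z110_0, z111_0, z111_1, z111_2] using eq_of_sq_eq_zero hs (sq_111_0 ψ)
  have z110_1 : ψ 1 I110 = 0 := by
    simpa [z101_0, z101_1, z101_2, z011_0, z110_0, z111_0, z111_1, z111_2, hc] using
      eq_of_sq_eq_zero hs (sq_111_1 ψ)
  have z110_2 : ψ 2 I110 = 0 := by
    have := eq_of_sq_eq_zero hs (sq_111_2 ψ)
    refine hl.eq_zero_of_mul (a := 1 + ψ 1 I011) ?_ ?_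
    · rw [map_add, map_one, ha]
      contrapose! h2
      linear_combination h2
    · simp [z101_0, z101_2, z110_0, z110_1, z111_0, z111_1, z111_2] at this
      linear_combination (norm := noncomm_ring) -this + hc (ψ 2 I110)
  have z010_2 : ψ 2 I010 = 0 := by
    simpa [z101_0, z011_0, z110_0, z110_1, z110_2] using eq_of_sq_eq_zero hs (sq_110_0 ψ)
  have z100_2 : ψ 2 I100 = 0 := by
    simpa [z101_0, z101_1, z101_2, z110_2, z011_2] using eq_of_sq_eq_zero hs (sq_101_2 ψ)
  have z001_2 : ψ 2 I001 = 0 := by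
    simpa [z101_0, z101_1, z101_2, z110_0, z011_0] using eq_of_sq_eq_zero hs (sq_101_0 ψ)
  have hu : 𝔸.aug (ψ 1 I011 - 1) ≠ 0 := by
    rw [map_sub, map_one, ha]
    exact sub_ne_zero.2 h1
  have z100_1 : ψ 1 I100 = 0 := by
    have := eq_of_sq_eq_zero hs (sq_101_1 ψ)
    refine hl.eq_zero_of_mul hu ?_
    simp [z101_0, z101_1, z101_2, z110_1] at this
    linear_combination (norm := noncomm_ring) this
  have z010_0 : ψ 0 I010 = 0 := by
    have := eq_of_sq_eq_zero hs (sq_011_0 ψ)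
    refine hl.eq_zero_of_mul hu ?_
    simp [z101_0, z011_0, z011_2, z110_0] at this
    linear_combination (norm := noncomm_ring) -this + hc (ψ 0 I010)
  refine ⟨?_, ?_, ?_⟩
  · apply cochain_ext <;> intro j <;> fin_cases j <;>
      simp [formGen, *]
  · simpa [z010_0, z001_2] using eq_of_sq_eq_zero hs (sq_001_0 ψ)
  · simpa [z100_1, z001_2] using eq_of_sq_eq_zero hs (sq_001_1 ψ)

/-- Since 1 + λ = 0, the entries `ψ 2 I110` and `ψ 2 I111` survive as parameters. The entries that
vanished in the generic case are now solved for as products of parameters, which accounts for the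
second order terms. -/
theorem normalForm_neg (hl : 𝔸.IsLocalBase)
    (hψ : IsDeformation 𝔸 (dt (-1)) ψ) (z101_0 : ψ 0 I101 = 1) (z011_0 : ψ 0 I011 = 0)
    (z101_1 : ψ 1 I101 = 0) (z110_0 : ψ 0 I110 = 0) (z101_2 : ψ 2 I101 = 0)
    (z111_0 : ψ 0 I111 = 0) (z111_1 : ψ 1 I111 = 0) :
    ψ = formNeg ![ψ 1 I011 + 1, ψ 2 I110]
        ![ψ 0 I100, ψ 1 I010, ψ 0 I001, ψ 1 I001, ψ 2 I111] ∧
      ψ 0 I100 * ψ 0 I001 = 0 ∧ ψ 1 I010 * ψ 1 I001 = 0 ∧ ψ 2 I110 * ψ 0 I001 * ψ 1 I001 = 0 ∧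
      ψ 2 I110 * ψ 0 I100 + ψ 2 I110 * ψ 1 I010 = 0 ∧
      ψ 2 I111 * ψ 0 I100 + ψ 2 I111 * ψ 1 I010 - (ψ 1 I011 + 1) * ψ 2 I110 = 0 := by
  have hs := hψ.sq_eq_zero
  have hc : ∀ a, ψ 1 I011 * a = a * ψ 1 I011 := fun a => hl.comm_of_even (hψ.odd 1 I011)
  have hc2 : ∀ a, ψ 2 I110 * a = a * ψ 2 I110 := fun a => hl.comm_of_even (hψ.odd 2 I110)
  have ha : 𝔸.aug (ψ 1 I011) = -1 := by rw [hψ.aug_apply, dt_apply]; simp +decide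
  have s001_0 : ψ 0 I001 * ψ 0 I001 = 0 := hl.sq_odd (hψ.odd 0 I001)
  have s001_1 : ψ 1 I001 * ψ 1 I001 = 0 := hl.sq_odd (hψ.odd 1 I001)
  have s111_2 : ψ 2 I111 * ψ 2 I111 = 0 := hl.sq_odd (hψ.odd 2 I111)
  have a1 := hl.anticomm (hψ.odd 1 I001) (hψ.odd 2 I111)
  have s100_0 : ψ 0 I100 * ψ 0 I100 = 0 := hl.sq_odd (hψ.odd 0 I100)
  have z011_2 : ψ 2 I011 = ψ 0 I001 * ψ 2 I111 := by
    have := eq_of_sq_eq_zero hs (sq_111_0 ψ)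
    simp [z101_0, z011_0, z110_0, z111_0, z111_1] at this
    linear_combination (norm := noncomm_ring) -this
  have z110_1 : ψ 1 I110 = ψ 1 I001 * ψ 2 I111 := by
    have := eq_of_sq_eq_zero hs (sq_111_1 ψ)
    simp [z101_0, z101_1, z101_2, z011_0, z110_0, z111_0, z111_1, hc] at this
    linear_combination (norm := noncomm_ring) -this
  have z001_2 : ψ 2 I001 = 0 := by
    simpa [z101_0, z101_1, z101_2, z110_0, z011_0] using eq_of_sq_eq_zero hs (sq_101_0 ψ)
  have hu : 𝔸.aug (ψ 1 I011 - 1) ≠ 0 := by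
    rw [map_sub, map_one, ha]
    norm_num
  have z100_1 : ψ 1 I100 = 0 := by
    have := eq_of_sq_eq_zero hs (sq_101_1 ψ)
    refine hl.eq_zero_of_mul hu ?_
    simp [z101_0, z101_1, z101_2, z110_1] at this
    linear_combination (norm := noncomm_ring) this - a1 * ψ 1 I001 + ψ 2 I111 * s001_1
  have z010_0 : ψ 0 I010 = 0 := by
    have := eq_of_sq_eq_zero hs (sq_011_0 ψ)
    refine hl.eq_zero_of_mul hu ?_
    simp [z101_0, z011_0, z011_2, z110_0] at this
    linear_combination (norm := noncomm_ring) -this + hc (ψ 0 I010) - s001_0 * ψ 2 I111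
  have z010_2 : ψ 2 I010 = ψ 2 I110 * ψ 0 I001 := by
    have := eq_of_sq_eq_zero hs (sq_110_0 ψ)
    simp [z101_0, z011_0, z110_0, z010_0] at this
    linear_combination (norm := noncomm_ring) this - hc2 (ψ 0 I001)
  have z100_2 : ψ 2 I100 = ψ 2 I110 * ψ 1 I001 := by
    have := eq_of_sq_eq_zero hs (sq_101_2 ψ)
    simp [z101_0, z101_1, z101_2, z100_1] at this
    linear_combination (norm := noncomm_ring) -this
  have r3 : ψ 2 I110 * ψ 0 I001 * ψ 1 I001 = 0 := by
    have := eq_of_sq_eq_zero hs (sq_100_0 ψ)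
    simp [z100_1, z100_2, s100_0] at this
    linear_combination (norm := noncomm_ring) this + hc2 (ψ 0 I001) * ψ 1 I001
  refine ⟨?_, ?_, ?_, r3, ?_, ?_⟩
  · apply cochain_ext <;> intro j <;> fin_cases j <;>
      simp [formNeg, z101_0, z011_0, z101_1, z110_0, z101_2, z111_0, z111_1, z011_2, z110_1, z001_2,
        z100_1, z010_0, z010_2, z100_2]
  · simpa [z010_0, z001_2] using eq_of_sq_eq_zero hs (sq_001_0 ψ)
  · simpa [z100_1, z001_2] using eq_of_sq_eq_zero hs (sq_001_1 ψ)
  · have := eq_of_sq_eq_zero hs (sq_110_2 ψ)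
    simp [z110_0, z110_1, z001_2, z101_2, z010_2, z011_2, z100_2] at this
    linear_combination (norm := noncomm_ring) this -
      ψ 0 I001 * hc2 (ψ 2 I111) * ψ 1 I001 - hc2 (ψ 0 I001) * ψ 2 I111 * ψ 1 I001 +
      ψ 2 I110 * ψ 0 I001 * a1
  · have := eq_of_sq_eq_zero hs (sq_111_2 ψ)
    simp [z110_0, z110_1, z001_2, z101_0, z101_2, z011_2, z111_0, z111_1] at this
    linear_combination (norm := noncomm_ring) this - hc (ψ 2 I110) - ψ 0 I001 * ψ 2 I111 * a1
      + ψ 0 I001 * s111_2 * ψ 1 I001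

theorem normalForm_one (hl : 𝔸.IsLocalBase)
    (hψ : IsDeformation 𝔸 (dt 1) ψ) (zt : ψ 1 I011 = 2 - ψ 0 I101) (z110_0 : ψ 0 I110 = 0)
    (z101_2 : ψ 2 I101 = 0) (z111_0 : ψ 0 I111 = 0) (z111_1 : ψ 1 I111 = 0)
    (z111_2 : ψ 2 I111 = 0) {t : Fin 3 → A} {θ : Fin 6 → A}
    (ht : t = ![ψ 0 I101 - 1, ψ 1 I101, ψ 0 I011])
    (hθ : θ = ![ψ 0 I100, ψ 1 I010, ψ 0 I001, ψ 1 I001, ψ 1 I100, ψ 0 I010]) :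
    ψ = formOne t θ ∧ t 2 * θ 4 - t 1 * θ 5 = 0 ∧ 2 * t 0 * θ 4 + t 1 * (θ 1 - θ 0) = 0 ∧
      2 * t 0 * θ 5 + t 2 * (θ 1 - θ 0) = 0 ∧ θ 4 * θ 5 = 0 ∧
      θ 0 * θ 2 - θ 3 * θ 5 = 0 ∧ θ 1 * θ 3 - θ 2 * θ 4 = 0 ∧
      θ 1 * θ 4 - θ 0 * θ 4 = 0 ∧ θ 0 * θ 5 - θ 1 * θ 5 = 0 := by
  have hs := hψ.sq_eq_zero
  have c0 : ∀ a, ψ 0 I101 * a = a * ψ 0 I101 := fun a => hl.comm_of_even (hψ.odd 0 I101)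
  have c1 : ∀ a, ψ 1 I101 * a = a * ψ 1 I101 := fun a => hl.comm_of_even (hψ.odd 1 I101)
  have c2 : ∀ a, ψ 0 I011 * a = a * ψ 0 I011 := fun a => hl.comm_of_even (hψ.odd 0 I011)
  have a0 : 𝔸.aug (ψ 0 I101) = 1 := by rw [hψ.aug_apply, dt_apply]; simp +decide
  have a1 : 𝔸.aug (ψ 1 I101) = 0 := by rw [hψ.aug_apply, dt_apply]; simp +decide
  have a2 : 𝔸.aug (ψ 2 I011) = 0 := by rw [hψ.aug_apply, dt_apply]; simp +decide
  have a3 : 𝔸.aug (ψ 1 I011) = 1 := by rw [hψ.aug_apply, dt_apply]; simp +decide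
  have e1 := eq_of_sq_eq_zero hs (sq_111_0 ψ)
  have e2 := eq_of_sq_eq_zero hs (sq_111_1 ψ)
  have e3 := eq_of_sq_eq_zero hs (sq_111_2 ψ)
  simp [z110_0, z101_2, z111_0, z111_1, z111_2] at e1 e2 e3
  -- `e1` and `e2` form a linear system for `ψ 2 I011` and `ψ 1 I110`. It is solved by Cramer's
  -- rule, the determinant having augmentation ±1; `ψ 2 I010` and `ψ 2 I100` are treated in the same
  -- way below.
  have z110_1 : ψ 1 I110 = 0 := by
    refine hl.eq_zero_of_mul (a := ψ 0 I101 * ψ 0 I101 + ψ 1 I101 * ψ 0 I011) ?_ ?_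
    · simp [a0, a1]
    · rw [zt] at e2
      linear_combination (norm := noncomm_ring) ψ 1 I101 * e1 - ψ 0 I101 * e2
        + c1 (ψ 0 I101) * ψ 2 I011 - c0 (ψ 1 I110) * ψ 0 I101
        + c0 (ψ 1 I110 * ψ 0 I101)
  have z011_2 : ψ 2 I011 = 0 := by
    refine hl.eq_zero_of_mul (a := ψ 0 I101) (by simp [a0]) ?_
    simp [z110_1] at e1
    exact e1
  have z110_2 : ψ 2 I110 = 0 := by
    simp [z110_1, zt] at e3
    have e : (2 : ℂ) • ψ 2 I110 = 0 := by
      rw [two_smul]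
      linear_combination (norm := noncomm_ring) -e3
    exact (smul_eq_zero_iff_right two_ne_zero).1 e
  have e4 := eq_of_sq_eq_zero hs (sq_110_0 ψ)
  have e5 := eq_of_sq_eq_zero hs (sq_110_1 ψ)
  simp [z110_0, z110_1, z110_2] at e4 e5
  have z010_2 : ψ 2 I010 = 0 := by
    refine hl.eq_zero_of_mul (a := ψ 1 I011 * ψ 0 I101 - ψ 0 I011 * ψ 1 I101) ?_ ?_
    · simp [a0, a1, a3]
    · linear_combination (norm := noncomm_ring) ψ 1 I011 * e4 - ψ 0 I011 * e5
        - c2 (ψ 1 I011) * ψ 2 I100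
  have z100_2 : ψ 2 I100 = 0 := by
    refine hl.eq_zero_of_mul (a := ψ 1 I011) (by simp [a3]) ?_
    simp [z010_2] at e5
    exact e5
  have e6 := eq_of_sq_eq_zero hs (sq_101_0 ψ)
  have e7 := eq_of_sq_eq_zero hs (sq_011_1 ψ)
  simp [z110_0, z101_2, z110_1, z011_2, zt] at e6 e7
  -- The sum of the two diagonal components is a trace: the commutators cancel, and `ψ 2 I001` is
  -- left with the coefficient `ψ 0 I101` + `ψ 1 I011`, which `zt` normalises to 2.
  have z001_2 : ψ 2 I001 = 0 := by
    have e : (2 : ℂ) • ψ 2 I001 = 0 := by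
      rw [two_smul]
      linear_combination (norm := noncomm_ring) e6 + e7 - c0 (ψ 0 I100) - c0 (ψ 1 I010)
        - c1 (ψ 0 I010) - c2 (ψ 1 I100) + 2 * c0 (ψ 1 I010)
    exact (smul_eq_zero_iff_right two_ne_zero).1 e
  subst ht hθ
  simp [z001_2] at e6
  have e8 := eq_of_sq_eq_zero hs (sq_101_1 ψ)
  have e9 := eq_of_sq_eq_zero hs (sq_011_0 ψ)
  have f1 := eq_of_sq_eq_zero hs (sq_100_0 ψ)
  have f2 := eq_of_sq_eq_zero hs (sq_100_1 ψ)
  have f3 := eq_of_sq_eq_zero hs (sq_010_0 ψ)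
  have f4 := eq_of_sq_eq_zero hs (sq_001_0 ψ)
  have f5 := eq_of_sq_eq_zero hs (sq_001_1 ψ)
  simp [z101_2, z110_1, z001_2, zt, z011_2, z110_0, z100_2, z010_2, hl.sq_odd (hψ.odd 0 I100)]
    at e8 e9 f1 f2 f3 f4 f5
  have aa := fun j k => hl.anticomm (hψ.odd j I010) (hψ.odd k I100)
  have ab := fun j k => hl.anticomm (hψ.odd j I001) (hψ.odd k I100)
  have ac := fun j k => hl.anticomm (hψ.odd j I010) (hψ.odd k I001)
  have ad := hl.anticomm (hψ.odd 1 I100) (hψ.odd 0 I100)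
  have ae := hl.anticomm (hψ.odd 0 I010) (hψ.odd 1 I010)
  refine ⟨?_, ?_, ?_, ?_, ?_, ?_, ?_, ?_, ?_⟩
  · apply cochain_ext <;> intro j <;> fin_cases j <;>
      simp [formOne, z110_0, z101_2, z111_0, z111_1, z111_2, z110_1, z110_2, z011_2, z001_2,
        z010_2, z100_2, zt]
    rw [← one_add_one_eq_two]
    abel
  all_goals simp
  · linear_combination (norm := noncomm_ring) e6 - c1 (ψ 0 I010) - c0 (ψ 0 I100)
  · linear_combination (norm := noncomm_ring) -e8 + c0 (ψ 1 I100) + c1 (ψ 1 I010)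
  · linear_combination (norm := noncomm_ring) e9 + c0 (ψ 0 I010) - c2 (ψ 0 I100)
  · linear_combination (norm := noncomm_ring) aa 0 1 - f1
  · linear_combination (norm := noncomm_ring) f4 - ac 0 1
  · linear_combination (norm := noncomm_ring) f5 - ab 0 1
  · linear_combination (norm := noncomm_ring) f2 - ad
  · linear_combination (norm := noncomm_ring) f3 - ae

end NormalForm

/-! ### Existence of the classifying morphism -/

section Existence

variable {B : Type v} [Ring B] [Algebra ℂ B] {𝔹 : SuperAug B} {ψ : Cochain B}

theorem exists_hom_gen {l : ℂ} (h1 : l ≠ 1) (h2 : l ≠ -1) (hf : 𝔹.IsFormalBase)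
    (hψ : IsDeformation 𝔹 (dt l) ψ) : ∃ f : RelQuot relGen →ₐ[ℂ] B,
      IsBaseHom (base relGen relGen_aug) 𝔹 f ∧ DefEquivalent 𝔹 ((defGen l).map f) ψ := by
  have hl := hf.toIsLocalBase
  have h1' : (1 - l)⁻¹ ≠ 0 := inv_ne_zero (sub_ne_zero.2 h1.symm)
  have h2' : (1 + l)⁻¹ ≠ 0 := inv_ne_zero (by contrapose! h2; linear_combination h2)
  -- The choice a = 1, b = 0 normalises the coefficient of φ^{101}_1 to 1, so the deformation of the
  -- diagonal part is a shift of λ.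
  obtain ⟨φ, hφ, he, q1, q2, q3, q4, q5, q6, q7, q8⟩ := exists_slice l hf (a := 1) (b := 0)
    (c := (1 - l)⁻¹) (e := (1 + l)⁻¹) (by ring)
    (by rw [inv_mul_cancel₀ (sub_ne_zero.2 h1.symm), one_mul])
    (by rw [inv_mul_cancel₀ (by simpa using h2'), one_mul]) hψ
  rw [one_smul, zero_smul, add_zero, sub_eq_zero] at q1
  rw [smul_eq_zero_iff_right h1'] at q2 q3
  rw [smul_eq_zero_iff_right h2'] at q8
  obtain ⟨e, r1, r2⟩ := normalForm_gen hl h1 h2 hφ q1 q2 q3 q4 q5 q6 q7 q8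
  have ha := hφ.aug_apply
  have ho := hφ.odd
  obtain ⟨f, hf1, hf2, hf3⟩ := exists_baseHom hf relGen relGen_aug
    (fun _ => φ 1 I011 - algebraMap ℂ B l) ![φ 0 I100, φ 1 I010, φ 0 I001, φ 1 I001]
    (fun _ => Submodule.sub_mem _ (ho 1 I011) (hl.algebraMap_mem l))
    (fun _ => by simp +decide [ha, dt_apply])
    (fun i => by fin_cases i; exacts [ho 0 I100, ho 1 I010, ho 0 I001, ho 1 I001])
    (fun F hF1 hF2 => by simp [relGen, hF2, r1, r2])
  refine ⟨f, hf1, ?_⟩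
  have e' : (defGen l).map f = φ := by
    rw [defGen_eq, formGen_map, hf2]
    refine Eq.trans ?_ e.symm
    congr 1
    exact funext hf3
  rwa [e']

theorem exists_hom_neg (hf : 𝔹.IsFormalBase)
    (hψ : IsDeformation 𝔹 (dt (-1)) ψ) : ∃ f : RelQuot relNeg →ₐ[ℂ] B,
      IsBaseHom (base relNeg relNeg_aug) 𝔹 f ∧ DefEquivalent 𝔹 (defNeg.map f) ψ := by
  have hl := hf.toIsLocalBase
  -- Here c = 1/2 inverts 1 - λ = 2, while e = 0 because 1 + λ = 0; no condition is imposed on `φ 2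
  -- I111`.
  obtain ⟨φ, hφ, he, q1, q2, q3, q4, q5, q6, q7, q8⟩ := exists_slice (-1) hf (a := 1) (b := 0)
    (c := 1 / 2) (e := 0) (by ring) (by ring) (by ring) hψ
  rw [one_smul, zero_smul, add_zero, sub_eq_zero] at q1
  rw [smul_eq_zero_iff_right (by norm_num)] at q2 q3
  obtain ⟨e, r1, r2, r3, r4, r5⟩ := normalForm_neg hl hφ q1 q2 q3 q4 q5 q6 q7
  have ha := hφ.aug_apply
  have ho := hφ.odd
  obtain ⟨f, hf1, hf2, hf3⟩ := exists_baseHom hf relNeg relNeg_aug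
    ![φ 1 I011 + 1, φ 2 I110] ![φ 0 I100, φ 1 I010, φ 0 I001, φ 1 I001, φ 2 I111]
    (fun i => by fin_cases i; exacts [Submodule.add_mem _ (ho 1 I011) hl.one_mem, ho 2 I110])
    (fun i => by fin_cases i <;> simp +decide [ha, dt_apply])
    (fun i => by
      fin_cases i
      exacts [ho 0 I100, ho 1 I010, ho 0 I001, ho 1 I001, ho 2 I111])
    (fun F hF1 hF2 => by simp [relNeg, hF1, hF2, r1, r2, r3, r4, r5])
  refine ⟨f, hf1, ?_⟩
  have e' : defNeg.map f = φ := by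
    rw [defNeg_eq, formNeg_map]
    refine Eq.trans ?_ e.symm
    exact congrArg₂ formNeg (funext hf2) (funext hf3)
  rwa [e']

theorem exists_hom_one (hf : 𝔹.IsFormalBase)
    (hψ : IsDeformation 𝔹 (dt 1) ψ) : ∃ f : RelQuot relOne →ₐ[ℂ] B,
      IsBaseHom (base relOne relOne_aug) 𝔹 f ∧ DefEquivalent 𝔹 (defOne.map f) ψ := by
  have hl := hf.toIsLocalBase
  -- At λ = 1 the gauge direction shifts both diagonal coefficients equally. With a = b = 1/2 their
  -- sum is normalised to 2 and their difference stays as the parameter t 0. As 1 - λ = 0, c = 0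
  -- leaves the off-diagonal coefficients free.
  obtain ⟨φ, hφ, he, q1, q2, q3, q4, q5, q6, q7, q8⟩ := exists_slice 1 hf (a := 1 / 2) (b := 1 / 2)
    (c := 0) (e := 1 / 2) (by ring) (by ring) (by ring) hψ
  rw [← smul_add, smul_eq_zero_iff_right (by norm_num), map_one] at q1
  rw [smul_eq_zero_iff_right (by norm_num)] at q8
  have zt : φ 1 I011 = 2 - φ 0 I101 := by
    have h11 : (2 : B) = 1 + 1 := one_add_one_eq_two.symm
    rw [h11]
    linear_combination (norm := abel) q1
  obtain ⟨e, r1, r2, r3, r4, r5, r6, r7, r8⟩ := normalForm_one hl hφ zt q4 q5 q6 q7 q8 rfl rfl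
  have ha := hφ.aug_apply
  have ho := hφ.odd
  obtain ⟨f, hf1, hf2, hf3⟩ := exists_baseHom hf relOne relOne_aug
    ![φ 0 I101 - 1, φ 1 I101, φ 0 I011]
    ![φ 0 I100, φ 1 I010, φ 0 I001, φ 1 I001, φ 1 I100, φ 0 I010]
    (fun i => by
      fin_cases i
      exacts [Submodule.sub_mem _ (ho 0 I101) hl.one_mem, ho 1 I101, ho 0 I011])
    (fun i => by fin_cases i <;> simp +decide [ha, dt_apply])
    (fun i => by
      fin_cases i
      exacts [ho 0 I100, ho 1 I010, ho 0 I001, ho 1 I001, ho 1 I100, ho 0 I010])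
    (fun F hF1 hF2 => by
      simp only [relOne, Set.forall_mem_insert, Set.mem_singleton_iff, forall_eq, map_add, map_sub,
        map_mul, hF1, hF2, map_ofNat]
      exact ⟨r1, r2, r3, r4, r5, r6, r7, r8⟩)
  refine ⟨f, hf1, ?_⟩
  have e' : defOne.map f = φ := by
    rw [defOne_eq, formOne_map]
    refine Eq.trans ?_ e.symm
    exact congrArg₂ formOne (funext hf2) (funext hf3)
  rwa [e']

end Existence

end LInfinity

end

noncomputable section

namespace LInfinity

open SuperAug SuperSeries

/-! ### Uniqueness over infinitesimal bases, and miniversality -/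

section Uniqueness

variable {B : Type v} [Ring B] [Algebra ℂ B] {𝔹 : SuperAug B}

theorem SuperAug.IsInfinitesimalBase.mul_eq_zero (h : 𝔹.IsInfinitesimalBase) {a b : B}
    (ha : 𝔹.aug a = 0) (hb : 𝔹.aug b = 0) : a * b = 0 := by
  have := Submodule.mul_mem_mul (mem_maxIdeal.2 ha) (mem_maxIdeal.2 hb)
  rwa [← pow_two, h.sq_eq_bot] at this

theorem SuperAug.EqMod.mul_eq_zero (h : 𝔹.IsInfinitesimalBase) {ι κ μ : Type*} [Fintype κ]
    {M : Matrix ι κ B} {N : Matrix κ μ B} (hM : EqMod 𝔹 0 M 0) (hN : EqMod 𝔹 0 N 0) :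
    M * N = 0 := by
  ext i j
  have := hM.mul_zero hN i j
  rw [zero_add, zero_add, one_add_one_eq_two, h.sq_eq_bot, Submodule.mem_bot, sub_eq_zero] at this
  exact this

/-- Over an infinitesimal base, equivalent deformations differ by an infinitesimal action. -/
theorem DefEquivalent.exists_infin (h : 𝔹.IsInfinitesimalBase) {d : Cochain ℂ} {φ ψ : Cochain B}
    (hψ : IsDeformation 𝔹 d ψ) (he : DefEquivalent 𝔹 φ ψ) :
    ∃ X : Cochain B, ψ - φ = infin B d X := by
  obtain ⟨g, hg, hg1, e⟩ := he
  obtain ⟨N, hN⟩ : ∃ N, g = 1 + N := ⟨g - 1, by abel⟩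
  have hN0 : EqMod 𝔹 0 N 0 := fun K I => by
    have h1 : N K I = g K I - (1 : Matrix Mono Mono B) K I := by simp [hN]
    have h2 : 𝔹.aug (g K I) = (1 : Matrix Mono Mono ℂ) K I := congrFun₂ hg1 K I
    rw [zero_add, pow_one, mem_maxIdeal, Matrix.zero_apply, sub_zero, h1, map_sub, h2,
      Matrix.one_apply, Matrix.one_apply]
    split_ifs <;> simp
  -- The entries of N lie in 𝔪 and 𝔪² = 0. The condition that 1 + N be a coalgebra map thus becomes
  -- linear and says that N is a coderivation.
  have hNN : tens 0 0 N N = 0 := by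
    ext x y
    have := h.mul_eq_zero (mem_maxIdeal.1 (by simpa using hN0 x.1 y.1))
      (mem_maxIdeal.1 (by simpa using hN0 x.2 y.2))
    simp [tens, this]
  have hNc : IsCoder 0 N := by
    have := hg.isEnd.comul
    rw [hN, Matrix.mul_add, Matrix.mul_one, tens_add_left, tens_add_right, tens_add_right,
      tens_one_one, hNN, add_zero, add_assoc, Matrix.add_mul 1, Matrix.one_mul,
      add_right_inj] at this
    rw [IsCoder, this, add_comm]
  obtain ⟨X, hX⟩ : ∃ X, N = coder 0 X := ⟨_, hNc.eq_coder⟩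
  have e1 : coder 1 φ - coder 1 ψ = N * coder 1 ψ - coder 1 φ * N := by
    rw [hN] at e
    linear_combination (norm := noncomm_ring) e
  have e2 : EqMod 𝔹 0 (coder 1 φ) (coder 1 ψ) := by
    have := (hN0.mul (EqMod.refl (coder 1 ψ))).sub ((EqMod.refl (coder 1 φ)).mul hN0)
    rw [← e1, zero_mul, mul_zero, sub_zero, EqMod.sub_zero_iff] at this
    exact this
  have hd := (eqMod_ext hψ).coder 1
  -- Products of N with ψ - d or φ - d vanish, so the intertwining relation reads ψ - φ = dN - Nd.
  have e3 : N * (coder 1 ψ - coder 1 (ext B d)) = 0 :=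
    EqMod.mul_eq_zero h hN0 (EqMod.sub_zero_iff.2 hd)
  have e4 : (coder 1 φ - coder 1 (ext B d)) * N = 0 :=
    EqMod.mul_eq_zero h (EqMod.sub_zero_iff.2 (e2.trans hd)) hN0
  refine ⟨X, ?_⟩
  rw [infin, ← hX, ← corestr_coder 1 φ, ← corestr_coder 1 ψ, ← corestr_sub]
  congr 1
  linear_combination (norm := noncomm_ring) -e1 - e3 + e4

variable {p q : ℕ}

/-- Both maps agree on constants and respect augmentations. A difference of their values therefore
lies in 𝔪 and annihilates 𝔪, so multiples of the variables are mapped equally once the variables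
are; no continuity is needed. -/
theorem baseHom_ext (h : 𝔹.IsInfinitesimalBase) {R : Set (SuperSeries p q)}
    {hR : ∀ r ∈ R, aug r = 0} {f f' : RelQuot R →ₐ[ℂ] B} (hf : IsBaseHom (base R hR) 𝔹 f)
    (hf' : IsBaseHom (base R hR) 𝔹 f') (ht : ∀ i, f (proj R (t i)) = f' (proj R (t i)))
    (hθ : ∀ i, f (proj R (θ i)) = f' (proj R (θ i))) : f = f' := by
  have hspan : ∀ r ∈ Ideal.span (Set.range (MvPowerSeries.X : Fin p → MvPowerSeries (Fin p) ℂ)),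
      f (proj R (algebraMap _ _ r)) = f' (proj R (algebraMap _ _ r)) := by
    intro r hr
    induction hr using Submodule.span_induction with
    | mem x hx =>
      obtain ⟨i, rfl⟩ := hx
      exact ht i
    | zero => simp
    | add x y _ _ hx hy => rw [map_add, map_add, map_add, map_add, hx, hy]
    | smul a x hx ih =>
      rw [smul_eq_mul, map_mul, map_mul, map_mul, map_mul, ih, ← sub_eq_zero, ← sub_mul]
      refine h.mul_eq_zero ?_ ?_
      · rw [map_sub, hf.map_aug, hf'.map_aug, sub_self]
      · rw [hf'.map_aug, aug_proj, aug_algebraMap]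
        exact constantCoeff_of_mem_varIdeal hx
  have hser : ∀ r : MvPowerSeries (Fin p) ℂ,
      f (proj R (algebraMap _ _ r)) = f' (proj R (algebraMap _ _ r)) := by
    intro r
    have e : r = (r - algebraMap ℂ _ (MvPowerSeries.constantCoeff r)) +
      algebraMap ℂ _ (MvPowerSeries.constantCoeff r) := by abel
    rw [e, map_add, map_add, map_add, map_add, hspan, ← IsScalarTower.algebraMap_apply,
      AlgHom.commutes, AlgHom.commutes, AlgHom.commutes]
    refine mem_span_X_of_constantCoeff ?_
    rw [map_sub, MvPowerSeries.algebraMap_apply]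
    simp
  refine AlgHom.ext fun x => ?_
  obtain ⟨x, rfl⟩ := proj_surjective R x
  induction x using ExteriorAlgebra.induction with
  | algebraMap r => exact hser r
  | ι m => simp only [SuperSeries.ι_eq, map_sum, map_mul, hser, hθ]
  | mul a b ha hb => rw [map_mul, map_mul, map_mul, ha, hb]
  | add a b ha hb => rw [map_add, map_add, map_add, ha, hb]

variable {ψ : Cochain B}

/-- Linear coefficients are not moved by the gauge action, which gives the θ's. The fixed
coefficient of φ^{101}_1 forces `X 2 I001` = `X' 2 I001`, after which the coefficient of φ^{011}_2
gives t. -/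
theorem unique_hom_gen (l : ℂ) (h : 𝔹.IsInfinitesimalBase) (hψ : IsDeformation 𝔹 (dt l) ψ)
    {f f' : RelQuot relGen →ₐ[ℂ] B} (hf : IsBaseHom (base relGen relGen_aug) 𝔹 f)
    (he : DefEquivalent 𝔹 ((defGen l).map f) ψ)
    (hf' : IsBaseHom (base relGen relGen_aug) 𝔹 f')
    (he' : DefEquivalent 𝔹 ((defGen l).map f') ψ) : f = f' := by
  rw [defGen_eq, formGen_map] at he he'
  obtain ⟨X, hX⟩ := he.exists_infin h hψ
  obtain ⟨X', hX'⟩ := he'.exists_infin h hψ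
  have e := fun j I => (sub_eq_iff_eq_add.1 (congrFun₂ hX j I)).symm.trans
    (sub_eq_iff_eq_add.1 (congrFun₂ hX' j I))
  have e1 := e 0 I101
  have e2 := e 1 I011
  have l1 := fun j => e j I100
  have l2 := fun j => e j I010
  have l3 := fun j => e j I001
  simp only [infin_dt_linear _ _ _ card_I100, infin_dt_linear _ _ _ card_I010,
    infin_dt_linear _ _ _ card_I001, zero_add] at l1 l2 l3
  rw [infin_dt_101_0, infin_dt_101_0] at e1
  rw [infin_dt_011_1, infin_dt_011_1] at e2
  simp [formGen] at e1
  simp [formGen, e1] at e2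
  refine baseHom_ext h hf hf' (fun i => ?_) fun i => ?_
  · obtain rfl : i = 0 := Subsingleton.elim _ _
    exact e2
  · fin_cases i
    · simpa [formGen] using l1 0
    · simpa [formGen] using l2 1
    · simpa [formGen] using l3 0
    · simpa [formGen] using l3 1

theorem unique_hom_neg (h : 𝔹.IsInfinitesimalBase) (hψ : IsDeformation 𝔹 (dt (-1)) ψ)
    {f f' : RelQuot relNeg →ₐ[ℂ] B} (hf : IsBaseHom (base relNeg relNeg_aug) 𝔹 f)
    (he : DefEquivalent 𝔹 (defNeg.map f) ψ)
    (hf' : IsBaseHom (base relNeg relNeg_aug) 𝔹 f')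
    (he' : DefEquivalent 𝔹 (defNeg.map f') ψ) : f = f' := by
  rw [defNeg_eq, formNeg_map] at he he'
  obtain ⟨X, hX⟩ := he.exists_infin h hψ
  obtain ⟨X', hX'⟩ := he'.exists_infin h hψ
  have e := fun j I => (sub_eq_iff_eq_add.1 (congrFun₂ hX j I)).symm.trans
    (sub_eq_iff_eq_add.1 (congrFun₂ hX' j I))
  have e1 := e 0 I101
  have e2 := e 1 I011
  have e3 := e 2 I110
  have e4 := e 2 I111
  have l1 := fun j => e j I100
  have l2 := fun j => e j I010
  have l3 := fun j => e j I001
  simp only [infin_dt_linear _ _ _ card_I100, infin_dt_linear _ _ _ card_I010,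
    infin_dt_linear _ _ _ card_I001, zero_add] at l1 l2 l3
  rw [infin_dt_101_0, infin_dt_101_0] at e1
  rw [infin_dt_011_1, infin_dt_011_1] at e2
  rw [infin_dt_110_2, infin_dt_110_2] at e3
  rw [infin_dt_111_2, infin_dt_111_2] at e4
  simp [formNeg] at e1 e3 e4
  simp [formNeg, e1] at e2
  refine baseHom_ext h hf hf' (fun i => ?_) fun i => ?_
  · fin_cases i
    · exact e2
    · exact e3
  · fin_cases i
    · simpa [formNeg] using l1 0
    · simpa [formNeg] using l2 1
    · simpa [formNeg] using l3 0
    · simpa [formNeg] using l3 1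
    · exact e4

theorem unique_hom_one (h : 𝔹.IsInfinitesimalBase) (hψ : IsDeformation 𝔹 (dt 1) ψ)
    {f f' : RelQuot relOne →ₐ[ℂ] B} (hf : IsBaseHom (base relOne relOne_aug) 𝔹 f)
    (he : DefEquivalent 𝔹 (defOne.map f) ψ)
    (hf' : IsBaseHom (base relOne relOne_aug) 𝔹 f')
    (he' : DefEquivalent 𝔹 (defOne.map f') ψ) : f = f' := by
  rw [defOne_eq, formOne_map] at he he'
  obtain ⟨X, hX⟩ := he.exists_infin h hψ
  obtain ⟨X', hX'⟩ := he'.exists_infin h hψ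
  have e := fun j I => (sub_eq_iff_eq_add.1 (congrFun₂ hX j I)).symm.trans
    (sub_eq_iff_eq_add.1 (congrFun₂ hX' j I))
  have e1 := e 0 I101
  have e2 := e 1 I011
  have e3 := e 1 I101
  have e4 := e 0 I011
  have l1 := fun j => e j I100
  have l2 := fun j => e j I010
  have l3 := fun j => e j I001
  simp only [infin_dt_linear _ _ _ card_I100, infin_dt_linear _ _ _ card_I010,
    infin_dt_linear _ _ _ card_I001, zero_add] at l1 l2 l3
  rw [infin_dt_101_0, infin_dt_101_0] at e1
  rw [infin_dt_011_1, infin_dt_011_1] at e2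
  rw [infin_dt_101_1, infin_dt_101_1] at e3
  rw [infin_dt_011_0, infin_dt_011_0] at e4
  simp [formOne] at e1 e2 e3 e4
  -- The difference of the two diagonal coefficients eliminates the gauge term and contains t 0
  -- twice.
  have e0 : f (proj relOne (t 0)) = f' (proj relOne (t 0)) := by
    rw [← sub_eq_zero, ← smul_eq_zero_iff_right (two_ne_zero (α := ℂ)), two_smul]
    linear_combination (norm := abel) e1 - e2
  refine baseHom_ext h hf hf' (fun i => ?_) fun i => ?_
  · fin_cases i
    · exact e0
    · exact e3
    · exact e4
  · fin_cases i
    · simpa [formOne] using l1 0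
    · simpa [formOne] using l2 1
    · simpa [formOne] using l3 0
    · simpa [formOne] using l3 1
    · simpa [formOne] using l1 1
    · simpa [formOne] using l2 0

end Uniqueness

theorem isMiniversal_defGen {l : ℂ} (h1 : l ≠ 1) (h2 : l ≠ -1) :
    IsMiniversal.{0, u} (base relGen relGen_aug) (dt l) (defGen l) where
  formal := isFormalBase_relGen
  isDeformation := isDeformation_defGen l
  exists_hom _ _ _ _ hf _ hψ := exists_hom_gen h1 h2 hf hψ
  unique_hom _ _ _ _ h _ hψ _ _ hf he hf' he' := unique_hom_gen l h hψ hf he hf' he'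

theorem isMiniversal_defNeg :
    IsMiniversal.{0, u} (base relNeg relNeg_aug) (dt (-1)) defNeg where
  formal := isFormalBase_relNeg
  isDeformation := isDeformation_defNeg
  exists_hom _ _ _ _ hf _ hψ := exists_hom_neg hf hψ
  unique_hom _ _ _ _ h _ hψ _ _ hf he hf' he' := unique_hom_neg h hψ hf he hf' he'

theorem isMiniversal_defOne :
    IsMiniversal.{0, u} (base relOne relOne_aug) (dt 1) defOne where
  formal := isFormalBase_relOne
  isDeformation := isDeformation_defOne
  exists_hom _ _ _ _ hf _ hψ := exists_hom_one hf hψ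
  unique_hom _ _ _ _ h _ hψ _ _ hf he hf' he' := unique_hom_one h hψ hf he hf' he'

end LInfinity

end

noncomputable section
namespace LInfinity

/-! ### The cohomology of `d̃_λ` -/

theorem differential_one (l : ℂ) (a b c : Fin 3 → ℂ) :
    differential (dt l) 1 (ofColumns a b c 0 0 0 0) =
      ofColumns 0 0 0 ![-b 2, l * a 2, 0] ![-c 2, (1 - l) * a 1, a 2]
        ![(l - 1) * b 0, -(l * c 2), l * b 2] 0 := by
  change bracket _ _ _ _ = _
  apply cochain_ext <;> intro j <;> fin_cases j <;>
    simp +decide [bracket, Matrix.mul_apply, sum_mono, dt_apply] <;> try ring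

theorem differential_two (l : ℂ) (a b c : Fin 3 → ℂ) :
    differential (dt l) 2 (ofColumns 0 0 0 a b c 0) =
      ofColumns 0 0 0 0 0 0 ![-c 2 - l * a 0, - a 1 + l * b 2, -(1+l) * a 2] := by
  change bracket _ _ _ _ = _
  apply cochain_ext <;> intro j <;> fin_cases j <;>
    simp +decide [bracket, Matrix.mul_apply, sum_mono, dt_apply] <;> try ring

theorem differential_three (l : ℂ) (a : Fin 3 → ℂ) :
    differential (dt l) 3 (ofColumns 0 0 0 0 0 0 a) = 0 := by
  change bracket _ _ _ _ = _
  apply cochain_ext <;> intro j <;> fin_cases j <;>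
    simp +decide [bracket, Matrix.mul_apply, sum_mono, dt_apply]

theorem mem_cochains_zero {φ : Cochain ℂ} : φ ∈ cochains 0 ↔ φ = 0 := by
  constructor
  · intro h
    ext j I
    exact h j I (Finset.card_ne_zero.2 I.2)
  · rintro rfl
    exact zero_mem _

theorem mem_cochains_one {φ : Cochain ℂ} :
    φ ∈ cochains 1 ↔ ∃ a b c, φ = ofColumns a b c 0 0 0 0 := by
  constructor
  · intro h
    refine ⟨fun j => φ j I100, fun j => φ j I010, fun j => φ j I001, ?_⟩
    apply cochain_ext <;> intro j <;> simp
    all_goals exact h j _ (by decide)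
  · rintro ⟨a, b, c, rfl⟩ j I hI
    rcases mono_cases I with rfl | rfl | rfl | rfl | rfl | rfl | rfl <;> simp at hI ⊢

theorem mem_cochains_two {φ : Cochain ℂ} :
    φ ∈ cochains 2 ↔ ∃ a b c, φ = ofColumns 0 0 0 a b c 0 := by
  constructor
  · intro h
    refine ⟨fun j => φ j I110, fun j => φ j I101, fun j => φ j I011, ?_⟩
    apply cochain_ext <;> intro j <;> simp
    all_goals exact h j _ (by decide)
  · rintro ⟨a, b, c, rfl⟩ j I hI
    rcases mono_cases I with rfl | rfl | rfl | rfl | rfl | rfl | rfl <;> simp at hI ⊢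

theorem mem_cochains_three {φ : Cochain ℂ} :
    φ ∈ cochains 3 ↔ ∃ a, φ = ofColumns 0 0 0 0 0 0 a := by
  constructor
  · intro h
    refine ⟨fun j => φ j I111, ?_⟩
    apply cochain_ext <;> intro j <;> simp
    all_goals exact h j _ (by decide)
  · rintro ⟨a, rfl⟩ j I hI
    rcases mono_cases I with rfl | rfl | rfl | rfl | rfl | rfl | rfl <;> simp at hI ⊢

theorem coboundaries_zero (d : Cochain ℂ) : coboundaries d 0 = ⊥ := by
  have h : cochains 0 = ⊥ := by
    ext φ
    rw [mem_cochains_zero, Submodule.mem_bot]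
  rw [coboundaries, h, Submodule.map_bot]

theorem mem_cocycles_one {l : ℂ} {φ : Cochain ℂ} : φ ∈ cocycles (dt l) 1 ↔
    ∃ a b c, φ = ofColumns a b c 0 0 0 0 ∧ a 2 = 0 ∧ b 2 = 0 ∧ c 2 = 0 ∧ (1 - l) * a 1 = 0 ∧
      (l - 1) * b 0 = 0 := by
  constructor
  · rintro ⟨h, h'⟩
    obtain ⟨a, b, c, rfl⟩ := mem_cochains_one.1 h
    rw [SetLike.mem_coe, LinearMap.mem_ker, differential_one] at h'
    refine ⟨a, b, c, rfl, ?_, ?_, ?_, ?_, ?_⟩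
    · simpa using congrFun₂ h' 2 I101
    · simpa using congrFun₂ h' 0 I110
    · simpa using congrFun₂ h' 0 I101
    · simpa using congrFun₂ h' 1 I101
    · simpa using congrFun₂ h' 0 I011
  · rintro ⟨a, b, c, rfl, h1, h2, h3, h4, h5⟩
    refine ⟨mem_cochains_one.2 ⟨a, b, c, rfl⟩, ?_⟩
    rw [SetLike.mem_coe, LinearMap.mem_ker, differential_one, h1, h2, h3, h4, h5]
    apply cochain_ext <;> intro j <;> fin_cases j <;> simp

theorem mem_cocycles_two {l : ℂ} {φ : Cochain ℂ} : φ ∈ cocycles (dt l) 2 ↔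
    ∃ a b c, φ = ofColumns 0 0 0 a b c 0 ∧ c 2 = -(l * a 0) ∧ a 1 = l * b 2 ∧
      (1 + l) * a 2 = 0 := by
  constructor
  · rintro ⟨h, h'⟩
    obtain ⟨a, b, c, rfl⟩ := mem_cochains_two.1 h
    rw [SetLike.mem_coe, LinearMap.mem_ker, differential_two] at h'
    have h1 := congrFun₂ h' 0 I111
    have h2 := congrFun₂ h' 1 I111
    have h3 := congrFun₂ h' 2 I111
    simp only [ofColumns_111, Matrix.cons_val, Matrix.zero_apply] at h1 h2 h3
    refine ⟨a, b, c, rfl, ?_, ?_, ?_⟩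
    · linear_combination -h1
    · linear_combination -h2
    · linear_combination -h3
  · rintro ⟨a, b, c, rfl, h1, h2, h3⟩
    refine ⟨mem_cochains_two.2 ⟨a, b, c, rfl⟩, ?_⟩
    rw [SetLike.mem_coe, LinearMap.mem_ker, differential_two, h1, h2, neg_mul, h3]
    apply cochain_ext <;> intro j <;> fin_cases j <;> simp

theorem mem_cocycles_three {l : ℂ} {φ : Cochain ℂ} : φ ∈ cocycles (dt l) 3 ↔
    ∃ a, φ = ofColumns 0 0 0 0 0 0 a := by
  rw [← mem_cochains_three, cocycles, Submodule.mem_inf, and_iff_left_iff_imp]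
  intro h
  obtain ⟨a, rfl⟩ := mem_cochains_three.1 h
  exact differential_three l a

theorem mem_coboundaries_one {l : ℂ} {φ : Cochain ℂ} : φ ∈ coboundaries (dt l) 1 ↔
    ∃ x y z u v : ℂ, φ = ofColumns 0 0 0 ![-y, l * x, 0] ![-z, (1 - l) * u, x]
        ![(l - 1) * v, -(l * z), l * y] 0 := by
  constructor
  · rintro ⟨_, h, rfl⟩
    obtain ⟨a, b, c, rfl⟩ := mem_cochains_one.1 h
    exact ⟨a 2, b 2, c 2, a 1, b 0, differential_one l a b c⟩
  · rintro ⟨x, y, z, u, v, rfl⟩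
    exact ⟨_, mem_cochains_one.2 ⟨![0, u, x], ![v, 0, y], ![0, 0, z], rfl⟩,
      differential_one l _ _ _⟩

theorem mem_coboundaries_two {l : ℂ} {φ : Cochain ℂ} : φ ∈ coboundaries (dt l) 2 ↔
    ∃ x y z : ℂ, φ = ofColumns 0 0 0 0 0 0 ![x, y, (1 + l) * z] := by
  constructor
  · rintro ⟨_, h, rfl⟩
    obtain ⟨a, b, c, rfl⟩ := mem_cochains_two.1 h
    refine ⟨-c 2 - l * a 0, -a 1 + l * b 2, -a 2, ?_⟩
    rw [differential_two, neg_mul, mul_neg]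
  · rintro ⟨x, y, z, rfl⟩
    refine ⟨_, mem_cochains_two.2 ⟨![0, -y, -z], 0, ![0, 0, -x], rfl⟩, ?_⟩
    rw [differential_two, show (1 + l) * z = -((-l + -1) * z) by ring]
    simp

/-- The dimension of a cohomology space, from a complete set of invariants of cocycles. -/
theorem finrank_cohomology {d : Cochain ℂ} {n k : ℕ} (J : Fin k → Cochain ℂ →ₗ[ℂ] ℂ)
    (S : (Fin k → ℂ) → Cochain ℂ) (hS : ∀ c, S c ∈ cocycles d n) (hJ : ∀ c i, J i (S c) = c i)
    (hker : ∀ φ ∈ cocycles d n, (∀ i, J i φ = 0) ↔ φ ∈ coboundaries d (n - 1)) :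
    Module.finrank ℂ (Cohomology d n) = k := by
  let G : cocycles d n →ₗ[ℂ] Fin k → ℂ := LinearMap.pi J ∘ₗ (cocycles d n).subtype
  have hG : Function.Surjective G := fun c => ⟨⟨S c, hS c⟩, funext fun i => hJ c i⟩
  have hk : (coboundaries d (n - 1)).comap (cocycles d n).subtype = LinearMap.ker G := by
    ext ⟨φ, hφ⟩
    rw [Submodule.mem_comap, LinearMap.mem_ker, funext_iff]
    exact (hker φ hφ).symm
  rw [((Submodule.quotEquivOfEq _ _ hk).trans (G.quotKerEquivOfSurjective hG)).finrank_eq,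
    Module.finrank_fin_fun]

/-- A coefficient of a cochain. -/
def coord (j : Fin 3) (I : Mono) : Cochain ℂ →ₗ[ℂ] ℂ := Matrix.entryLinearMap ℂ ℂ j I

theorem coord_apply (j : Fin 3) (I : Mono) (φ : Cochain ℂ) : coord j I φ = φ j I := rfl

theorem finrank_cohomology_one {l : ℂ} (h : l ≠ 1) :
    Module.finrank ℂ (Cohomology (dt l) 1) = 4 := by
  refine finrank_cohomology ![coord 0 I100, coord 1 I010, coord 0 I001, coord 1 I001]
    (fun c => ofColumns ![c 0, 0, 0] ![0, c 1, 0] ![c 2, c 3, 0] 0 0 0 0) (fun c => ?_)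
    (fun c i => ?_) fun φ hφ => ?_
  · exact mem_cocycles_one.2 ⟨_, _, _, rfl, by simp⟩
  · fin_cases i <;> simp [coord_apply]
  · rw [coboundaries_zero, Submodule.mem_bot]
    constructor
    · intro h0
      obtain ⟨a, b, c, rfl, h1, h2, h3, h4, h5⟩ := mem_cocycles_one.1 hφ
      rw [mul_eq_zero_iff_left (sub_ne_zero.2 h.symm)] at h4
      rw [mul_eq_zero_iff_left (sub_ne_zero.2 h)] at h5
      have e0 := h0 0
      have e1 := h0 1
      have e2 := h0 2
      have e3 := h0 3
      simp [coord_apply] at e0 e1 e2 e3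
      apply cochain_ext <;> intro j <;> fin_cases j <;> simp [*]
    · rintro rfl i
      exact map_zero _

theorem finrank_cohomology_one_one : Module.finrank ℂ (Cohomology (dt 1) 1) = 6 := by
  refine finrank_cohomology ![coord 0 I100, coord 1 I010, coord 0 I001, coord 1 I001, coord 1 I100,
    coord 0 I010] (fun c => ofColumns ![c 0, c 4, 0] ![c 5, c 1, 0] ![c 2, c 3, 0] 0 0 0 0)
    (fun c => ?_) (fun c i => ?_) fun φ hφ => ?_
  · exact mem_cocycles_one.2 ⟨_, _, _, rfl, by simp⟩
  · fin_cases i <;> simp [coord_apply]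
  · rw [coboundaries_zero, Submodule.mem_bot]
    constructor
    · intro h0
      obtain ⟨a, b, c, rfl, h1, h2, h3, -, -⟩ := mem_cocycles_one.1 hφ
      have e0 := h0 0
      have e1 := h0 1
      have e2 := h0 2
      have e3 := h0 3
      have e4 := h0 4
      have e5 := h0 5
      simp [coord_apply] at e0 e1 e2 e3 e4 e5
      apply cochain_ext <;> intro j <;> fin_cases j <;> simp [*]
    · rintro rfl i
      exact map_zero _

/-- A coboundary has diagonal coefficients (-z, -λz), so the coefficient of φ^{011}_2 minus λ times
that of φ^{101}_1 is an invariant. The off-diagonal coefficients are removed by dividing by ±(1 -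
λ). -/
theorem finrank_cohomology_two {l : ℂ} (h : l ≠ 1) (h' : l ≠ -1) :
    Module.finrank ℂ (Cohomology (dt l) 2) = 1 := by
  have h1 : 1 + l ≠ 0 := by
    contrapose! h'
    linear_combination h'
  refine finrank_cohomology ![coord 1 I011 - l • coord 0 I101]
    (fun c => ofColumns 0 0 0 0 0 ![0, c 0, 0] 0) (fun c => ?_) (fun c i => ?_) fun φ hφ => ?_
  · exact mem_cocycles_two.2 ⟨_, _, _, rfl, by simp⟩
  · fin_cases i
    simp [coord_apply]
  · obtain ⟨a, b, c, rfl, h2, h3, h4⟩ := mem_cocycles_two.1 hφ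
    rw [mul_eq_zero_iff_left h1] at h4
    rw [mem_coboundaries_one]
    constructor
    · intro h0
      have e0 := h0 0
      simp [coord_apply] at e0
      refine ⟨b 2, -a 0, -b 0, (1 - l)⁻¹ * b 1, (l - 1)⁻¹ * c 0, ?_⟩
      apply cochain_ext <;> intro j <;> fin_cases j <;>
        simp [h2, h3, h4, mul_inv_cancel_left₀ (sub_ne_zero.2 h),
          mul_inv_cancel_left₀ (sub_ne_zero.2 h.symm)]
      linear_combination e0
    · rintro ⟨x, y, z, u, v, e⟩ i
      fin_cases i
      simp [coord_apply, e]

/-- The second class is φ^{110}_3: the cocycle condition (1 + λ) a = 0 on its coefficient becomes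
empty. -/
theorem finrank_cohomology_neg_two : Module.finrank ℂ (Cohomology (dt (-1)) 2) = 2 := by
  refine finrank_cohomology ![coord 1 I011 + coord 0 I101, coord 2 I110]
    (fun c => ofColumns 0 0 0 ![0, 0, c 1] 0 ![0, c 0, 0] 0) (fun c => ?_) (fun c i => ?_)
    fun φ hφ => ?_
  · exact mem_cocycles_two.2 ⟨_, _, _, rfl, by simp⟩
  · fin_cases i <;> simp [coord_apply]
  · obtain ⟨a, b, c, rfl, h2, h3, -⟩ := mem_cocycles_two.1 hφ
    rw [mem_coboundaries_one]
    constructor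
    · intro h0
      have e0 := h0 0
      have e1 := h0 1
      simp [coord_apply] at e0 e1
      refine ⟨b 2, -a 0, -b 0, (1 / 2) * b 1, -(1 / 2) * c 0, ?_⟩
      apply cochain_ext <;> intro j <;> fin_cases j <;> simp [h2, h3, e1]
      · ring
      · ring
      · linear_combination e0
    · rintro ⟨x, y, z, u, v, e⟩ i
      fin_cases i <;> simp [coord_apply, e]

/-- Coboundaries no longer reach the off-diagonal coefficients, which contribute two further
classes. -/
theorem finrank_cohomology_one_two : Module.finrank ℂ (Cohomology (dt 1) 2) = 3 := by
  refine finrank_cohomology ![coord 1 I011 - coord 0 I101, coord 1 I101, coord 0 I011]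
    (fun c => ofColumns 0 0 0 0 ![0, c 1, 0] ![c 2, c 0, 0] 0) (fun c => ?_) (fun c i => ?_)
    fun φ hφ => ?_
  · exact mem_cocycles_two.2 ⟨_, _, _, rfl, by simp⟩
  · fin_cases i <;> simp [coord_apply]
  · obtain ⟨a, b, c, rfl, h2, h3, h4⟩ := mem_cocycles_two.1 hφ
    rw [mul_eq_zero_iff_left (by norm_num)] at h4
    rw [mem_coboundaries_one]
    constructor
    · intro h0
      have e0 := h0 0
      have e1 := h0 1
      have e2 := h0 2
      simp [coord_apply] at e0 e1 e2
      refine ⟨b 2, -a 0, -b 0, 0, 0, ?_⟩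
      apply cochain_ext <;> intro j <;> fin_cases j <;> simp [h2, h3, h4, e1, e2]
      linear_combination e0
    · rintro ⟨x, y, z, u, v, e⟩ i
      fin_cases i <;> simp [coord_apply, e]

theorem finrank_cohomology_three {l : ℂ} (h : l ≠ -1) :
    Module.finrank ℂ (Cohomology (dt l) 3) = 0 := by
  have h1 : 1 + l ≠ 0 := by
    contrapose! h
    linear_combination h
  refine finrank_cohomology ![] (fun _ => 0) (fun c => zero_mem _) (fun c i => i.elim0)
    fun φ hφ => ?_
  obtain ⟨a, rfl⟩ := mem_cocycles_three.1 hφ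
  rw [mem_coboundaries_two]
  refine ⟨fun _ => ⟨a 0, a 1, (1 + l)⁻¹ * a 2, ?_⟩, fun _ i => i.elim0⟩
  apply cochain_ext <;> intro j <;> fin_cases j <;> simp [mul_inv_cancel_left₀ h1]

theorem finrank_cohomology_neg_three : Module.finrank ℂ (Cohomology (dt (-1)) 3) = 1 := by
  refine finrank_cohomology ![coord 2 I111] (fun c => ofColumns 0 0 0 0 0 0 ![0, 0, c 0])
    (fun c => mem_cocycles_three.2 ⟨_, rfl⟩) (fun c i => ?_) fun φ hφ => ?_
  · fin_cases i
    simp [coord_apply]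
  · obtain ⟨a, rfl⟩ := mem_cocycles_three.1 hφ
    rw [mem_coboundaries_two]
    constructor
    · intro h0
      have e0 := h0 0
      simp [coord_apply] at e0
      refine ⟨a 0, a 1, 0, ?_⟩
      apply cochain_ext <;> intro j <;> fin_cases j <;> simp [e0]
    · rintro ⟨x, y, z, e⟩ i
      fin_cases i
      simp [coord_apply, e]

end LInfinity

end

noncomputable section

namespace LInfinity

/-! ### The base of the deformation of `d̃_{-1}` modulo odd parameters -/

open SuperSeries

/-- Setting the odd variables to zero. -/
def evenPart (p q : ℕ) : SuperSeries p q →+* MvPowerSeries (Fin p) ℂ :=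
  (ExteriorAlgebra.algebraMapInv :
    SuperSeries p q →ₐ[MvPowerSeries (Fin p) ℂ] MvPowerSeries (Fin p) ℂ).toRingHom

theorem evenPart_algebraMap {p q : ℕ} (r : MvPowerSeries (Fin p) ℂ) :
    evenPart p q (algebraMap _ _ r) = r := ExteriorAlgebra.algebraMap_leftInverse _ r

theorem evenPart_t {p q : ℕ} (i : Fin p) : evenPart p q (t i) = MvPowerSeries.X i :=
  evenPart_algebraMap _

theorem evenPart_θ {p q : ℕ} (i : Fin q) : evenPart p q (θ i) = 0 := by
  change ExteriorAlgebra.algebraMapInv (ExteriorAlgebra.ι (MvPowerSeries (Fin p) ℂ)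
    (Pi.single i 1 : Fin q → MvPowerSeries (Fin p) ℂ)) = 0
  simp [ExteriorAlgebra.algebraMapInv]

/-- Setting the odd variables to zero turns every relation into zero or a multiple of t₁t₂, so the
quotient maps to power series modulo t₁t₂. Conversely the last relation writes t₁t₂ as a multiple of
an odd variable. -/
theorem mem_span_odd_iff (r : MvPowerSeries (Fin 2) ℂ) :
    proj relNeg (algebraMap _ _ r) ∈
        TwoSidedIdeal.span (Set.range fun i => proj relNeg (θ i)) ↔
      MvPowerSeries.X 0 * MvPowerSeries.X 1 ∣ r := by
  constructor
  · intro h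
    let ρ : SuperSeries 2 5 →+* MvPowerSeries (Fin 2) ℂ ⧸ Ideal.span
        {(MvPowerSeries.X 0 * MvPowerSeries.X 1 : MvPowerSeries (Fin 2) ℂ)} :=
      (Ideal.Quotient.mk _).comp (evenPart 2 5)
    have hρ : TwoSidedIdeal.span relNeg ≤ TwoSidedIdeal.ker ρ := by
      rw [TwoSidedIdeal.span_le]
      intro x hx
      refine (TwoSidedIdeal.mem_ker _).2 ?_
      revert x
      simp only [relNeg, Set.forall_mem_insert, Set.mem_singleton_iff, forall_eq]
      have h0 : Ideal.Quotient.mk (Ideal.span {(MvPowerSeries.X 0 * MvPowerSeries.X 1 :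
          MvPowerSeries (Fin 2) ℂ)}) (MvPowerSeries.X 0) * Ideal.Quotient.mk _
            (MvPowerSeries.X 1) = 0 := by
        rw [← map_mul]
        exact Ideal.Quotient.eq_zero_iff_mem.2 (Ideal.mem_span_singleton_self _)
      simp [ρ, evenPart_θ, evenPart_t, h0]
    let Φ : RelQuot relNeg →+* MvPowerSeries (Fin 2) ℂ ⧸ Ideal.span
        {(MvPowerSeries.X 0 * MvPowerSeries.X 1 : MvPowerSeries (Fin 2) ℂ)} :=
      (TwoSidedIdeal.span relNeg).ringCon.lift ρ fun x y hxy => by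
        have hm := (TwoSidedIdeal.mem_ker _).1 (hρ ((TwoSidedIdeal.rel_iff _ x y).1 hxy))
        rw [map_sub] at hm
        exact sub_eq_zero.1 hm
    have hΦ : ∀ x, Φ (proj relNeg x) = ρ x := fun x => rfl
    have hle : TwoSidedIdeal.span (Set.range fun i => proj relNeg (θ i)) ≤
        TwoSidedIdeal.ker Φ := by
      rw [TwoSidedIdeal.span_le]
      rintro _ ⟨i, rfl⟩
      refine (TwoSidedIdeal.mem_ker _).2 ?_
      rw [hΦ]
      simp [ρ, evenPart_θ]
    have h1 := (TwoSidedIdeal.mem_ker _).1 (hle h)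
    rw [hΦ, RingHom.comp_apply, evenPart_algebraMap, Ideal.Quotient.eq_zero_iff_mem,
      Ideal.mem_span_singleton] at h1
    exact h1
  · rintro ⟨s, rfl⟩
    have h0 : proj relNeg (θ 4 * θ 0 + θ 4 * θ 1 - t 0 * t 1) = 0 :=
      proj_eq_zero (by simp [relNeg])
    have e : proj relNeg (algebraMap _ _ (MvPowerSeries.X 0 * MvPowerSeries.X 1 * s)) =
        proj relNeg (θ 4) * (proj relNeg (θ 0) + proj relNeg (θ 1)) *
          proj relNeg (algebraMap _ _ s) := by
      rw [map_sub, sub_eq_zero, map_add, map_mul, map_mul] at h0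
      rw [mul_add, h0, map_mul, map_mul, map_mul]
      rfl
    rw [e]
    exact TwoSidedIdeal.mul_mem_right _ _ _ (TwoSidedIdeal.mul_mem_right _ _ _
      (TwoSidedIdeal.subset_span ⟨4, rfl⟩))

end LInfinity

end

noncomputable section

/-! ### Codifferentials near `d̃_1` equivalent to `d2`: conjugacy of 2 × 2 matrices -/

namespace LInfinity

/-- The codifferential `f_0 f_2 ↦ f_0 (1 + t₁) + f_1 t₂`, `f_1 f_2 ↦ f_0 t₃ + f_1 (1 - t₁)`. -/
def dJ (t₁ t₂ t₃ : ℂ) : Cochain ℂ :=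
  ofColumns 0 0 0 0 ![1 + t₁, t₂, 0] ![t₃, 1 - t₁, 0] 0

theorem dJ_eq (t₁ t₂ t₃ : ℂ) :
    dt 1 + (phi I101 0 t₁ - phi I011 1 t₁) + phi I101 1 t₂ + phi I011 0 t₃ = dJ t₁ t₂ t₃ := by
  apply cochain_ext <;> intro j <;> fin_cases j <;>
    simp +decide [dJ, dt_apply, phi_apply, sub_eq_add_neg]

theorem d2_eq : d2 = dJ 0 1 0 := by
  apply cochain_ext <;> intro j <;> fin_cases j <;> simp +decide [dJ, d2, phi_apply]

theorem isLocalBase_groundBase : groundBase.IsLocalBase where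
  isCompl := by
    change IsCompl (if (0 : ZMod 2) = 0 then ⊤ else ⊥) (if (1 : ZMod 2) = 0 then ⊤ else ⊥)
    simpa using isCompl_top_bot
  one_mem := by
    change (1 : ℂ) ∈ (if (0 : ZMod 2) = 0 then (⊤ : Submodule ℂ ℂ) else ⊥)
    simp
  mul_mem i j a b ha hb := by
    change _ ∈ (if _ then (⊤ : Submodule ℂ ℂ) else ⊥) at *
    obtain rfl | rfl := (show ∀ i : ZMod 2, i = 0 ∨ i = 1 by decide) i <;>
    obtain rfl | rfl := (show ∀ i : ZMod 2, i = 0 ∨ i = 1 by decide) j <;> simp_all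
  supercomm i j a b ha hb := by
    change _ ∈ (if _ then (⊤ : Submodule ℂ ℂ) else ⊥) at *
    obtain rfl | rfl := (show ∀ i : ZMod 2, i = 0 ∨ i = 1 by decide) i <;>
    obtain rfl | rfl := (show ∀ i : ZMod 2, i = 0 ∨ i = 1 by decide) j <;> simp_all [mul_comm]
  isLocal := inferInstance

/-- Equivalence through an explicitly invertible automorphism. -/
def AutEquiv (φ φ' : Cochain ℂ) : Prop :=
  ∃ g g' : Matrix Mono Mono ℂ, AutPair groundBase g g' ∧ coder 1 φ * g = g * coder 1 φ'

theorem AutEquiv.equivalent {φ φ' : Cochain ℂ} (h : AutEquiv φ φ') :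
    Equivalent groundBase φ φ' := by
  obtain ⟨g, g', hg, e⟩ := h
  exact ⟨g, hg.isCoalgAut, e⟩

theorem AutEquiv.trans {φ φ' φ'' : Cochain ℂ} (h : AutEquiv φ φ') (h' : AutEquiv φ' φ'') :
    AutEquiv φ φ'' := by
  obtain ⟨g, g', hg, e⟩ := h
  obtain ⟨k, k', hk, e'⟩ := h'
  refine ⟨g * k, k' * g', hg.mul isLocalBase_groundBase hk, ?_⟩
  rw [← mul_assoc, e, mul_assoc, e', mul_assoc]

/-- An intertwining relation between coderivations can be checked on corestrictions. -/
theorem AutPair.intertwines {g g' : Matrix Mono Mono ℂ} (hg : AutPair groundBase g g')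
    {φ φ' : Cochain ℂ} (hφ' : IsCodifferential groundBase φ')
    (h : ∀ j I, (coder 1 φ * g) (sing j) I = (g * coder 1 φ') (sing j) I) :
    coder 1 φ * g = g * coder 1 φ' := by
  have hc := (hg.conj_isCoder isLocalBase_groundBase (isCoder_coder 1 φ') hφ'.hasParity).1
  have e : coder 1 φ = g * coder 1 φ' * g' := by
    refine (isCoder_coder 1 φ).ext hc fun j I => ?_
    have e1 : coder 1 φ = coder 1 φ * g * g' := by rw [mul_assoc, hg.mul_inv, mul_one]
    rw [e1, Matrix.mul_apply, Matrix.mul_apply]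
    exact Finset.sum_congr rfl fun M _ => by rw [h]
  rw [e, mul_assoc, hg.inv_mul, mul_one]

theorem groundBase_mem (a : ℂ) : a ∈ groundBase.part 0 := by
  change a ∈ (if (0 : ZMod 2) = 0 then (⊤ : Submodule ℂ ℂ) else ⊥)
  simp

theorem isCodifferential_dJ (t₁ t₂ t₃ : ℂ) : IsCodifferential groundBase (dJ t₁ t₂ t₃) := by
  refine isCodifferential_of_entries isLocalBase_groundBase ?_ ?_ ?_ ?_ ?_ ?_ ?_ ?_ ?_ ?_ ?_ ?_ ?_
    ?_ ?_ ?_ ?_ ?_ ?_ ?_ ?_ ?_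
  · apply mem_part_of_columns <;> intro j <;> fin_cases j <;> simp [dJ, groundBase_mem]
  all_goals simp [dJ]

/-- Write the matrix as 1 + N. The vector f₂ + (t₁/t₂) f₁ spans the kernel of the nilpotent N, and N
f₁ is t₂ times it; the shear takes this vector as the new f₂. -/
theorem autEquiv_shear {t₁ t₂ t₃ : ℂ} (h : t₂ ≠ 0) (h' : t₁ ^ 2 + t₂ * t₃ = 0) :
    AutEquiv (dJ t₁ t₂ t₃) (dJ 0 t₂ 0) := by
  have hp : AutPair groundBase (1 + coder 0 (phi I010 0 (t₁ / t₂)))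
      (1 + coder 0 (phi I010 0 (-(t₁ / t₂)))) :=
    autPair_elementary isLocalBase_groundBase (groundBase_mem _) (groundBase_mem _) (by simp +decide) (by simp +decide)
  refine ⟨_, _, hp, hp.intertwines (isCodifferential_dJ _ _ _) fun j I => ?_⟩
  obtain rfl : t₃ = -t₁ ^ 2 / t₂ := by
    field_simp
    linear_combination h'
  rcases mono_cases I with rfl | rfl | rfl | rfl | rfl | rfl | rfl <;> fin_cases j <;>
    simp +decide [sing_zero, sing_one, sing_two, Matrix.mul_apply, sum_mono, dJ, phi_apply,
      Matrix.one_apply]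
  all_goals field_simp
  all_goals ring

theorem autEquiv_scale {t : ℂ} (h : t ≠ 0) : AutEquiv (dJ 0 t 0) (dJ 0 1 0) := by
  have hp : AutPair groundBase (1 + coder 0 (phi I010 1 (t - 1)))
      (1 + coder 0 (phi I010 1 (t⁻¹ - 1))) := by
    refine autPair_elementary isLocalBase_groundBase (groundBase_mem _) (groundBase_mem _) ?_ ?_
    all_goals
      rw [if_pos (show I010 = sing 1 from rfl)]
      field_simp
      ring
  refine ⟨_, _, hp, hp.intertwines (isCodifferential_dJ _ _ _) fun j I => ?_⟩
  rcases mono_cases I with rfl | rfl | rfl | rfl | rfl | rfl | rfl <;> fin_cases j <;>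
    simp +decide [sing_zero, sing_one, sing_two, Matrix.mul_apply, sum_mono, dJ, phi_apply,
      Matrix.one_apply]

/-- Conjugation by f₁ ↦ f₁ + f₂ makes the entry t₂ nonzero, which brings the case t₂ = 0 within
reach of the shear. -/
theorem autEquiv_lower (t : ℂ) : AutEquiv (dJ 0 0 t) (dJ t (-t) t) := by
  have hp : AutPair groundBase (1 + coder 0 (phi I100 1 1)) (1 + coder 0 (phi I100 1 (-1))) :=
    autPair_elementary isLocalBase_groundBase (groundBase_mem _) (groundBase_mem _)
      (by simp +decide) (by simp +decide)
  refine ⟨_, _, hp, hp.intertwines (isCodifferential_dJ _ _ _) fun j I => ?_⟩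
  rcases mono_cases I with rfl | rfl | rfl | rfl | rfl | rfl | rfl <;> fin_cases j <;>
    simp +decide [sing_zero, sing_one, sing_two, Matrix.mul_apply, sum_mono, dJ, phi_apply,
      Matrix.one_apply]

theorem autEquiv_dJ {t₁ t₂ t₃ : ℂ} (h : t₁ ≠ 0 ∨ t₂ ≠ 0 ∨ t₃ ≠ 0) (h' : t₁ ^ 2 + t₂ * t₃ = 0) :
    AutEquiv (dJ t₁ t₂ t₃) (dJ 0 1 0) := by
  by_cases h2 : t₂ = 0
  · subst h2
    obtain rfl : t₁ = 0 := by simpa using h'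
    have h3 : t₃ ≠ 0 := by simpa using h
    exact (autEquiv_lower t₃).trans ((autEquiv_shear (neg_ne_zero.2 h3) (by ring)).trans
      (autEquiv_scale (neg_ne_zero.2 h3)))
  · exact (autEquiv_shear h2 h').trans (autEquiv_scale h2)

theorem mulCoef_to_101 : ∀ J N : Mono, mulCoef J.1 N.1 I101.1 =
    if J = I100 ∧ N = I001 then 1 else if J = I001 ∧ N = I100 then -1 else 0 := by decide +kernel

theorem mulCoef_to_011 : ∀ J N : Mono, mulCoef J.1 N.1 I011.1 =
    if J = I010 ∧ N = I001 then 1 else if J = I001 ∧ N = I010 then -1 else 0 := by decide +kernel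

theorem mulCoef_100_001 : ∀ K : Mono, mulCoef I100.1 I001.1 K.1 = if K = I101 then 1 else 0 := by
  decide +kernel

theorem mulCoef_010_001 : ∀ K : Mono, mulCoef I010.1 I001.1 K.1 = if K = I011 then 1 else 0 := by
  decide +kernel

theorem mulCoef_split_one : ∀ J N : Mono, ∀ j : Fin 3, mulCoef J.1 N.1 (sing j).1 = 0 := by
  decide +kernel

/-- Elements of W are primitive. If f_P ⊗ f_Q occurs in Δ f_K only, with coefficient 1,
compatibility with Δ isolates the entry. -/
theorem IsCoalgAut.apply_sing {A : Type u} [Ring A] [Algebra ℂ A] {𝔸 : SuperAug A}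
    {g : Matrix Mono Mono A} (hg : IsCoalgAut 𝔸 g) (i : Fin 3) {P Q K : Mono}
    (h : ∀ M : Mono, mulCoef P.1 Q.1 M.1 = if M = K then 1 else 0) : g K (sing i) = 0 := by
  simpa [h, mulCoef_split_one] using hg.comul P Q (sing i)

theorem eq_zero_of_columns {g : Matrix Mono Mono ℂ} (hg : IsUnit g) {I I' : Mono} (hI : I ≠ I')
    {x y : ℂ} (h : ∀ M, x * g M I + y * g M I' = 0) : x = 0 ∧ y = 0 := by
  obtain ⟨k, hk⟩ := hg.exists_left_inv
  have key : ∀ K, x * (1 : Matrix Mono Mono ℂ) K I + y * (1 : Matrix Mono Mono ℂ) K I' = 0 := by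
    intro K
    rw [← hk, Matrix.mul_apply, Matrix.mul_apply, Finset.mul_sum, Finset.mul_sum,
      ← Finset.sum_add_distrib]
    refine Finset.sum_eq_zero fun M _ => ?_
    linear_combination k K M * h M
  refine ⟨?_, ?_⟩
  · simpa [hI] using key I
  · simpa [hI.symm] using key I'

/-- Let G be the block of g on ⟨f₁, f₂⟩ and s its entry on f₃. Writing M and M' for the two
matrices, equivalence amounts to s M G = G M'. The traces, both equal to 2, give s = 1; the
determinants then give t₁² + t₂t₃ = 0, and M = 1 is impossible because M' ≠ 1. -/
theorem equivalent_dJ_imp {t₁ t₂ t₃ : ℂ} (h : Equivalent groundBase (dJ t₁ t₂ t₃) (dJ 0 1 0)) :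
    (t₁ ≠ 0 ∨ t₂ ≠ 0 ∨ t₃ ≠ 0) ∧ t₁ ^ 2 + t₂ * t₃ = 0 := by
  obtain ⟨g, hg, e⟩ := h
  have c1 := hg.comul I100 I001 I101
  have c2 := hg.comul I010 I001 I101
  have c3 := hg.comul I100 I001 I011
  have c4 := hg.comul I010 I001 I011
  simp +decide [sum_mono, mulCoef_to_101, mulCoef_to_011, mulCoef_100_001, mulCoef_010_001] at c1 c2 c3 c4
  have e1 := congrFun₂ e I100 I101
  have e2 := congrFun₂ e I010 I101
  have e3 := congrFun₂ e I100 I011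
  have e4 := congrFun₂ e I010 I011
  have e5 := congrFun₂ e I001 I101
  have e6 := congrFun₂ e I001 I011
  simp +decide [Matrix.mul_apply, sum_mono, dJ] at e1 e2 e3 e4 e5 e6
  -- The values of `d2` span ⟨f₁, f₂⟩, and those of `dJ` lie in it, so g preserves this plane.
  have g21 : g I001 I010 = 0 := e6.symm
  have g20 : g I001 I100 = 0 := by linear_combination -e5 - g21
  -- The first two columns of g are supported on f₁ and f₂, hence a linear relation between the
  -- columns of G extends to whole columns of the invertible matrix g.
  have hcol : ∀ x y : ℂ, x * g I100 I100 + y * g I100 I010 = 0 →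
      x * g I010 I100 + y * g I010 I010 = 0 → x = 0 ∧ y = 0 := by
    intro x y h1 h2
    refine eq_zero_of_columns hg.isUnit (show I100 ≠ I010 by decide) fun M => ?_
    have hz : ∀ (i : Fin 3) (K : Mono), 2 ≤ K.1.card → g K (sing i) = 0 := by
      intro i K hK
      rcases mono_cases K with rfl | rfl | rfl | rfl | rfl | rfl | rfl
      iterate 3 exact absurd hK (by simp)
      · exact hg.apply_sing i (P := I100) (Q := I010) (by decide +kernel)
      · exact hg.apply_sing i (P := I100) (Q := I001) (by decide +kernel)
      · exact hg.apply_sing i (P := I010) (Q := I001) (by decide +kernel)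
      · exact hg.apply_sing i (P := I100) (Q := I011) (by decide +kernel)
    have hz0 := hz 0
    have hz1 := hz 1
    rw [sing_zero] at hz0
    rw [sing_one] at hz1
    rcases mono_cases M with rfl | rfl | rfl | rfl | rfl | rfl | rfl
    · exact h1
    · exact h2
    · rw [g20, g21, mul_zero, mul_zero, add_zero]
    all_goals rw [hz0 _ (by simp), hz1 _ (by simp), mul_zero, mul_zero, add_zero]
  rw [c1, c2, g20, mul_zero, neg_zero, add_zero] at e1 e2
  rw [c3, c4, g21, mul_zero, neg_zero, add_zero] at e3 e4
  simp only [mul_zero, neg_zero, add_zero] at e1 e2 e3 e4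
  have hΔ : g I100 I100 * g I010 I010 - g I100 I010 * g I010 I100 ≠ 0 := by
    intro h0
    obtain ⟨h1, h2⟩ := hcol (g I010 I010) (-g I010 I100) (by linear_combination h0) (by ring)
    obtain ⟨-, h4⟩ := hcol (g I100 I010) (-g I100 I100) (by ring)
      (by linear_combination -g I100 I010 * h2 - g I100 I100 * h1)
    exact one_ne_zero (hcol 1 0 (by linear_combination -h4) (by linear_combination -h2)).1
  have htr : g I001 I001 = 1 := by
    have : 2 * (g I001 I001 - 1) * (g I100 I100 * g I010 I010 - g I100 I010 * g I010 I100) = 0 := by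
      -- The combination with the adjugate of G: it computes the trace of s M - G M' G⁻¹ times det
      -- G.
      linear_combination g I010 I010 * e1 - g I010 I100 * e3 - g I100 I010 * e2 + g I100 I100 * e4
    simpa [hΔ, sub_eq_zero] using this
  rw [htr] at e1 e2 e3 e4
  constructor
  · by_contra! h0
    obtain ⟨rfl, rfl, rfl⟩ := h0
    have h1 := hcol 0 1 (by linear_combination -e1) (by linear_combination -e2)
    exact one_ne_zero h1.2
  · have : (t₁ ^ 2 + t₂ * t₃) * (g I100 I100 * g I010 I010 - g I100 I010 * g I010 I100) = 0 := by
      linear_combination (-1) * ((t₂ * g I100 I010 + (1 - t₁) * g I010 I010) * e1 +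
        (g I100 I100 + g I100 I010) * e4 - (t₂ * g I100 I100 + (1 - t₁) * g I010 I100) * e3 -
        g I100 I010 * e2)
    exact (mul_eq_zero.1 this).resolve_right hΔ

theorem equivalent_d2_iff (t₁ t₂ t₃ : ℂ) : Equivalent groundBase
    (dt 1 + (phi I101 0 t₁ - phi I011 1 t₁) + phi I101 1 t₂ + phi I011 0 t₃) d2 ↔
      (t₁ ≠ 0 ∨ t₂ ≠ 0 ∨ t₃ ≠ 0) ∧ t₁ ^ 2 + t₂ * t₃ = 0 := by
  rw [dJ_eq, d2_eq]
  exact ⟨equivalent_dJ_imp, fun h => (autEquiv_dJ h.1 h.2).equivalent⟩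

end LInfinity

end

theorem mainTheorem4 :
    (∀ l : ℂ, l ≠ 1 → l ≠ -1 →
      Module.finrank ℂ (LInfinity.Cohomology (LInfinity.dt l) 1) = 4 ∧
      Module.finrank ℂ (LInfinity.Cohomology (LInfinity.dt l) 2) = 1 ∧
      Module.finrank ℂ (LInfinity.Cohomology (LInfinity.dt l) 3) = 0 ∧
      LInfinity.IsMiniversal.{0, u}
        (LInfinity.SuperSeries.base LInfinity.relGen LInfinity.relGen_aug)
        (LInfinity.dt l) (LInfinity.defGen l)) ∧
    (Module.finrank ℂ (LInfinity.Cohomology (LInfinity.dt (-1)) 1) = 4 ∧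
      Module.finrank ℂ (LInfinity.Cohomology (LInfinity.dt (-1)) 2) = 2 ∧
      Module.finrank ℂ (LInfinity.Cohomology (LInfinity.dt (-1)) 3) = 1 ∧
      LInfinity.IsMiniversal.{0, u}
        (LInfinity.SuperSeries.base LInfinity.relNeg LInfinity.relNeg_aug)
        (LInfinity.dt (-1)) LInfinity.defNeg ∧
      -- modulo the odd parameters, the only relation is `t₁t₂ = 0`
      (∀ r : MvPowerSeries (Fin 2) ℂ,
        LInfinity.SuperSeries.proj LInfinity.relNeg (algebraMap _ _ r) ∈
            TwoSidedIdeal.span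
              (Set.range fun i => LInfinity.SuperSeries.proj LInfinity.relNeg
                (LInfinity.SuperSeries.θ i)) ↔
          MvPowerSeries.X 0 * MvPowerSeries.X 1 ∣ r)) ∧
    (Module.finrank ℂ (LInfinity.Cohomology (LInfinity.dt 1) 1) = 6 ∧
      Module.finrank ℂ (LInfinity.Cohomology (LInfinity.dt 1) 2) = 3 ∧
      Module.finrank ℂ (LInfinity.Cohomology (LInfinity.dt 1) 3) = 0 ∧
      LInfinity.IsMiniversal.{0, u}
        (LInfinity.SuperSeries.base LInfinity.relOne LInfinity.relOne_aug)
        (LInfinity.dt 1) LInfinity.defOne ∧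
      -- the deformations `(t₁, t₂, t₃)` of `d̃_1` that are equivalent to `d_2`
      (∀ t₁ t₂ t₃ : ℂ,
        LInfinity.Equivalent LInfinity.groundBase
            (LInfinity.dt 1 + (LInfinity.phi LInfinity.I101 0 t₁ - LInfinity.phi LInfinity.I011 1 t₁)
              + LInfinity.phi LInfinity.I101 1 t₂ + LInfinity.phi LInfinity.I011 0 t₃)
            LInfinity.d2 ↔
          (t₁ ≠ 0 ∨ t₂ ≠ 0 ∨ t₃ ≠ 0) ∧ t₁ ^ 2 + t₂ * t₃ = 0)) := by
  open LInfinity in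
  exact ⟨fun l h1 h2 => ⟨finrank_cohomology_one h1, finrank_cohomology_two h1 h2,
      finrank_cohomology_three h2, isMiniversal_defGen h1 h2⟩,
    ⟨finrank_cohomology_one (by norm_num), finrank_cohomology_neg_two, finrank_cohomology_neg_three,
      isMiniversal_defNeg, mem_span_odd_iff⟩,
    ⟨finrank_cohomology_one_one, finrank_cohomology_one_two, finrank_cohomology_three (by norm_num),
      isMiniversal_defOne, equivalent_d2_iff⟩⟩
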